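/- Let $\mathbb E^m_1=\mathbb R^m$ and let $\mathbb E^m_2=\mathbb S^m$ be the unit sphere. Let $\pi_1:\mathbb R^3\to\mathbb R^2$ be the orthogonal projection $(x_1,x_2,x_3)\mapsto(x_1,x_2)$, and let $\pi_2:\mathbb S^3\to\mathbb S^2$ be the Hopf map $(z_1,z_2)\mapsto z_1/z_2$, where $\mathbb S^3\subset\mathbb C^2$ and $\mathbb S^2=\mathbb C\cup\{\infty\}$ by stereographic projection. Let $\mathcal F_1$ be the foliation of $\mathbb R^3$ by vertical lines, and $\mathcal F_2$ the foliation of $\mathbb S^3$ by its intersections with the complex lines of $\mathbb C^2$. Let $i\in\{1,2\}$ and let $\Gamma$ be a discrete group of isometries of $\mathbb E^3_i$ that acts freely on $\mathbb E^3_i$ and satisfies (a) $\Gamma$ maps leaves of $\mathcal F_i$ to leaves of $\mathcal F_i$. Then: (i) $\Gamma$ descends through $\pi_i$ to an action on $\mathbb E^2_i$ by a group $\Gamma'$ of isometries: there is a homomorphism $\rho:\Gamma\to\mathrm{Isom}(\mathbb E^2_i)$ with $\pi_i\circ\gamma=\rho(\gamma)\circ\pi_i$ for all $\gamma\in\Gamma$,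 and $\Gamma'=\rho(\Gamma)$. (ii) The quotient $M^3=\mathbb E^3_i/\Gamma$ is a connected complete Riemannian manifold for which the projection $\mathbb E^3_i\to M^3$ is a covering map and a local isometry. The images in $M^3$ of the leaves of $\mathcal F_i$ are the leaves of a Riemannian foliation $\mathcal F_{i,\Gamma}$ of $M^3$ by geodesics (that is, a foliation given locally by Riemannian submersions, whose leaves are geodesics). Its leaf space is $L^M=\mathbb E^2_i/\Gamma'$: the map $\pi_i$ factors to a quotient map $\pi_{i,\Gamma}:M^3\to L^M$ whose fibres are exactly the leaves of $\mathcal F_{i,\Gamma}$. Suppose further that (b1) for each $p\in\mathbb E^2_i$ the stabilizer $\Gamma'_p$ contains no reflection (in a line of $\mathbb R^2$ if $i=1$, in a great circle of $\mathbb S^2$ if $i=2$), and (b2) $\Gamma'$ acts discontinuously on $\mathbb E^2_i$: for each compact $K\subset\mathbb E^2_i$ only finitely many $\gamma\in\Gamma'$ satisfy $\gamma K\cap K\neq\emptyset$. Then: (iii) $L^M=\mathbb E^2_i/\Gamma'$, with the structure given by the projection $\mathbb E^2_i\to L^M$, is a Riemannian orbifold whose only possible singularities are cone points. (iv) $L^M$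 has a smoothing, that is, a $C^\infty$ conformal structure on the topological space $L^M$ such that, if $L^M_s$ denotes $L^M$ with this structure, the identity map $I:L^M\to L^M_s$ is smooth and conformal away from the cone points. The map $\pi_{i,\Gamma}:M^3\to L^M$ is continuous, its composition with $\mathbb E^3_i\to M^3$ equals the composition of $\pi_i$ with $\mathbb E^2_i\to L^M$, and for every smoothing the composition $I\circ\pi_{i,\Gamma}:M^3\to L^M_s$ is a smooth harmonic morphism: it is smooth, and if $f$ is a harmonic function on an open set $V\subset L^M_s$, then $f\circ I\circ\pi_{i,\Gamma}$ is harmonic on the preimage of $V$. -/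

import Mathlib

open scoped Manifold ContDiff Topology

noncomputable section

namespace StandardFoliation

/-! ### Riemannian geometry in coordinates -/

section Riemannian

variable {n : ℕ} {M : Type} [TopologicalSpace M] [ChartedSpace (EuclideanSpace ℝ (Fin n)) M]

/-- A smooth Riemannian metric on a smooth `n`-manifold without boundary. -/
abbrev RiemMetric (n : ℕ) (M : Type) [TopologicalSpace M] [ChartedSpace (EuclideanSpace ℝ (Fin n)) M]
    [IsManifold (𝓡 n) ∞ M] : Type :=
  Bundle.ContMDiffRiemannianMetric (𝓡 n) ∞ (EuclideanSpace ℝ (Fin n))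
    (fun x : M => TangentSpace (𝓡 n) x)

/-- The partial derivative `∂ᵢ F` of a real function of `n` real variables. -/
def partialDeriv (i : Fin n) (F : EuclideanSpace ℝ (Fin n) → ℝ) (y : EuclideanSpace ℝ (Fin n)) :
    ℝ :=
  fderiv ℝ F y (EuclideanSpace.single i 1)

variable [IsManifold (𝓡 n) ∞ M]

/-- The matrix `(g_ij)` of the metric in the preferred chart at `x`, as a function of the
coordinates `y`. -/
def coordMetric (g : RiemMetric n M) (x : M) (y : EuclideanSpace ℝ (Fin n)) :
    Matrix (Fin n) (Fin n) ℝ :=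
  Matrix.of fun i j =>
    g.inner ((extChartAt (𝓡 n) x).symm y)
      (mfderiv (𝓡 n) (𝓡 n) (extChartAt (𝓡 n) x).symm y
        (EuclideanSpace.single i 1 : EuclideanSpace ℝ (Fin n)))
      (mfderiv (𝓡 n) (𝓡 n) (extChartAt (𝓡 n) x).symm y
        (EuclideanSpace.single j 1 : EuclideanSpace ℝ (Fin n)))

/-- The Christoffel symbols
`Γᵏᵢⱼ = ½ ∑ₗ gᵏˡ (∂ᵢ g_jl + ∂ⱼ g_il - ∂ₗ g_ij)` in the preferred chart at `x`. -/
def christoffel (g : RiemMetric n M) (x : M) (k i j : Fin n) (y : EuclideanSpace ℝ (Fin n)) : ℝ :=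
  (1 / 2) * ∑ l, (coordMetric g x y)⁻¹ k l *
    (partialDeriv i (fun z => coordMetric g x z j l) y
      + partialDeriv j (fun z => coordMetric g x z i l) y
      - partialDeriv l (fun z => coordMetric g x z i j) y)

/-- The Laplace–Beltrami operator
`Δ f = ∑ᵢⱼ gⁱʲ (∂ᵢ ∂ⱼ f - ∑ₖ Γᵏᵢⱼ ∂ₖ f)`, evaluated at `x` in the preferred chart at `x`. -/
def laplaceBeltrami (g : RiemMetric n M) (f : M → ℝ) (x : M) : ℝ :=
  let F : EuclideanSpace ℝ (Fin n) → ℝ := f ∘ (extChartAt (𝓡 n) x).symm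
  let y₀ := extChartAt (𝓡 n) x x
  ∑ i, ∑ j, (coordMetric g x y₀)⁻¹ i j *
    (partialDeriv i (partialDeriv j F) y₀ - ∑ k, christoffel g x k i j y₀ * partialDeriv k F y₀)

/-- `f` is a harmonic function on the open set `V` of the Riemannian manifold `(M, g)`. -/
def IsHarmonicOn (g : RiemMetric n M) (f : M → ℝ) (V : Set M) : Prop :=
  ContMDiffOn (𝓡 n) 𝓘(ℝ, ℝ) 2 f V ∧ ∀ x ∈ V, laplaceBeltrami g f x = 0

/-- The velocity of a curve, as a tangent vector. -/
def velocity (c : ℝ → M) (t : ℝ) : TangentSpace (𝓡 n) (c t) :=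
  mfderiv 𝓘(ℝ, ℝ) (𝓡 n) c t (1 : ℝ)

/-- A complete geodesic: a smooth curve `c : ℝ → M` satisfying
`c''ᵏ + ∑ᵢⱼ Γᵏᵢⱼ(c) c'ⁱ c'ʲ = 0` at each time `t`, in the preferred chart at `c t`. -/
def IsGeodesic (g : RiemMetric n M) (c : ℝ → M) : Prop :=
  ContMDiff 𝓘(ℝ, ℝ) (𝓡 n) ∞ c ∧
    ∀ t : ℝ, ∀ k : Fin n,
      let u : ℝ → EuclideanSpace ℝ (Fin n) := fun s => extChartAt (𝓡 n) (c t) (c s)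
      deriv (deriv u) t k
        + ∑ i, ∑ j, christoffel g (c t) k i j (u t) * (deriv u t i * deriv u t j) = 0

/-- `(M, g)` is (geodesically) complete: each initial velocity is that of a geodesic defined for
all times. -/
def IsGeodesicallyComplete (g : RiemMetric n M) : Prop :=
  ∀ (x : M) (v : TangentSpace (𝓡 n) x), ∃ c : ℝ → M, IsGeodesic g c ∧
    (⟨c 0, velocity c 0⟩ : TangentBundle (𝓡 n) M) = ⟨x, v⟩

/-- `h` is a smooth Riemannian metric on the (open) set `U` of `ℝᵏ`. -/
structure IsMetricOn {k : ℕ} (U : Set (EuclideanSpace ℝ (Fin k)))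
    (h : EuclideanSpace ℝ (Fin k) →
      EuclideanSpace ℝ (Fin k) →L[ℝ] EuclideanSpace ℝ (Fin k) →L[ℝ] ℝ) : Prop where
  contDiffOn : ContDiffOn ℝ ∞ h U
  symm : ∀ y ∈ U, ∀ v w, h y v w = h y w v
  pos : ∀ y ∈ U, ∀ v, v ≠ 0 → 0 < h y v v

/-- `s` restricts to a Riemannian submersion of the open set `W` of `(M, g)` onto the open set
`s '' W` of `ℝᵏ` with the Riemannian metric `h`: it is a smooth submersion and its differential
is isometric on the orthogonal complement of its kernel. -/
structure IsRiemannianSubmersionOn {k : ℕ} (g : RiemMetric n M) (W : Set M)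
    (s : M → EuclideanSpace ℝ (Fin k))
    (h : EuclideanSpace ℝ (Fin k) →
      EuclideanSpace ℝ (Fin k) →L[ℝ] EuclideanSpace ℝ (Fin k) →L[ℝ] ℝ) : Prop where
  contMDiffOn : ContMDiffOn (𝓡 n) 𝓘(ℝ, EuclideanSpace ℝ (Fin k)) ∞ s W
  isOpen_image : IsOpen (s '' W)
  isMetricOn : IsMetricOn (s '' W) h
  surjective : ∀ y ∈ W,
    Function.Surjective (mfderiv (𝓡 n) 𝓘(ℝ, EuclideanSpace ℝ (Fin k)) s y)
  isometric : ∀ y ∈ W, ∀ v w : TangentSpace (𝓡 n) y,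
    (∀ u, mfderiv (𝓡 n) 𝓘(ℝ, EuclideanSpace ℝ (Fin k)) s y u = 0 → g.inner y u v = 0) →
    (∀ u, mfderiv (𝓡 n) 𝓘(ℝ, EuclideanSpace ℝ (Fin k)) s y u = 0 → g.inner y u w = 0) →
    h (s y) (mfderiv (𝓡 n) 𝓘(ℝ, EuclideanSpace ℝ (Fin k)) s y v)
        (mfderiv (𝓡 n) 𝓘(ℝ, EuclideanSpace ℝ (Fin k)) s y w) = g.inner y v w

/-- The leaf through `x` of a distribution `D` of tangent subspaces: the points that can be joined
to `x` by a smooth curve tangent to `D`. -/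
def leafThrough (D : ∀ x : M, Submodule ℝ (TangentSpace (𝓡 n) x)) (x : M) : Set M :=
  {y | ∃ c : ℝ → M, ContMDiff 𝓘(ℝ, ℝ) (𝓡 n) ∞ c ∧ (∀ t, velocity (n := n) c t ∈ D (c t)) ∧
    c 0 = x ∧ c 1 = y}

/-- The sets in `leaves` are the leaves of a Riemannian foliation of `(M, g)` of codimension `k`,
and they are geodesics. The foliation is given by its distribution `D` of tangent spaces, which is
locally the kernel of the differential of a Riemannian submersion; its leaves are the connected
integral manifolds of `D`; each of them is the image of a complete regular geodesic. -/
structure IsRiemannianFoliationByGeodesics (g : RiemMetric n M) (k : ℕ)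
    (D : ∀ x : M, Submodule ℝ (TangentSpace (𝓡 n) x)) (leaves : Set (Set M)) : Prop where
  local_submersion : ∀ x : M, ∃ W : Set M, IsOpen W ∧ x ∈ W ∧
    ∃ (s : M → EuclideanSpace ℝ (Fin k))
      (h : EuclideanSpace ℝ (Fin k) →
        EuclideanSpace ℝ (Fin k) →L[ℝ] EuclideanSpace ℝ (Fin k) →L[ℝ] ℝ),
      IsRiemannianSubmersionOn g W s h ∧
      ∀ y ∈ W, ∀ v : TangentSpace (𝓡 n) y,
        v ∈ D y ↔ mfderiv (𝓡 n) 𝓘(ℝ, EuclideanSpace ℝ (Fin k)) s y v = 0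
  leaves_eq : leaves = Set.range (leafThrough D)
  geodesic : ∀ A ∈ leaves, ∃ c : ℝ → M, IsGeodesic g c ∧
    (∀ t, velocity (n := n) c t ∈ D (c t) ∧ velocity (n := n) c t ≠ 0) ∧ Set.range c = A

end Riemannian

/-! ### Conformal surfaces and harmonic morphisms -/

section Conformal

/-- `L` is a surface with a `C^∞` conformal structure: the transition maps of its atlas, between
open sets of `ℂ = ℝ²`, are smooth and conformal (they may reverse the orientation). -/
def IsConformalSurface (L : Type) [TopologicalSpace L] [ChartedSpace ℂ L] : Prop :=
  IsManifold 𝓘(ℝ, ℂ) ∞ L ∧ HasGroupoid L (conformalGroupoid (X := ℂ))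

/-- `f` is a harmonic function on the open set `V` of a conformal surface. (In dimension two
harmonicity is conformally invariant, so it is tested in the conformal charts.) -/
def IsHarmonicOnSurface {L : Type} [TopologicalSpace L] [ChartedSpace ℂ L]
    (f : L → ℝ) (V : Set L) : Prop :=
  ∀ ψ ∈ atlas ℂ L,
    InnerProductSpace.HarmonicOnNhd (f ∘ ψ.symm) (ψ.target ∩ ψ.symm ⁻¹' V)

/-- A smooth harmonic morphism from a Riemannian manifold to a conformal surface: a smooth map
that pulls back harmonic functions on open sets to harmonic functions. -/
def IsSmoothHarmonicMorphism {n : ℕ} {M : Type} [TopologicalSpace M]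
    [ChartedSpace (EuclideanSpace ℝ (Fin n)) M] [IsManifold (𝓡 n) ∞ M] (g : RiemMetric n M)
    {L : Type} [TopologicalSpace L] [ChartedSpace ℂ L] (φ : M → L) : Prop :=
  ContMDiff (𝓡 n) 𝓘(ℝ, ℂ) ∞ φ ∧
    ∀ (V : Set L) (f : L → ℝ), IsOpen V → IsHarmonicOnSurface f V →
      IsHarmonicOn g (f ∘ φ) (φ ⁻¹' V)

end Conformal

/-! ### Two-dimensional Riemannian orbifolds -/

/-- A chart of a 2-dimensional Riemannian orbifold with underlying space `L`: a connected open set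
`dom` of `ℝ²` with a Riemannian metric, a finite group of orthogonal transformations which preserves
`dom` and acts on it by isometries of the metric, and a map `proj` which induces a homeomorphism
of the quotient of `dom` by the group onto an open set of `L`. -/
structure OrbifoldChart (L : Type) [TopologicalSpace L] where
  dom : Set (EuclideanSpace ℝ (Fin 2))
  isOpen_dom : IsOpen dom
  isConnected_dom : IsConnected dom
  metric : EuclideanSpace ℝ (Fin 2) →
    EuclideanSpace ℝ (Fin 2) →L[ℝ] EuclideanSpace ℝ (Fin 2) →L[ℝ] ℝ
  isMetricOn : IsMetricOn dom metric
  group : Subgroup (EuclideanSpace ℝ (Fin 2) ≃ₗᵢ[ℝ] EuclideanSpace ℝ (Fin 2))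
  finite_group : Finite group
  mapsTo : ∀ a ∈ group, ∀ u ∈ dom, a u ∈ dom
  isometric : ∀ a ∈ group, ∀ u ∈ dom, ∀ v w, metric (a u) (a v) (a w) = metric u v w
  proj : EuclideanSpace ℝ (Fin 2) → L
  continuousOn_proj : ContinuousOn proj dom
  isOpen_image : ∀ V ⊆ dom, IsOpen V → IsOpen (proj '' V)
  proj_eq_iff : ∀ u ∈ dom, ∀ v ∈ dom, proj u = proj v ↔ ∃ a ∈ group, a u = v

/-- A 2-dimensional Riemannian orbifold with underlying space `L`: a Hausdorff second countable
space covered by orbifold charts, any two of which are related, near points with the same image, by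
a local isometry commuting with the projections to `L`. -/
structure RiemannianOrbifold (L : Type) [TopologicalSpace L] where
  t2 : T2Space L
  secondCountable : SecondCountableTopology L
  charts : Set (OrbifoldChart L)
  covering : ∀ l : L, ∃ c ∈ charts, ∃ u ∈ c.dom, c.proj u = l
  compatible : ∀ c ∈ charts, ∀ c' ∈ charts, ∀ u ∈ c.dom, ∀ u' ∈ c'.dom, c.proj u = c'.proj u' →
    ∃ τ : EuclideanSpace ℝ (Fin 2) → EuclideanSpace ℝ (Fin 2), τ u = u' ∧
      ∀ᶠ y in 𝓝 u, τ y ∈ c'.dom ∧ c'.proj (τ y) = c.proj y ∧ ContDiffAt ℝ ∞ τ y ∧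
        ∀ v w, c'.metric (τ y) (fderiv ℝ τ y v) (fderiv ℝ τ y w) = c.metric y v w

namespace RiemannianOrbifold

variable {L : Type} [TopologicalSpace L]

/-- All singularities of the orbifold are cone points: the local groups consist of rotations. -/
def OnlyConePoints (O : RiemannianOrbifold L) : Prop :=
  ∀ c ∈ O.charts, ∀ u ∈ c.dom, ∀ a ∈ c.group, a u = u →
    LinearMap.det (a.toLinearEquiv : EuclideanSpace ℝ (Fin 2) →ₗ[ℝ] EuclideanSpace ℝ (Fin 2)) = 1

/-- The orbifold is the quotient, by the projection `p : Y → L`, of the Riemannian surface `Y`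
isometrically embedded in the Euclidean space `E` by `κ`: near points with the same image in `L`,
each orbifold chart is related to `Y` by a local isometry commuting with the projections to `L`. -/
def IsQuotientOf {Y E : Type} [NormedAddCommGroup E] [InnerProductSpace ℝ E]
    (O : RiemannianOrbifold L) (κ : Y → E) (p : Y → L) : Prop :=
  ∀ c ∈ O.charts, ∀ u ∈ c.dom, ∀ y : Y, p y = c.proj u →
    ∃ τ : EuclideanSpace ℝ (Fin 2) → Y, τ u = y ∧
      ∀ᶠ z in 𝓝 u, p (τ z) = c.proj z ∧ ContDiffAt ℝ ∞ (κ ∘ τ) z ∧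
        ∀ v w, inner ℝ (fderiv ℝ (κ ∘ τ) z v) (fderiv ℝ (κ ∘ τ) z w) = c.metric z v w

/-- The atlas on `L` is that of a smoothed orbifold associated to the Riemannian orbifold:
it is a `C^∞` conformal structure on the topological space `L`, for which the identity map is
smooth and conformal at all points which are not singular points of the orbifold. -/
def IsSmoothedBy (O : RiemannianOrbifold L) [ChartedSpace ℂ L] : Prop :=
  IsConformalSurface L ∧
    ∀ c ∈ O.charts, ∀ u ∈ c.dom, (∀ a ∈ c.group, a u = u → a = 1) →
      ∀ ψ ∈ atlas ℂ L, c.proj u ∈ ψ.source →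
        ContDiffAt ℝ ∞ (ψ ∘ c.proj) u ∧
        ∃ r : ℝ, 0 < r ∧ ∀ v w,
          inner ℝ (fderiv ℝ (ψ ∘ c.proj) u v) (fderiv ℝ (ψ ∘ c.proj) u w) = r * c.metric u v w

end RiemannianOrbifold

/-! ### Groups of isometries -/

section Groups

variable {X : Type} [MetricSpace X]

/-- The group is discrete in the topology of uniform convergence on compact sets. -/
def IsDiscreteGroup (Γ : Subgroup (X ≃ᵢ X)) : Prop :=
  DiscreteTopology ((fun a : X ≃ᵢ X => (⟨a, a.continuous⟩ : C(X, X))) '' (Γ : Set (X ≃ᵢ X)))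

def ActsFreely (Γ : Subgroup (X ≃ᵢ X)) : Prop :=
  ∀ a ∈ Γ, ∀ x : X, a x = x → a = 1

def ActsDiscontinuously (Γ : Subgroup (X ≃ᵢ X)) : Prop :=
  ∀ K : Set X, IsCompact K → {a : X ≃ᵢ X | a ∈ Γ ∧ (a '' K ∩ K).Nonempty}.Finite

/-- The group maps leaves to leaves. -/
def PreservesLeaves (Γ : Subgroup (X ≃ᵢ X)) (leaves : Set (Set X)) : Prop :=
  ∀ a ∈ Γ, ∀ A ∈ leaves, a '' A ∈ leaves

def orbitSetoid (Γ : Subgroup (X ≃ᵢ X)) : Setoid X where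
  r x y := ∃ a ∈ Γ, a x = y
  iseqv :=
    { refl := fun _ => ⟨1, Γ.one_mem, rfl⟩
      symm := by
        rintro x y ⟨a, ha, rfl⟩
        exact ⟨a⁻¹, Γ.inv_mem ha, a.symm_apply_apply x⟩
      trans := by
        rintro x y z ⟨a, ha, rfl⟩ ⟨b, hb, rfl⟩
        exact ⟨b * a, Γ.mul_mem hb ha, rfl⟩ }

/-- The orbit space `X / Γ`, with the quotient topology. -/
abbrev OrbitSpace (Γ : Subgroup (X ≃ᵢ X)) : Type := Quotient (orbitSetoid Γ)

/-- The projection `X → X / Γ`. -/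
def orbitProj (Γ : Subgroup (X ≃ᵢ X)) (x : X) : OrbitSpace Γ := Quotient.mk (orbitSetoid Γ) x

/-- The group `Γ'` of the isometries of `Y` to which the elements of `Γ` descend through
`π : X → Y`. -/
def descendedGroup {Y : Type} [MetricSpace Y] (π : X → Y) (Γ : Subgroup (X ≃ᵢ X)) :
    Subgroup (Y ≃ᵢ Y) where
  carrier := {b | ∃ a ∈ Γ, ∀ x, π (a x) = b (π x)}
  one_mem' := ⟨1, Γ.one_mem, fun _ => rfl⟩
  mul_mem' := by
    rintro b b' ⟨a, ha, h⟩ ⟨a', ha', h'⟩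
    refine ⟨a * a', Γ.mul_mem ha ha', fun x => ?_⟩
    rw [IsometryEquiv.mul_apply, IsometryEquiv.mul_apply, h, h']
  inv_mem' := by
    rintro b ⟨a, ha, h⟩
    refine ⟨a⁻¹, Γ.inv_mem ha, fun x => ?_⟩
    have := h (a⁻¹ x)
    rw [IsometryEquiv.apply_inv_self] at this
    rw [this, IsometryEquiv.inv_apply_self]

/-- The images in `X / Γ` of the given leaves. -/
def quotientLeaves (Γ : Subgroup (X ≃ᵢ X)) (leaves : Set (Set X)) : Set (Set (OrbitSpace Γ)) :=
  {A | ∃ B ∈ leaves, A = orbitProj Γ '' B}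

/-- `(M, g)` is the Riemannian quotient, by the covering map `q : X → M`, of the Riemannian manifold
`X` isometrically embedded in the Euclidean space `E` by `ι`: `M` is a Hausdorff second
countable manifold and `q` is a covering map, a local diffeomorphism and a local isometry. -/
structure IsRiemannianQuotient {n : ℕ} [ChartedSpace (EuclideanSpace ℝ (Fin n)) X]
    {E : Type} [NormedAddCommGroup E] [InnerProductSpace ℝ E] (ι : X → E)
    {M : Type} [TopologicalSpace M] [ChartedSpace (EuclideanSpace ℝ (Fin n)) M]
    [IsManifold (𝓡 n) ∞ M] (q : X → M) (g : RiemMetric n M) : Prop where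
  t2 : T2Space M
  secondCountable : SecondCountableTopology M
  isCoveringMap : IsCoveringMap q
  isLocalDiffeomorph : IsLocalDiffeomorph (𝓡 n) (𝓡 n) ∞ q
  isometric : ∀ (x : X) (v w : TangentSpace (𝓡 n) x),
    g.inner (q x) (mfderiv (𝓡 n) (𝓡 n) q x v) (mfderiv (𝓡 n) (𝓡 n) q x w) =
      inner (E := E) ℝ (mfderiv (𝓡 n) 𝓘(ℝ, E) ι x v) (mfderiv (𝓡 n) 𝓘(ℝ, E) ι x w)

/-- `L` is the leaf space, with the quotient topology, of the decomposition of `M` into `leaves`,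
with projection `ϖ : M → L`. -/
def IsLeafSpace {M L : Type} [TopologicalSpace M] [TopologicalSpace L]
    (leaves : Set (Set M)) (ϖ : M → L) : Prop :=
  Topology.IsQuotientMap ϖ ∧ leaves = {A | ∃ l : L, A = ϖ ⁻¹' {l}}

end Groups

/-! ### The two standard foliations and harmonic morphisms -/

abbrev R2 : Type := EuclideanSpace ℝ (Fin 2)

abbrev R3 : Type := EuclideanSpace ℝ (Fin 3)

abbrev R4 : Type := EuclideanSpace ℝ (Fin 4)

/-- The unit sphere `S²` of `ℝ³`. -/
abbrev S2 : Type := Metric.sphere (0 : R3) 1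

/-- The unit sphere `S³` of `ℝ⁴ = ℂ²`. -/
abbrev S3 : Type := Metric.sphere (0 : R4) 1

/-- Orthogonal projection `ℝ³ → ℝ²`. -/
def orthProj (x : R3) : R2 := !₂[x 0, x 1]

/-- The foliation of `ℝ³` by vertical lines. -/
def verticalLines : Set (Set R3) :=
  Set.range fun x : R3 => Set.range fun t : ℝ => x + t • EuclideanSpace.single (2 : Fin 3) (1 : ℝ)

/-- The first complex coordinate on `ℝ⁴ = ℂ²`. -/
def z₁ (x : R4) : ℂ := ⟨x 0, x 1⟩

/-- The second complex coordinate on `ℝ⁴ = ℂ²`. -/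
def z₂ (x : R4) : ℂ := ⟨x 2, x 3⟩

/-- The foliation of `S³` by the great circles in which it meets the complex lines of `ℂ²`. -/
def hopfCircles : Set (Set S3) :=
  Set.range fun x : S3 => {y : S3 | ∃ a : ℂ, z₁ y = a * z₁ x ∧ z₂ y = a * z₂ x}

/-- The Hopf map `S³ → S²`. In the coordinate of `S²` given by the stereographic projection
`(x₁ + i x₂) / (1 - x₃)` to `ℂ ∪ {∞}` it is `z₁ / z₂`. -/
def hopfMap (x : S3) : S2 :=
  ⟨!₂[2 * (z₁ x * (starRingEnd ℂ) (z₂ x)).re, 2 * (z₁ x * (starRingEnd ℂ) (z₂ x)).im,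
      Complex.normSq (z₁ x) - Complex.normSq (z₂ x)], by
    have hx : (x : R4) 0 ^ 2 + (x : R4) 1 ^ 2 + (x : R4) 2 ^ 2 + (x : R4) 3 ^ 2 = 1 := by
      have h := mem_sphere_zero_iff_norm.1 x.2
      rw [EuclideanSpace.norm_eq, Real.sqrt_eq_one, Fin.sum_univ_four] at h
      simpa using h
    rw [mem_sphere_zero_iff_norm, EuclideanSpace.norm_eq, Real.sqrt_eq_one, Fin.sum_univ_three]
    simp only [z₁, z₂, Real.norm_eq_abs, sq_abs, Complex.mul_re, Complex.mul_im, Complex.conj_re,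
      Complex.conj_im, Complex.normSq_mk, Matrix.cons_val_zero, Matrix.cons_val_one,
      Matrix.cons_val]
    have h2 : ((x : R4) 0 ^ 2 + (x : R4) 1 ^ 2 + (x : R4) 2 ^ 2 + (x : R4) 3 ^ 2) ^ 2 = 1 := by
      rw [hx, one_pow]
    linear_combination h2⟩

/-- Reflection of `ℝ²` in a line. -/
def IsPlaneReflection (b : R2 ≃ᵢ R2) : Prop :=
  ∃ (p : R2) (K : Submodule ℝ R2), Module.finrank ℝ K = 1 ∧
    ∀ x, b x = p + K.reflection (x - p)

/-- Reflection of `S²` in a great circle. -/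
def IsSphereReflection (b : S2 ≃ᵢ S2) : Prop :=
  ∃ K : Submodule ℝ R3, Module.finrank ℝ K = 2 ∧ ∀ x : S2, (b x : R3) = K.reflection (x : R3)

end StandardFoliation

end

open StandardFoliation

/-!
The two foliations are instances of one structure, `ModelFibration`, and the theorem is proved for
it. The idea is to use charts of the total space `X` and of the base `Y`, one centred at each point,
in which every isometry is *linear*: translations for Euclidean space, stereographic projections
from the antipode for the unit sphere (`ConformalCharts`). Their inverses pull the metric back to
`(4 / (4 + ε ‖u‖²))²` times the Euclidean one, with `ε = 0` or `1`; this factor is even in `u` and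
has the value `1` at the origin. For the Hopf map the frames defining the charts are chosen adapted
to the quaternion structure, and then `π` is given at all points, up to a linear isometry of the
base chart, by one explicit map `Q : ℝ³ → ℂ`, as it is trivially for the orthogonal projection.

A discrete group `Γ` acts discontinuously (`IsDiscreteGroup.actsDiscontinuously`), so the charts of
`X` induce charts of `X / Γ`. These are isometric at their centres and the Christoffel symbols
vanish there (`AdaptedAtlas.christoffel_zero`). Hence geodesics and Laplacians on the quotient can
be checked at the centres of the charts by Euclidean formulas: images of the geodesics of `X` are
geodesics, which gives completeness, and the projection to the base, in these charts `Q` followed by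
an isometry and a change of charts, is up to a constant factor a local Riemannian submersion whose
fibres are geodesics.

An isometry that permutes the fibres of `π` descends to an isometry of `Y`, because the distance of
`π x` from `y` is a function of the distance of `x` from the fibre over `y`
(`ModelFibration.exists_descent`).

If the descended group `Δ` acts discontinuously, a disc around each point `p` of `Y`, with the
stabilizer of `p` acting linearly on it, is an orbifold chart of `Y / Δ`. In the absence of
reflections the stabilizer is a finite group of rotations, say of order `n`, whose orbits are the
fibres of `z ↦ zⁿ` (`ConformalCharts.pow_order_eq_iff`); so `zⁿ` is a chart of the quotient at the
image of `p`, and these charts form a smoothing (`ConformalCharts.smoothing`).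

Finally, let any smoothing be given. One of its charts, in terms of the chart of `Y` at `p`, is
continuous at the origin, and smooth and conformal elsewhere near it. It is therefore holomorphic or
antiholomorphic on a punctured disc, and the singularity is removable
(`analyticAt_or_conj_of_conformal`). So the composite of a harmonic function with the projection of
`X / Γ` to `Y / Δ` is locally the real part of a holomorphic function of `Q`
(`ModelFibration.exists_descend_eq`), and at the centre of the chart its Laplacian vanishes, as the
components of `Q` are harmonic there and the differential of `Q` is, up to a factor, an orthogonal
projection (`ModelFibration.laplacian_re_comp_Q`).
-/

open scoped Manifold ContDiff Topology

noncomputable section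

namespace StandardFoliation

/-! ### Discontinuous groups of isometries and their orbit spaces -/

section Action

variable {X : Type} [MetricSpace X]

/-- The tautological action of the isometry group. -/
instance : MulAction (X ≃ᵢ X) X where
  smul a x := a x
  one_smul _ := rfl
  mul_smul _ _ _ := rfl

variable (Γ : Subgroup (X ≃ᵢ X))

instance : ContinuousConstSMul Γ X where
  continuous_const_smul a := (a : X ≃ᵢ X).continuous

lemma orbitSetoid_eq_orbitRel : orbitSetoid Γ = MulAction.orbitRel Γ X := by
  ext x y
  rw [MulAction.orbitRel_apply, MulAction.mem_orbit_symm]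
  constructor
  · rintro ⟨a, ha, h⟩
    exact ⟨⟨a, ha⟩, h⟩
  · rintro ⟨a, h⟩
    exact ⟨a, a.2, h⟩

variable {Γ}

lemma orbitProj_eq_iff {x y : X} : orbitProj Γ x = orbitProj Γ y ↔ ∃ a ∈ Γ, a x = y :=
  Quotient.eq (r := orbitSetoid Γ)

lemma orbitProj_apply {a : X ≃ᵢ X} (ha : a ∈ Γ) (x : X) : orbitProj Γ (a x) = orbitProj Γ x :=
  (orbitProj_eq_iff.2 ⟨a, ha, rfl⟩).symm

lemma orbitProj_surjective : Function.Surjective (orbitProj Γ) := Quotient.mk_surjective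

lemma isOpenQuotientMap_orbitProj : IsOpenQuotientMap (orbitProj Γ) := by
  have h := MulAction.isOpenQuotientMap_quotientMk (Γ := Γ) (T := X)
  rw [← orbitSetoid_eq_orbitRel] at h
  exact h

lemma continuous_orbitProj : Continuous (orbitProj Γ) := isOpenQuotientMap_orbitProj.continuous

lemma isOpenMap_orbitProj : IsOpenMap (orbitProj Γ) := isOpenQuotientMap_orbitProj.isOpenMap

lemma secondCountableTopology_orbitSpace [SecondCountableTopology X] :
    SecondCountableTopology (OrbitSpace Γ) := by
  unfold OrbitSpace
  rw [orbitSetoid_eq_orbitRel]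
  exact ContinuousConstSMul.secondCountableTopology

namespace ActsDiscontinuously

lemma properlyDiscontinuousSMul (hΓ : ActsDiscontinuously Γ) : ProperlyDiscontinuousSMul Γ X where
  finite_disjoint_inter_image {K L} hK hL := by
    refine ((hΓ _ (hK.union hL)).preimage
      (f := ((↑) : Γ → X ≃ᵢ X)) Subtype.val_injective.injOn).subset ?_
    rintro a ⟨_, ⟨x, hx, rfl⟩, hy⟩
    exact ⟨a.2, a • x, ⟨x, Or.inl hx, rfl⟩, Or.inr hy⟩

variable [LocallyCompactSpace X]

lemma t2Space_orbitSpace (hΓ : ActsDiscontinuously Γ) : T2Space (OrbitSpace Γ) := by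
  have := hΓ.properlyDiscontinuousSMul
  unfold OrbitSpace
  rw [orbitSetoid_eq_orbitRel]
  infer_instance

/-- Each point has a neighbourhood that meets its translates by elements of its stabilizer only. -/
lemma exists_nhds (hΓ : ActsDiscontinuously Γ) (x : X) :
    ∃ U ∈ 𝓝 x, ∀ a ∈ Γ, ∀ y ∈ U, a y ∈ U → a x = x := by
  have := hΓ.properlyDiscontinuousSMul
  obtain ⟨U, hU, h⟩ := ProperlyDiscontinuousSMul.exists_nhds_image_smul_eq_self Γ x
  exact ⟨U, hU, fun a ha y hy hay => h ⟨a, ha⟩ ⟨a y, ⟨y, hy, rfl⟩, hay⟩⟩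

omit [LocallyCompactSpace X] in
lemma finite_stabilizer (hΓ : ActsDiscontinuously Γ) (x : X) : {a | a ∈ Γ ∧ a x = x}.Finite :=
  (hΓ {x} isCompact_singleton).subset fun _ ha => ⟨ha.1, x, ⟨x, rfl, ha.2⟩, rfl⟩

lemma isCoveringMap_orbitProj (hΓ : ActsDiscontinuously Γ) (hfree : ActsFreely Γ) :
    IsCoveringMap (orbitProj Γ) := by
  have := hΓ.properlyDiscontinuousSMul
  have : IsCancelSMul Γ X := by
    rw [isCancelSMul_iff_eq_one_of_smul_eq]
    exact fun a x h => Subtype.ext (hfree a a.2 x h)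
  have h := isQuotientCoveringMap_quotientMk_of_properlyDiscontinuousSMul (G := Γ) (E := X)
  rw [← orbitSetoid_eq_orbitRel] at h
  exact h.isCoveringMap

end ActsDiscontinuously

/-- A discrete group of isometries of a proper metric space acts discontinuously: the elements
moving a compact set `K` to a set meeting `K` are determined, up to a small uniform error on `K`,
by the images of a finite net of `K` in a compact set, and two elements which are uniformly close
on `K` coincide. -/
lemma IsDiscreteGroup.actsDiscontinuously [ProperSpace X] (hΓ : IsDiscreteGroup Γ) :
    ActsDiscontinuously Γ := by
  intro K hK
  rcases isEmpty_or_nonempty X with hX | ⟨⟨x₀⟩⟩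
  · have : Subsingleton (X ≃ᵢ X) := ⟨fun a b => IsometryEquiv.ext fun x => hX.elim x⟩
    exact Set.toFinite _
  -- a compact set `C` and `ε > 0` such that an element moving points of `C` less than `ε` is `1`
  obtain ⟨C, ε, hC, hε, hC1⟩ : ∃ (C : Set X) (ε : ℝ), IsCompact C ∧ 0 < ε ∧
      ∀ a ∈ Γ, (∀ x ∈ C, dist (a x) x < ε) → a = 1 := by
    set j : (X ≃ᵢ X) → C(X, X) := fun a => ⟨a, a.continuous⟩ with hj
    have hj1 : j 1 ∈ j '' (Γ : Set (X ≃ᵢ X)) := ⟨1, Γ.one_mem, rfl⟩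
    have h := (discreteTopology_subtype_iff'.1 hΓ) (j 1) hj1
    obtain ⟨U, hU, hUΓ⟩ := h
    have hU' : U ∈ 𝓝 (j 1) := hU.mem_nhds (by
      have : j 1 ∈ U ∩ j '' (Γ : Set (X ≃ᵢ X)) := by rw [hUΓ]; rfl
      exact this.1)
    obtain ⟨⟨C, ε⟩, ⟨hC, hε⟩, hCU⟩ := (nhds_basis_uniformity
      (Metric.uniformity_basis_dist.compactConvergenceUniformity (α := X))).mem_iff.1 hU'
    refine ⟨C, ε, hC, hε, fun a ha h => ?_⟩
    have h1 : j a ∈ U ∩ j '' (Γ : Set (X ≃ᵢ X)) := ⟨hCU h, a, ha, rfl⟩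
    rw [hUΓ] at h1
    exact IsometryEquiv.ext fun x => congrArg (fun f : C(X, X) => f x) h1
  obtain ⟨R, hR⟩ := (hC.union hK).isBounded.subset_closedBall x₀
  obtain ⟨T, hTC, hT, hCT⟩ := Metric.finite_approx_of_totallyBounded hC.totallyBounded (ε / 3)
    (by positivity)
  obtain ⟨N, -, hN, hBN⟩ := Metric.finite_approx_of_totallyBounded
    (isCompact_closedBall x₀ (3 * R)).totallyBounded (ε / 6) (by positivity)
  -- an infinite set of elements contains two with the same approximate values on the net `T`
  by_contra hinf
  set S := {a : X ≃ᵢ X | a ∈ Γ ∧ (a '' K ∩ K).Nonempty} with hS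
  have : Infinite S := Set.infinite_coe_iff.2 hinf
  have : Finite T := hT
  have : Finite N := hN
  have hnet : ∀ (a : S) (t : T), ∃ n : N, dist ((a : X ≃ᵢ X) t) n < ε / 6 := by
    rintro ⟨a, ha, _, ⟨y, hy, rfl⟩, hay⟩ ⟨t, ht⟩
    have h1 : dist y x₀ ≤ R := hR (Or.inr hy)
    have h2 : dist (a y) x₀ ≤ R := hR (Or.inr hay)
    have h3 : dist t x₀ ≤ R := hR (Or.inl (hTC ht))
    have h4 : dist (a t) (a y) = dist t y := a.dist_eq t y
    have h5 : a t ∈ Metric.closedBall x₀ (3 * R) := by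
      rw [Metric.mem_closedBall]
      linarith [dist_triangle (a t) (a y) x₀, dist_triangle_right t y x₀]
    obtain ⟨n, hn, hd⟩ := Set.mem_iUnion₂.1 (hBN h5)
    exact ⟨⟨n, hn⟩, hd⟩
  choose f hf using hnet
  obtain ⟨a, b, hab, hfab⟩ := Finite.exists_ne_map_eq_of_infinite f
  refine hab (Subtype.ext ?_)
  rw [← inv_mul_eq_one, ← inv_inj, mul_inv_rev, inv_inv, inv_one]
  refine hC1 _ (Γ.mul_mem (Γ.inv_mem b.2.1) a.2.1) fun x hx => ?_
  obtain ⟨t, ht, hxt⟩ := Set.mem_iUnion₂.1 (hCT hx)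
  rw [Metric.mem_ball] at hxt
  have h1 := hf a ⟨t, ht⟩
  have h2 := hf b ⟨t, ht⟩
  rw [← hfab] at h2
  have h3 : dist (((b : X ≃ᵢ X)⁻¹ * a) x) x = dist ((a : X ≃ᵢ X) x) ((b : X ≃ᵢ X) x) := by
    rw [← (b : X ≃ᵢ X).dist_eq, IsometryEquiv.mul_apply, IsometryEquiv.apply_inv_self]
  have h4 : dist ((a : X ≃ᵢ X) x) ((a : X ≃ᵢ X) t) = dist x t := (a : X ≃ᵢ X).dist_eq x t
  have h5 : dist ((b : X ≃ᵢ X) x) ((b : X ≃ᵢ X) t) = dist x t := (b : X ≃ᵢ X).dist_eq x t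
  simp only at h1 h2
  rw [h3]
  linarith [dist_triangle ((a : X ≃ᵢ X) x) ((a : X ≃ᵢ X) t) ((b : X ≃ᵢ X) x),
    dist_triangle_right ((a : X ≃ᵢ X) t) ((b : X ≃ᵢ X) t) (f a ⟨t, ht⟩ : X),
    dist_triangle ((a : X ≃ᵢ X) t) ((b : X ≃ᵢ X) t) ((b : X ≃ᵢ X) x),
    dist_comm ((b : X ≃ᵢ X) x) ((b : X ≃ᵢ X) t)]

end Action

/-! ### Conformal charts adapted to the isometry group -/

/-- The conformal factor `(4 / (4 + ε ‖u‖²))²` of the Euclidean metric (`ε = 0`) and of the metric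
of the unit sphere in stereographic coordinates (`ε = 1`). -/
def confFactor {V : Type} [NormedAddCommGroup V] (ε : ℝ) (u : V) : ℝ :=
  (4 / (4 + ε * ‖u‖ ^ 2)) ^ 2

section confFactor

variable {V : Type} [NormedAddCommGroup V] {ε : ℝ}

lemma confFactor_pos (hε : 0 ≤ ε) (u : V) : 0 < confFactor ε u := by
  unfold confFactor
  positivity

lemma confFactor_zero : confFactor ε (0 : V) = 1 := by
  simp [confFactor]

lemma confFactor_congr {W : Type} [NormedAddCommGroup W] {u : V} {w : W} (h : ‖u‖ = ‖w‖) :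
    confFactor ε u = confFactor ε w := by
  simp [confFactor, h]

variable [InnerProductSpace ℝ V]

lemma contDiff_confFactor (hε : 0 ≤ ε) : ContDiff ℝ ∞ (confFactor ε : V → ℝ) := by
  unfold confFactor
  refine (contDiff_const.div (contDiff_const.add (contDiff_const.mul (contDiff_norm_sq ℝ)))
    fun u => ?_).pow 2
  positivity

lemma fderiv_confFactor_zero (hε : 0 ≤ ε) : fderiv ℝ (confFactor ε : V → ℝ) 0 = 0 := by
  -- the function is even
  have h : (confFactor ε : V → ℝ) = confFactor ε ∘ Neg.neg := by
    ext u
    simp [confFactor]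
  have hd : HasFDerivAt (confFactor ε : V → ℝ) (fderiv ℝ (confFactor ε : V → ℝ) 0) 0 :=
    ((contDiff_confFactor hε).differentiable (by simp) 0).hasFDerivAt
  have h2 : HasFDerivAt (confFactor ε : V → ℝ) (-fderiv ℝ (confFactor ε : V → ℝ) 0) 0 := by
    have h3 : HasFDerivAt (Neg.neg : V → V) (-ContinuousLinearMap.id ℝ V) 0 :=
      (hasFDerivAt_id (𝕜 := ℝ) (0 : V)).neg
    have h4 := HasFDerivAt.comp (g := (confFactor ε : V → ℝ)) (0 : V) (by simpa using hd) h3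
    rw [← h] at h4
    simpa using h4
  have h5 := hd.unique h2
  ext v
  have := congrArg (fun f : V →L[ℝ] ℝ => f v) h5
  simp only [neg_apply] at this
  simp only [zero_apply]
  linarith

end confFactor

/-- Charts `Y → ℝᵏ`, one centred at each point, of a Riemannian manifold `Y` isometrically embedded
in the Euclidean space `E` by `κ`: their inverses are defined on all of `ℝᵏ` and pull the metric
back to a multiple of the Euclidean metric which is the same for all charts, and all isometries of
`Y` are linear in them. The smoothness of the charts is expressed by smooth extensions to `E`, so
that no smooth structure on `Y` is needed. -/
structure ConformalCharts (k : ℕ) (ε : ℝ) {Y E : Type} [MetricSpace Y] [NormedAddCommGroup E]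
    [InnerProductSpace ℝ E] (κ : Y → E) where
  chart : Y → OpenPartialHomeomorph Y (EuclideanSpace ℝ (Fin k))
  nonneg : 0 ≤ ε
  mem_source : ∀ y, y ∈ (chart y).source
  chart_self : ∀ y, chart y y = 0
  target_eq : ∀ y, (chart y).target = Set.univ
  contDiff_symm : ∀ y, ContDiff ℝ ∞ (κ ∘ (chart y).symm)
  inner_fderiv : ∀ y u v w, inner ℝ (fderiv ℝ (κ ∘ (chart y).symm) u v)
    (fderiv ℝ (κ ∘ (chart y).symm) u w) = confFactor ε u * inner ℝ v w
  smooth_extension : ∀ y, ∃ F : E → EuclideanSpace ℝ (Fin k),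
    ∀ z ∈ (chart y).source, ContDiffAt ℝ ∞ F (κ z) ∧ F (κ z) = chart y z
  isometry_linear : ∀ (a : Y ≃ᵢ Y) (y : Y),
    ∃ A : EuclideanSpace ℝ (Fin k) ≃ₗᵢ[ℝ] EuclideanSpace ℝ (Fin k),
      ∀ u, a ((chart y).symm u) = (chart (a y)).symm (A u)

namespace ConformalCharts

variable {k : ℕ} {ε : ℝ} {Y E : Type} [MetricSpace Y] [NormedAddCommGroup E]
  [InnerProductSpace ℝ E] {κ : Y → E} (C : ConformalCharts k ε κ)

/-- The inverse of the chart at `y`. -/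
def param (y : Y) (u : EuclideanSpace ℝ (Fin k)) : Y := (C.chart y).symm u

lemma mem_target (y : Y) (u : EuclideanSpace ℝ (Fin k)) : u ∈ (C.chart y).target := by
  rw [C.target_eq]
  trivial

@[simp] lemma param_zero (y : Y) : C.param y 0 = y := by
  rw [param, ← C.chart_self y, (C.chart y).left_inv (C.mem_source y)]

@[simp] lemma chart_param (y : Y) (u : EuclideanSpace ℝ (Fin k)) :
    C.chart y (C.param y u) = u := (C.chart y).right_inv (C.mem_target y u)

lemma param_mem_source (y : Y) (u : EuclideanSpace ℝ (Fin k)) :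
    C.param y u ∈ (C.chart y).source := (C.chart y).map_target (C.mem_target y u)

lemma param_chart {y z : Y} (hz : z ∈ (C.chart y).source) : C.param y (C.chart y z) = z :=
  (C.chart y).left_inv hz

lemma param_injective (y : Y) : Function.Injective (C.param y) := fun u v h => by
  rw [← C.chart_param y u, h, C.chart_param]

lemma continuous_param (y : Y) : Continuous (C.param y) := by
  rw [← continuousOn_univ, ← C.target_eq y]
  exact (C.chart y).continuousOn_symm

lemma isOpenMap_param (y : Y) : IsOpenMap (C.param y) := fun _ hU =>
  (C.chart y).symm.isOpen_image_of_subset_source hU fun u _ => C.mem_target y u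

lemma tendsto_param (y : Y) : Filter.Tendsto (C.param y) (𝓝 0) (𝓝 y) := by
  simpa using (C.continuous_param y).tendsto 0

/-- The change of coordinates from the chart at `y` to the chart at `y'`. -/
def transition (y y' : Y) (u : EuclideanSpace ℝ (Fin k)) : EuclideanSpace ℝ (Fin k) :=
  C.chart y' (C.param y u)

lemma param_transition {y y' : Y} {u : EuclideanSpace ℝ (Fin k)}
    (hu : C.param y u ∈ (C.chart y').source) : C.param y' (C.transition y y' u) = C.param y u :=
  C.param_chart hu

lemma isOpen_transition_source (y y' : Y) : IsOpen {u | C.param y u ∈ (C.chart y').source} :=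
  (C.chart y').open_source.preimage (C.continuous_param y)

lemma contDiffAt_transition {y y' : Y} {u : EuclideanSpace ℝ (Fin k)}
    (hu : C.param y u ∈ (C.chart y').source) : ContDiffAt ℝ ∞ (C.transition y y') u := by
  obtain ⟨F, hF⟩ := C.smooth_extension y'
  have h1 : ContDiffAt ℝ ∞ (F ∘ (κ ∘ C.param y)) u :=
    (hF _ hu).1.comp u (C.contDiff_symm y).contDiffAt
  refine h1.congr_of_eventuallyEq ?_
  filter_upwards [(C.isOpen_transition_source y y').mem_nhds hu] with v hv
  exact (hF _ hv).2.symm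

lemma differentiableAt_param (y : Y) (u : EuclideanSpace ℝ (Fin k)) :
    DifferentiableAt ℝ (κ ∘ C.param y) u := (C.contDiff_symm y).differentiable (by simp) u

lemma inner_fderiv_param (y : Y) (u v w : EuclideanSpace ℝ (Fin k)) :
    inner ℝ (fderiv ℝ (κ ∘ C.param y) u v) (fderiv ℝ (κ ∘ C.param y) u w) =
      confFactor ε u * inner ℝ v w := C.inner_fderiv y u v w

/-- The changes of coordinates preserve the common metric of the charts. -/
lemma inner_fderiv_transition {y y' : Y} {u : EuclideanSpace ℝ (Fin k)}
    (hu : C.param y u ∈ (C.chart y').source) (v w : EuclideanSpace ℝ (Fin k)) :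
    confFactor ε (C.transition y y' u) *
        inner ℝ (fderiv ℝ (C.transition y y') u v) (fderiv ℝ (C.transition y y') u w) =
      confFactor ε u * inner ℝ v w := by
  have hd : DifferentiableAt ℝ (C.transition y y') u :=
    (C.contDiffAt_transition hu).differentiableAt (by simp)
  have h : fderiv ℝ (κ ∘ C.param y) u =
      (fderiv ℝ (κ ∘ C.param y') (C.transition y y' u)).comp (fderiv ℝ (C.transition y y') u) := by
    rw [← fderiv_comp u (C.differentiableAt_param _ _) hd]
    refine Filter.EventuallyEq.fderiv_eq ?_
    filter_upwards [(C.isOpen_transition_source y y').mem_nhds hu] with v hv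
    simp only [Function.comp_apply, C.param_transition hv]
  rw [← C.inner_fderiv_param y u, ← C.inner_fderiv_param y', h]
  rfl

/-- The expression of the isometry `a` in the charts at `y` and at `a y`. -/
def linearPart (a : Y ≃ᵢ Y) (y : Y) : EuclideanSpace ℝ (Fin k) ≃ₗᵢ[ℝ] EuclideanSpace ℝ (Fin k) :=
  (C.isometry_linear a y).choose

lemma apply_param (a : Y ≃ᵢ Y) (y : Y) (u : EuclideanSpace ℝ (Fin k)) :
    a (C.param y u) = C.param (a y) (C.linearPart a y u) :=
  (C.isometry_linear a y).choose_spec u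

lemma chart_apply {a : Y ≃ᵢ Y} {y z : Y} (hz : z ∈ (C.chart y).source) :
    C.chart (a y) (a z) = C.linearPart a y (C.chart y z) := by
  rw [← C.param_chart hz, C.apply_param, C.chart_param, C.chart_param]

end ConformalCharts

/-- Euclidean space, with the charts given by translations. -/
def euclideanCharts (k : ℕ) :
    ConformalCharts k 0 (id : EuclideanSpace ℝ (Fin k) → EuclideanSpace ℝ (Fin k)) where
  chart y := (Homeomorph.subRight y).toOpenPartialHomeomorph
  nonneg := le_rfl
  mem_source _ := trivial
  chart_self y := sub_self y
  target_eq _ := rfl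
  contDiff_symm y := contDiff_id.add contDiff_const
  inner_fderiv y u v w := by
    have h : HasFDerivAt (id ∘ (Homeomorph.subRight y).toOpenPartialHomeomorph.symm)
        (ContinuousLinearMap.id ℝ (EuclideanSpace ℝ (Fin k))) u := (hasFDerivAt_id u).add_const y
    rw [h.fderiv]
    simp [confFactor]
  smooth_extension y := ⟨fun z => z - y, fun z _ =>
    ⟨(contDiff_id.sub contDiff_const).contDiffAt, rfl⟩⟩
  isometry_linear a y := by
    refine ⟨a.toRealAffineIsometryEquiv.linearIsometryEquiv, fun u => ?_⟩
    have h := a.toRealAffineIsometryEquiv.map_vadd y u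
    simpa using h

lemma euclideanCharts_param {k : ℕ} (x u : EuclideanSpace ℝ (Fin k)) :
    (euclideanCharts k).param x u = u + x := rfl

section Sphere

/-- The unit sphere of `ℝⁿ`. -/
abbrev UnitSphere (n : ℕ) : Type := Metric.sphere (0 : EuclideanSpace ℝ (Fin n)) 1

variable {n : ℕ}

lemma sphere_inner_self (v : UnitSphere n) : inner ℝ (v : EuclideanSpace ℝ (Fin n)) v = 1 := by
  rw [real_inner_self_eq_norm_sq, mem_sphere_zero_iff_norm.1 v.2, one_pow]

lemma inner_sphere_isometry (a : UnitSphere n ≃ᵢ UnitSphere n) (v w : UnitSphere n) :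
    inner ℝ (a v : EuclideanSpace ℝ (Fin n)) (a w) = inner ℝ (v : EuclideanSpace ℝ (Fin n)) w := by
  have h := a.dist_eq v w
  rw [Subtype.dist_eq, Subtype.dist_eq, dist_eq_norm, dist_eq_norm] at h
  have h1 := norm_sub_sq_real (a v : EuclideanSpace ℝ (Fin n)) (a w)
  have h2 := norm_sub_sq_real (v : EuclideanSpace ℝ (Fin n)) w
  rw [h] at h1
  simp only [norm_eq_of_mem_sphere] at h1 h2
  linarith

/-- An isometry of the unit sphere for the chordal metric is the restriction of a linear
isometry. -/
lemma exists_linearIsometryEquiv_of_sphere (a : UnitSphere n ≃ᵢ UnitSphere n) :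
    ∃ L : EuclideanSpace ℝ (Fin n) ≃ₗᵢ[ℝ] EuclideanSpace ℝ (Fin n),
      ∀ v : UnitSphere n, (a v : EuclideanSpace ℝ (Fin n)) = L v := by
  set e : Fin n → UnitSphere n := fun i => ⟨EuclideanSpace.basisFun (Fin n) ℝ i, by simp⟩ with he
  have hon : Orthonormal ℝ fun i => (a (e i) : EuclideanSpace ℝ (Fin n)) := by
    rw [orthonormal_iff_ite]
    intro i j
    rw [inner_sphere_isometry]
    exact orthonormal_iff_ite.1 (EuclideanSpace.basisFun (Fin n) ℝ).orthonormal i j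
  have hcard : Fintype.card (Fin n) = Module.finrank ℝ (EuclideanSpace ℝ (Fin n)) := by simp
  set b : OrthonormalBasis (Fin n) ℝ (EuclideanSpace ℝ (Fin n)) :=
    OrthonormalBasis.mk hon (by
      rw [hon.linearIndependent.span_eq_top_of_card_eq_finrank' hcard]) with hb
  refine ⟨(EuclideanSpace.basisFun (Fin n) ℝ).equiv b (Equiv.refl _), fun v => ?_⟩
  -- both sides have the same inner products with the images of the standard basis
  refine InnerProductSpace.ext_inner_left_basis b.toBasis fun i => ?_
  have h1 : b.toBasis i = (a (e i) : EuclideanSpace ℝ (Fin n)) := by simp [hb]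
  have h2 : b.toBasis i = (EuclideanSpace.basisFun (Fin n) ℝ).equiv b (Equiv.refl _)
      (EuclideanSpace.basisFun (Fin n) ℝ i) := by
    rw [OrthonormalBasis.equiv_apply_basis]; simp
  rw [h1, inner_sphere_isometry, ← h1, h2, LinearIsometryEquiv.inner_map_map]

/-- An orthonormal frame of the tangent space of the unit sphere at each point. -/
structure SphereFrame (k : ℕ) where
  frame : UnitSphere (k + 1) → EuclideanSpace ℝ (Fin k) →ₗᵢ[ℝ] EuclideanSpace ℝ (Fin (k + 1))
  inner_frame : ∀ v u, inner ℝ (frame v u) (v : EuclideanSpace ℝ (Fin (k + 1))) = 0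

section Frame

variable {k : ℕ} {v : UnitSphere (k + 1)}
  {e : EuclideanSpace ℝ (Fin k) →ₗᵢ[ℝ] EuclideanSpace ℝ (Fin (k + 1))}

/-- The coordinates, in the orthonormal system `e`, of the orthogonal projection to its span. -/
def frameCoord (e : EuclideanSpace ℝ (Fin k) →ₗᵢ[ℝ] EuclideanSpace ℝ (Fin (k + 1))) :
    EuclideanSpace ℝ (Fin (k + 1)) →L[ℝ] EuclideanSpace ℝ (Fin k) :=
  ContinuousLinearMap.adjoint e.toContinuousLinearMap

lemma inner_frameCoord (u : EuclideanSpace ℝ (Fin k)) (y : EuclideanSpace ℝ (Fin (k + 1))) :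
    inner ℝ u (frameCoord e y) = inner ℝ (e u) y :=
  ContinuousLinearMap.adjoint_inner_right e.toContinuousLinearMap u y

lemma frameCoord_frame (u : EuclideanSpace ℝ (Fin k)) : frameCoord e (e u) = u :=
  ext_inner_left ℝ fun w => by rw [inner_frameCoord, e.inner_map_map]

lemma frameCoord_of_orthogonal {y : EuclideanSpace ℝ (Fin (k + 1))}
    (he : ∀ u, inner ℝ (e u) y = 0) : frameCoord e y = 0 :=
  ext_inner_left ℝ fun w => by rw [inner_frameCoord, he, inner_zero_right]

/-- A vector orthogonal to `v` is in the span of the frame, for reasons of dimension. -/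
lemma frame_frameCoord (he : ∀ u, inner ℝ (e u) (v : EuclideanSpace ℝ (Fin (k + 1))) = 0)
    (y : EuclideanSpace ℝ (Fin (k + 1))) :
    e (frameCoord e y) = y - inner ℝ (v : EuclideanSpace ℝ (Fin (k + 1))) y •
      (v : EuclideanSpace ℝ (Fin (k + 1))) := by
  have hv := sphere_inner_self v
  have hv0 : (v : EuclideanSpace ℝ (Fin (k + 1))) ≠ 0 := by
    intro h
    rw [h, inner_zero_left] at hv
    exact zero_ne_one hv
  have h1 : e.toLinearMap.range = (ℝ ∙ (v : EuclideanSpace ℝ (Fin (k + 1))))ᗮ := by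
    apply Submodule.eq_of_le_of_finrank_eq
    · rintro _ ⟨u, rfl⟩
      rw [Submodule.mem_orthogonal_singleton_iff_inner_left]
      exact he u
    · have : Fact (Module.finrank ℝ (EuclideanSpace ℝ (Fin (k + 1))) = k + 1) := ⟨by simp⟩
      rw [LinearMap.finrank_range_of_inj e.injective, finrank_euclideanSpace_fin,
        Submodule.finrank_orthogonal_span_singleton (n := k) hv0]
  have h2 : y - inner ℝ (v : EuclideanSpace ℝ (Fin (k + 1))) y •
      (v : EuclideanSpace ℝ (Fin (k + 1))) ∈ e.toLinearMap.range := by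
    rw [h1, Submodule.mem_orthogonal_singleton_iff_inner_right, inner_sub_right, inner_smul_right,
      hv, mul_one, sub_self]
  obtain ⟨u, hu⟩ := h2
  have hu' : e u = y - inner ℝ (v : EuclideanSpace ℝ (Fin (k + 1))) y •
      (v : EuclideanSpace ℝ (Fin (k + 1))) := hu
  have h3 : y = e u + inner ℝ (v : EuclideanSpace ℝ (Fin (k + 1))) y •
      (v : EuclideanSpace ℝ (Fin (k + 1))) := by rw [hu']; abel
  rw [← hu']
  congr 1
  conv_lhs => rw [h3]
  rw [map_add, map_smul, frameCoord_frame, frameCoord_of_orthogonal he, smul_zero, add_zero]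

/-- Two orthonormal frames of the tangent space at `v` differ by an orthogonal transformation. -/
lemma exists_frame_eq {e' : EuclideanSpace ℝ (Fin k) →ₗᵢ[ℝ] EuclideanSpace ℝ (Fin (k + 1))}
    (he : ∀ u, inner ℝ (e u) (v : EuclideanSpace ℝ (Fin (k + 1))) = 0)
    (he' : ∀ u, inner ℝ (e' u) (v : EuclideanSpace ℝ (Fin (k + 1))) = 0) :
    ∃ A : EuclideanSpace ℝ (Fin k) ≃ₗᵢ[ℝ] EuclideanSpace ℝ (Fin k), ∀ u, e' u = e (A u) := by
  have h (u) : e (frameCoord e (e' u)) = e' u := by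
    rw [frame_frameCoord he, real_inner_comm, he', zero_smul, sub_zero]
  have hn (u) : ‖frameCoord e (e' u)‖ = ‖u‖ := by
    rw [← e.norm_map, h, e'.norm_map]
  let f : EuclideanSpace ℝ (Fin k) →ₗᵢ[ℝ] EuclideanSpace ℝ (Fin k) :=
    ⟨(frameCoord e).toLinearMap ∘ₗ e'.toLinearMap, hn⟩
  exact ⟨f.toLinearIsometryEquiv rfl, fun u => (h u).symm⟩

/-- The inverse of the stereographic projection from the point antipodal to `v`, composed with the
frame `e` at `v`. -/
def sphereParam (e : EuclideanSpace ℝ (Fin k) →ₗᵢ[ℝ] EuclideanSpace ℝ (Fin (k + 1)))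
    (v : EuclideanSpace ℝ (Fin (k + 1))) (u : EuclideanSpace ℝ (Fin k)) :
    EuclideanSpace ℝ (Fin (k + 1)) :=
  (4 + ‖u‖ ^ 2)⁻¹ • ((4 : ℝ) • e u + (4 - ‖u‖ ^ 2) • v)

lemma contDiff_sphereParam : ContDiff ℝ ∞
    (sphereParam e (v : EuclideanSpace ℝ (Fin (k + 1)))) := by
  unfold sphereParam
  have h1 : ContDiff ℝ ∞ fun u : EuclideanSpace ℝ (Fin k) => ‖u‖ ^ 2 := contDiff_norm_sq ℝ
  have h2 : ContDiff ℝ ∞ e := e.toContinuousLinearMap.contDiff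
  refine ContDiff.smul (ContDiff.inv (contDiff_const.add h1) fun u => by positivity) ?_
  exact ContDiff.add (ContDiff.const_smul 4 h2)
      (ContDiff.smul (contDiff_const.sub h1) contDiff_const)

lemma inner_sphereParam (he : ∀ u, inner ℝ (e u) (v : EuclideanSpace ℝ (Fin (k + 1))) = 0)
    (u : EuclideanSpace ℝ (Fin k)) :
    inner ℝ (v : EuclideanSpace ℝ (Fin (k + 1))) (sphereParam e v u) =
      (4 + ‖u‖ ^ 2)⁻¹ * (4 - ‖u‖ ^ 2) := by
  rw [sphereParam, inner_smul_right, inner_add_right, inner_smul_right, inner_smul_right,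
    real_inner_comm, he, sphere_inner_self]
  ring

lemma frameCoord_sphereParam (he : ∀ u, inner ℝ (e u) (v : EuclideanSpace ℝ (Fin (k + 1))) = 0)
    (u : EuclideanSpace ℝ (Fin k)) :
    frameCoord e (sphereParam e v u) = ((4 + ‖u‖ ^ 2)⁻¹ * 4) • u := by
  rw [sphereParam, map_smul, map_add, map_smul, map_smul, frameCoord_frame,
    frameCoord_of_orthogonal he, smul_zero, add_zero, smul_smul]

lemma norm_sphereParam (he : ∀ u, inner ℝ (e u) (v : EuclideanSpace ℝ (Fin (k + 1))) = 0)
    (u : EuclideanSpace ℝ (Fin k)) : ‖sphereParam e v u‖ = 1 := by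
  have h : ‖(4 : ℝ) • e u + (4 - ‖u‖ ^ 2) • (v : EuclideanSpace ℝ (Fin (k + 1)))‖ ^ 2 =
      (4 + ‖u‖ ^ 2) ^ 2 := by
    rw [norm_add_sq_real, inner_smul_left, inner_smul_right, he, norm_smul, norm_smul, e.norm_map,
      mem_sphere_zero_iff_norm.1 v.2, mul_pow, mul_pow, Real.norm_eq_abs, Real.norm_eq_abs, sq_abs,
      sq_abs]
    ring
  rw [sphereParam, norm_smul, norm_inv, Real.norm_of_nonneg (by positivity : 0 ≤ 4 + ‖u‖ ^ 2),
    (sq_eq_sq₀ (norm_nonneg _) (by positivity)).1 h]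
  exact inv_mul_cancel₀ (by positivity)

/-- The stereographic projection from the point antipodal to `v`, in the frame `e`. -/
def sphereCoord (e : EuclideanSpace ℝ (Fin k) →ₗᵢ[ℝ] EuclideanSpace ℝ (Fin (k + 1)))
    (v y : EuclideanSpace ℝ (Fin (k + 1))) : EuclideanSpace ℝ (Fin k) :=
  (2 / (1 + inner ℝ v y)) • frameCoord e y

lemma sphereCoord_sphereParam
    (he : ∀ u, inner ℝ (e u) (v : EuclideanSpace ℝ (Fin (k + 1))) = 0)
    (u : EuclideanSpace ℝ (Fin k)) : sphereCoord e v (sphereParam e v u) = u := by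
  have h : 4 + ‖u‖ ^ 2 ≠ 0 := by positivity
  rw [sphereCoord, frameCoord_sphereParam he, inner_sphereParam he, smul_smul]
  convert one_smul ℝ u
  field_simp
  norm_num

lemma sphereParam_sphereCoord
    (he : ∀ u, inner ℝ (e u) (v : EuclideanSpace ℝ (Fin (k + 1))) = 0)
    {y : UnitSphere (k + 1)} (hy : 1 + inner ℝ (v : EuclideanSpace ℝ (Fin (k + 1))) y ≠ 0) :
    sphereParam e v (sphereCoord e v y) = y := by
  set s := inner ℝ (v : EuclideanSpace ℝ (Fin (k + 1))) (y : EuclideanSpace ℝ (Fin (k + 1))) with hs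
  have h1 : ‖frameCoord e y‖ ^ 2 = 1 - s ^ 2 := by
    rw [← real_inner_self_eq_norm_sq, inner_frameCoord, frame_frameCoord he, inner_sub_left,
      inner_smul_left, sphere_inner_self]
    simp only [conj_trivial]
    ring
  have h2 : ‖sphereCoord e v y‖ ^ 2 = 4 * (1 - s) / (1 + s) := by
    rw [sphereCoord, norm_smul, mul_pow, h1, Real.norm_eq_abs, sq_abs, ← hs]
    field_simp
    ring
  have h3 : (4 + 4 * (1 - s) / (1 + s))⁻¹ = (1 + s) / 8 := by
    rw [inv_eq_iff_eq_inv]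
    field_simp
    ring
  rw [sphereParam, h2, h3, sphereCoord, map_smul, frame_frameCoord he, ← hs]
  match_scalars
  · field_simp
    norm_num
  · field_simp
    ring

lemma inner_fderiv_sphereParam
    (he : ∀ u, inner ℝ (e u) (v : EuclideanSpace ℝ (Fin (k + 1))) = 0)
    (u a b : EuclideanSpace ℝ (Fin k)) :
    inner ℝ (fderiv ℝ (sphereParam e v) u a) (fderiv ℝ (sphereParam e v) u b) =
      confFactor 1 u * inner ℝ a b := by
  have hr : (4 + ‖u‖ ^ 2) ≠ 0 := by positivity
  have h1 : HasFDerivAt (fun u : EuclideanSpace ℝ (Fin k) => ‖u‖ ^ 2) (2 • innerSL ℝ u) u :=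
    (hasStrictFDerivAt_norm_sq u).hasFDerivAt
  have h2 : HasFDerivAt e e.toContinuousLinearMap u := e.toContinuousLinearMap.hasFDerivAt
  have h3 := ((hasDerivAt_inv hr).comp_hasFDerivAt u (h1.const_add 4)).smul
    ((h2.const_smul (4 : ℝ)).add ((h1.const_sub 4).smul_const (v : EuclideanSpace ℝ (Fin (k + 1)))))
  have h4 (a : EuclideanSpace ℝ (Fin k)) : fderiv ℝ (sphereParam e v) u a =
      (4 + ‖u‖ ^ 2)⁻¹ • ((4 : ℝ) • e a - (2 * inner ℝ u a) • (v : EuclideanSpace ℝ (Fin (k + 1)))) -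
      (2 * inner ℝ u a * ((4 + ‖u‖ ^ 2) ^ 2)⁻¹) • ((4 : ℝ) • e u + (4 - ‖u‖ ^ 2) •
        (v : EuclideanSpace ℝ (Fin (k + 1)))) := by
    have h5 : fderiv ℝ (sphereParam e v) u = _ := h3.fderiv
    rw [h5]
    simp
    module
  have hev (w) : inner ℝ (v : EuclideanSpace ℝ (Fin (k + 1))) (e w) = 0 := by
    rw [real_inner_comm, he]
  rw [h4, h4]
  simp only [inner_sub_left, inner_sub_right, inner_add_left, inner_add_right, inner_smul_left,
    inner_smul_right, he, hev, e.inner_map_map, conj_trivial, confFactor,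
    real_inner_self_eq_norm_sq, norm_eq_of_mem_sphere]
  rw [real_inner_comm u a]
  field_simp
  ring

end Frame

/-- The unit sphere, with stereographic projections. -/
def sphereCharts {k : ℕ} (f : SphereFrame k) :
    ConformalCharts k 1 (Subtype.val : UnitSphere (k + 1) → EuclideanSpace ℝ (Fin (k + 1))) where
  chart v :=
    { toFun := fun y => sphereCoord (f.frame v) v y
      invFun := fun u => ⟨sphereParam (f.frame v) v u,
        mem_sphere_zero_iff_norm.2 (norm_sphereParam (f.inner_frame v) u)⟩
      source := {y | 1 + inner ℝ (v : EuclideanSpace ℝ (Fin (k + 1))) y ≠ 0}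
      target := Set.univ
      map_source' := fun _ _ => trivial
      map_target' := fun u _ => by
        rw [Set.mem_ofPred_eq, inner_sphereParam (f.inner_frame v)]
        have h : 4 + ‖u‖ ^ 2 ≠ 0 := by positivity
        field_simp
        norm_num [h]
      left_inv' := fun y hy => Subtype.ext (sphereParam_sphereCoord (f.inner_frame v) hy)
      right_inv' := fun u _ => sphereCoord_sphereParam (f.inner_frame v) u
      open_source := isOpen_ne_fun (by fun_prop) (by fun_prop)
      open_target := isOpen_univ
      continuousOn_toFun := by
        refine ContinuousOn.smul (continuousOn_const.div (by fun_prop) fun y hy => hy) (by fun_prop)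
      continuousOn_invFun := by
        refine Continuous.continuousOn (Continuous.subtype_mk ?_ _)
        exact contDiff_sphereParam.continuous }
  nonneg := zero_le_one
  mem_source v := by
    change 1 + inner ℝ (v : EuclideanSpace ℝ (Fin (k + 1))) v ≠ 0
    rw [sphere_inner_self]
    norm_num
  chart_self v := by
    change sphereCoord (f.frame v) v v = 0
    rw [sphereCoord, frameCoord_of_orthogonal (f.inner_frame v), smul_zero]
  target_eq _ := rfl
  contDiff_symm v := contDiff_sphereParam
  inner_fderiv v := inner_fderiv_sphereParam (f.inner_frame v)
  smooth_extension v := by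
    refine ⟨sphereCoord (f.frame v) v, fun y hy => ⟨?_, rfl⟩⟩
    have h1 : ContDiffAt ℝ ∞ (fun z => 1 + inner ℝ (v : EuclideanSpace ℝ (Fin (k + 1))) z)
        (y : EuclideanSpace ℝ (Fin (k + 1))) :=
      contDiffAt_const.add (innerSL ℝ (v : EuclideanSpace ℝ (Fin (k + 1)))).contDiff.contDiffAt
    exact (contDiffAt_const.div h1 hy).smul (frameCoord (f.frame v)).contDiff.contDiffAt
  isometry_linear a v := by
    obtain ⟨L, hL⟩ := exists_linearIsometryEquiv_of_sphere a
    have h : ∀ u, inner ℝ (L.toLinearIsometry.comp (f.frame v) u)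
        (a v : EuclideanSpace ℝ (Fin (k + 1))) = 0 := fun u => by
      rw [hL]
      exact (L.inner_map_map _ _).trans (f.inner_frame v u)
    obtain ⟨A, hA⟩ := exists_frame_eq (f.inner_frame (a v)) h
    refine ⟨A, fun u => Subtype.ext ?_⟩
    rw [hL]
    change L (sphereParam (f.frame v) v u) = sphereParam (f.frame (a v)) (a v) (A u)
    rw [sphereParam, sphereParam, A.norm_map, ← hA, map_smul, map_add, map_smul, map_smul, hL]
    rfl

lemma sphereCharts_param {k : ℕ} (f : SphereFrame k) (v : UnitSphere (k + 1))
    (u : EuclideanSpace ℝ (Fin k)) : ((sphereCharts f).param v u : EuclideanSpace ℝ (Fin (k + 1))) =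
      sphereParam (f.frame v) v u := rfl

end Sphere

/-! ### Model fibrations -/

/-- The data, common to the two standard foliations, from which the geometry of the quotients is
derived: a map `π : X → Y` of Riemannian manifolds of dimensions `3` and `2` (isometrically embedded
by `ι` and `κ`) with adapted charts on `X` and on `Y`, in which `π` is given, up to a linear
isometry, by one map `Q : ℝ³ → ℂ`. The map `Q` has the 1-jet at `0` of a multiple of the projection
`(w₀, w₁, w₂) ↦ w₀ + i w₁`, and is harmonic at `0`. The geodesics of `X` are the curves `geo x v`,
which run in the chart at `x` along the line spanned by `v`, without acceleration at time `0`, and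
the fibres of `π` are the geodesics in the direction of the last axis. The predicate `isReflection`
describes the reflections of `Y`. -/
structure ModelFibration {X Y E E' : Type} [MetricSpace X] [MetricSpace Y]
    [NormedAddCommGroup E] [InnerProductSpace ℝ E] [NormedAddCommGroup E'] [InnerProductSpace ℝ E']
    [ChartedSpace R3 X] (ι : X → E) (κ : Y → E') (π : X → Y) (leaves : Set (Set X))
    (isReflection : (Y ≃ᵢ Y) → Prop) where
  ε : ℝ
  ε' : ℝ
  C : ConformalCharts 3 ε ι
  B : ConformalCharts 2 ε' κ
  contMDiffOn_chart : ∀ x, ContMDiffOn (𝓡 3) (𝓡 3) ∞ (C.chart x) (C.chart x).source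
  contMDiff_param : ∀ x, ContMDiff (𝓡 3) (𝓡 3) ∞ (C.param x)
  isQuotientMap : Topology.IsQuotientMap π
  leaves_eq : leaves = Set.range fun y => π ⁻¹' {y}
  dist_eq : ∃ G : ℝ → ℝ, ∀ x y, dist (π x) y = G (Metric.infDist x (π ⁻¹' {y}))
  geo : X → R3 → ℝ → X
  geo_add : ∀ x v s t, geo x v (s + t) = geo (geo x v t) v s
  geo_near : ∀ v, ∃ φ : ℝ → ℝ, ContDiffAt ℝ ∞ φ 0 ∧ φ 0 = 0 ∧ deriv φ 0 = 1 ∧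
    deriv (deriv φ) 0 = 0 ∧ ∀ x, ∀ᶠ s in 𝓝 0, geo x v s = C.param x (φ s • v)
  range_geo : ∀ x, Set.range (geo x (EuclideanSpace.single 2 1)) = π ⁻¹' {π x}
  Q : R3 → ℂ
  c : ℝ
  c_ne_zero : c ≠ 0
  contDiffAt_Q : ContDiffAt ℝ ∞ Q 0
  Q_zero : Q 0 = 0
  fderiv_Q : ∀ v : R3, fderiv ℝ Q 0 v = c * (v 0 + v 1 * Complex.I)
  laplacian_Q : ∑ i, fderiv ℝ (fun w => fderiv ℝ Q w (EuclideanSpace.single i 1)) 0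
    (EuclideanSpace.single i 1) = 0
  π_param : ∀ x, ∃ R : ℂ ≃ₗᵢ[ℝ] R2, ∀ᶠ w in 𝓝 0, π (C.param x w) = B.param (π x) (R (Q w))
  isReflection_of_det : ∀ (b : Y ≃ᵢ Y) (p : Y) (A : R2 ≃ₗᵢ[ℝ] R2),
    (∀ u, b (B.param p u) = B.param p (A u)) →
    LinearMap.det (A.toLinearEquiv : R2 →ₗ[ℝ] R2) ≠ 1 → isReflection b

/-! ### Orthogonal transformations of the plane -/

lemma R2_inner (u v : R2) : inner ℝ u v = u 0 * v 0 + u 1 * v 1 := by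
  simp [PiLp.inner_apply, Fin.sum_univ_two, mul_comm]

lemma R3_inner (u v : R3) : inner ℝ u v = u 0 * v 0 + u 1 * v 1 + u 2 * v 2 := by
  simp [PiLp.inner_apply, Fin.sum_univ_three, mul_comm]

lemma R4_inner (u v : R4) : inner ℝ u v = u 0 * v 0 + u 1 * v 1 + u 2 * v 2 + u 3 * v 3 := by
  simp [PiLp.inner_apply, Fin.sum_univ_four, mul_comm]

lemma R2_norm_sq (u : R2) : ‖u‖ ^ 2 = u 0 ^ 2 + u 1 ^ 2 := by
  rw [← real_inner_self_eq_norm_sq, R2_inner]; ring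

lemma R3_norm_sq (u : R3) : ‖u‖ ^ 2 = u 0 ^ 2 + u 1 ^ 2 + u 2 ^ 2 := by
  rw [← real_inner_self_eq_norm_sq, R3_inner]; ring

lemma R4_norm_sq (u : R4) : ‖u‖ ^ 2 = u 0 ^ 2 + u 1 ^ 2 + u 2 ^ 2 + u 3 ^ 2 := by
  rw [← real_inner_self_eq_norm_sq, R4_inner]; ring

/-- An orthogonal transformation of the plane is a rotation, or fixes a line and reverses the
direction orthogonal to it. -/
lemma det_eq_one_or_exists_fixed (A : R2 ≃ₗᵢ[ℝ] R2) :
    LinearMap.det (A.toLinearEquiv : R2 →ₗ[ℝ] R2) = 1 ∨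
      ∃ w : R2, w ≠ 0 ∧ A w = w ∧ ∀ u : R2, inner ℝ w u = 0 → A u = -u := by
  set e₀ : R2 := !₂[1, 0] with he₀
  set e₁ : R2 := !₂[0, 1] with he₁
  have hexp (u : R2) : u = u 0 • e₀ + u 1 • e₁ := by
    ext i; fin_cases i <;> simp [he₀, he₁]
  have hA (u : R2) : A u = u 0 • A e₀ + u 1 • A e₁ := by
    conv_lhs => rw [hexp u]
    rw [map_add, map_smul, map_smul]
  have hdet : LinearMap.det (A.toLinearEquiv : R2 →ₗ[ℝ] R2) =
      A e₀ 0 * A e₁ 1 - A e₁ 0 * A e₀ 1 := by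
    rw [← LinearMap.det_toMatrix (EuclideanSpace.basisFun (Fin 2) ℝ).toBasis, Matrix.det_fin_two]
    have h0 : EuclideanSpace.single (0 : Fin 2) (1 : ℝ) = e₀ := by
      ext i; fin_cases i <;> simp [he₀]
    have h1 : EuclideanSpace.single (1 : Fin 2) (1 : ℝ) = e₁ := by
      ext i; fin_cases i <;> simp [he₁]
    simp [LinearMap.toMatrix_apply, h0, h1]
  have h00 : A e₀ 0 * A e₀ 0 + A e₀ 1 * A e₀ 1 = 1 := by
    rw [← R2_inner, A.inner_map_map, R2_inner]; simp [he₀]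
  have h11 : A e₁ 0 * A e₁ 0 + A e₁ 1 * A e₁ 1 = 1 := by
    rw [← R2_inner, A.inner_map_map, R2_inner]; simp [he₁]
  have h01 : A e₀ 0 * A e₁ 0 + A e₀ 1 * A e₁ 1 = 0 := by
    rw [← R2_inner, A.inner_map_map, R2_inner]; simp [he₀, he₁]
  rw [hdet]
  -- the matrix of `A` has the columns `(a, b)` and `(p, q)`, and determinant `±1`
  set a := A e₀ 0
  set b := A e₀ 1
  set p := A e₁ 0
  set q := A e₁ 1
  have hd2 : (a * q - p * b - 1) * (a * q - p * b + 1) = 0 := by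
    linear_combination (p * p + q * q) * h00 + h11 - (a * p + b * q) * h01
  rcases mul_eq_zero.1 hd2 with h | h
  · exact Or.inl (by linarith)
  -- determinant `-1`: the second column is `(b, -a)`, and `e₀ + A e₀ = (1 + a, b)` is fixed; if it
  -- vanishes then `e₁` is fixed
  right
  have hp : p = b := by
    linear_combination (-p) * h00 - b * h + a * h01
  have hq : q = -a := by
    linear_combination (-q) * h00 + a * h + b * h01
  have hA0 (u : R2) : A u 0 = u 0 * a + u 1 * b := by
    rw [hA u, ← hp]; simp [a, p]
  have hA1 (u : R2) : A u 1 = u 0 * b - u 1 * a := by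
    rw [hA u]
    have : q = A e₁ 1 := rfl
    simp [← this, hq, b]
    ring
  by_cases ha : a = -1
  · have hb : b = 0 := by
      have : b * b = 0 := by rw [ha] at h00; linarith
      exact mul_self_eq_zero.1 this
    refine ⟨e₁, ?_, ?_, fun u hu => ?_⟩
    · intro h0
      simpa [he₁] using congrArg (fun v : R2 => v 1) h0
    · ext i; fin_cases i
      · simpa [hb, he₁] using hA0 e₁
      · simpa [ha, he₁] using hA1 e₁
    · have hu1 : u 1 = 0 := by simpa [R2_inner, he₁] using hu
      ext i; fin_cases i
      · simpa [hb, ha] using hA0 u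
      · simpa [hb, ha, hu1] using hA1 u
  · refine ⟨!₂[1 + a, b], ?_, ?_, fun u hu => ?_⟩
    · intro h0
      have h1 : 1 + a = 0 := by simpa using congrArg (fun v : R2 => v 0) h0
      exact ha (by linarith)
    · ext i; fin_cases i
      · refine (hA0 _).trans ?_
        simp
        linear_combination h00
      · refine (hA1 _).trans ?_
        simp
        ring
    · have hu' : (1 + a) * u 0 + b * u 1 = 0 := by simpa [R2_inner] using hu
      ext i; fin_cases i
      · refine (hA0 u).trans ?_
        simp
        linear_combination hu'
      · refine (hA1 u).trans ?_
        simp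
        have h1 : (1 + a) * (u 0 * b + u 1 * (1 - a)) = 0 := by
          linear_combination b * hu' - u 1 * h00
        have h2 := (mul_eq_zero.1 h1).resolve_left fun h => ha (by linarith)
        linear_combination h2

/-- A linear map which fixes `K` and reverses its orthogonal complement is the reflection in `K`. -/
lemma eq_reflection {V : Type} [NormedAddCommGroup V] [InnerProductSpace ℝ V]
    [FiniteDimensional ℝ V] (A : V ≃ₗᵢ[ℝ] V) (K : Submodule ℝ V) (h1 : ∀ u ∈ K, A u = u)
    (h2 : ∀ u ∈ Kᗮ, A u = -u) (x : V) : A x = K.reflection x := by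
  conv_lhs => rw [← K.starProjection_add_starProjection_orthogonal x]
  rw [map_add, h1 _ (K.starProjection_apply_mem x), h2 _ (Kᗮ.starProjection_apply_mem x),
    Submodule.reflection_apply]
  have := K.starProjection_add_starProjection_orthogonal x
  rw [← eq_sub_iff_add_eq'] at this
  rw [this, two_smul]
  abel

/-! ### The orthogonal projection of Euclidean space -/

section Plane

lemma orthProj_eq_iff {x y : R3} : orthProj x = orthProj y ↔ x 0 = y 0 ∧ x 1 = y 1 := by
  constructor
  · intro h
    exact ⟨by simpa [orthProj] using congrArg (fun v : R2 => v 0) h,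
      by simpa [orthProj] using congrArg (fun v : R2 => v 1) h⟩
  · rintro ⟨h0, h1⟩
    simp [orthProj, h0, h1]

lemma contDiff_orthProj : ContDiff ℝ ∞ orthProj := by
  rw [contDiff_euclidean]
  intro i
  fin_cases i
  · exact contDiff_piLp_apply (i := (0 : Fin 3)) (p := 2)
  · exact contDiff_piLp_apply (i := (1 : Fin 3)) (p := 2)

/-- The point of `ℝ³` over `y` at height `t`. -/
def liftR3 (y : R2) (t : ℝ) : R3 := !₂[y 0, y 1, t]

lemma orthProj_liftR3 (y : R2) (t : ℝ) : orthProj (liftR3 y t) = y := by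
  ext i; fin_cases i <;> simp [orthProj, liftR3]

lemma isQuotientMap_orthProj : Topology.IsQuotientMap orthProj := by
  refine Topology.IsQuotientMap.of_inverse (f := fun y => liftR3 y 0) ?_
      contDiff_orthProj.continuous
    fun y => orthProj_liftR3 y 0
  refine (PiLp.continuous_toLp 2 _).comp (continuous_pi fun i => ?_)
  fin_cases i
  · exact (EuclideanSpace.proj (0 : Fin 2) : R2 →L[ℝ] ℝ).continuous
  · exact (EuclideanSpace.proj (1 : Fin 2) : R2 →L[ℝ] ℝ).continuous
  · exact continuous_const

lemma range_vertical (x : R3) :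
    Set.range (fun t : ℝ => x + t • EuclideanSpace.single (2 : Fin 3) (1 : ℝ)) =
      orthProj ⁻¹' {orthProj x} := by
  ext y
  simp only [Set.mem_range, Set.mem_preimage, Set.mem_singleton_iff, orthProj_eq_iff]
  constructor
  · rintro ⟨t, rfl⟩
    simp
  · rintro ⟨h0, h1⟩
    refine ⟨y 2 - x 2, ?_⟩
    ext i; fin_cases i <;> simp [h0, h1]

/-- The distance from a point to a vertical line is the distance of their projections. -/
lemma infDist_orthProj (x : R3) (y : R2) :
    Metric.infDist x (orthProj ⁻¹' {y}) = dist (orthProj x) y := by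
  have h0 : dist (orthProj x) y ^ 2 = (x 0 - y 0) ^ 2 + (x 1 - y 1) ^ 2 := by
    rw [dist_eq_norm, R2_norm_sq]
    simp [orthProj]
  apply le_antisymm
  · refine (Metric.infDist_le_dist_of_mem (y := liftR3 y (x 2)) (orthProj_liftR3 _ _)).trans ?_
    refine abs_le_of_sq_le_sq' ?_ dist_nonneg |>.2
    rw [h0, dist_eq_norm, R3_norm_sq]
    simp [liftR3]
  · refine (Metric.le_infDist ⟨liftR3 y 0, orthProj_liftR3 _ _⟩).2 fun z hz => ?_
    obtain rfl : orthProj z = y := hz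
    refine abs_le_of_sq_le_sq' ?_ dist_nonneg |>.2
    rw [h0, dist_eq_norm, R3_norm_sq]
    simp only [orthProj, PiLp.sub_apply, PiLp.toLp_apply, Matrix.cons_val_zero, Matrix.cons_val_one]
    linarith [sq_nonneg (x 2 - z 2)]

/-- The coordinates of the plane as a real linear map of the space. -/
def planeCoord : R3 →L[ℝ] ℂ :=
  (Complex.orthonormalBasisOneI.repr.symm : R2 →L[ℝ] ℂ).comp
    (LinearMap.toContinuousLinearMap
      { toFun := orthProj
        map_add' := fun x y => by ext i; fin_cases i <;> simp [orthProj]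
        map_smul' := fun x y => by ext i; fin_cases i <;> simp [orthProj] })

lemma planeCoord_apply (v : R3) : planeCoord v = v 0 + v 1 * Complex.I := by
  simp [planeCoord, orthProj]

/-- The model fibration given by the orthogonal projection of `ℝ³` to `ℝ²`. -/
def planeFibration : ModelFibration (id : R3 → R3) (id : R2 → R2) orthProj verticalLines
    IsPlaneReflection where
  ε := 0
  ε' := 0
  C := euclideanCharts 3
  B := euclideanCharts 2
  contMDiffOn_chart x := (contDiff_id.sub contDiff_const).contMDiff.contMDiffOn
  contMDiff_param x := (contDiff_id.add contDiff_const).contMDiff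
  isQuotientMap := isQuotientMap_orthProj
  leaves_eq := by
    ext A
    constructor
    · rintro ⟨x, rfl⟩
      exact ⟨orthProj x, (range_vertical x).symm⟩
    · rintro ⟨y, rfl⟩
      refine ⟨liftR3 y 0, ?_⟩
      simp only [range_vertical, orthProj_liftR3]
  dist_eq := ⟨id, fun x y => (infDist_orthProj x y).symm⟩
  geo x v t := x + t • v
  geo_add x v s t := by module
  geo_near v := by
    refine ⟨id, contDiffAt_id, rfl, by simp, by simp, fun x => Filter.Eventually.of_forall fun s =>
        ?_⟩
    rw [euclideanCharts_param, add_comm]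
    rfl
  range_geo := range_vertical
  Q := planeCoord
  c := 1
  c_ne_zero := one_ne_zero
  contDiffAt_Q := planeCoord.contDiff.contDiffAt
  Q_zero := map_zero _
  fderiv_Q v := by simp [planeCoord_apply]
  laplacian_Q := by simp
  π_param x := by
    refine ⟨Complex.orthonormalBasisOneI.repr, Filter.Eventually.of_forall fun w => ?_⟩
    rw [euclideanCharts_param, euclideanCharts_param]
    ext i; fin_cases i <;> simp [orthProj, planeCoord]
  isReflection_of_det b p A h hA := by
    obtain ⟨w, hw, h1, h2⟩ := (det_eq_one_or_exists_fixed A).resolve_left hA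
    refine ⟨p, ℝ ∙ w, finrank_span_singleton hw, fun x => ?_⟩
    rw [← eq_reflection A]
    · have h3 := h (x - p)
      rw [euclideanCharts_param, euclideanCharts_param, sub_add_cancel] at h3
      rw [h3, add_comm]
    · intro u hu
      obtain ⟨t, rfl⟩ := Submodule.mem_span_singleton.1 hu
      rw [map_smul, h1]
    · intro u hu
      exact h2 u (Submodule.mem_orthogonal_singleton_iff_inner_right.1 hu)

end Plane

/-! ### The Hopf fibration -/

section SphereManifold

variable {k : ℕ} (f : SphereFrame k)

lemma contMDiff_sphereCharts_param (v : UnitSphere (k + 1)) :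
    ContMDiff (𝓡 k) (𝓡 k) ∞ ((sphereCharts f).param v) := by
  have : Fact (Module.finrank ℝ (EuclideanSpace ℝ (Fin (k + 1))) = k + 1) := ⟨by simp⟩
  exact ContMDiff.codRestrict_sphere
    (contDiff_sphereParam (v := v) (e := f.frame v)).contMDiff _

lemma contMDiffOn_sphereCharts_chart (v : UnitSphere (k + 1)) :
    ContMDiffOn (𝓡 k) (𝓡 k) ∞ ((sphereCharts f).chart v) ((sphereCharts f).chart v).source := by
  have : Fact (Module.finrank ℝ (EuclideanSpace ℝ (Fin (k + 1))) = k + 1) := ⟨by simp⟩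
  obtain ⟨F, hF⟩ := (sphereCharts f).smooth_extension v
  intro z hz
  have h1 : ContMDiffAt (𝓡 k) (𝓡 k) ∞
      (F ∘ (Subtype.val : UnitSphere (k + 1) → EuclideanSpace ℝ (Fin (k + 1)))) z :=
    (hF z hz).1.contMDiffAt.comp z contMDiff_coe_sphere.contMDiffAt
  exact h1.contMDiffWithinAt.congr (fun y hy => (hF y hy).2.symm) (hF z hz).2.symm

end SphereManifold

section Hopf

/-- The vector field `v₀ j x + v₁ k x + v₂ i x` on `ℂ² = ℝ⁴`, where `i` is the multiplication by the
imaginary unit, `j (z₁, z₂) = (-z̄₂, z̄₁)` and `k = i j`. -/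
def hopfField (x : R4) (v : R3) : R4 :=
  !₂[-(v 0 * x 2) - v 1 * x 3 - v 2 * x 1, v 0 * x 3 - v 1 * x 2 + v 2 * x 0,
    v 0 * x 0 + v 1 * x 1 - v 2 * x 3, -(v 0 * x 1) + v 1 * x 0 + v 2 * x 2]

lemma inner_hopfField_self (x : R4) (v : R3) : inner ℝ (hopfField x v) x = 0 := by
  simp [hopfField, R4_inner]
  ring

lemma norm_hopfField (x : S3) (v : R3) : ‖hopfField x v‖ = ‖v‖ := by
  have hx : ‖(x : R4)‖ ^ 2 = 1 := by rw [norm_eq_of_mem_sphere, one_pow]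
  rw [R4_norm_sq] at hx
  rw [← sq_eq_sq₀ (norm_nonneg _) (norm_nonneg _), R4_norm_sq, R3_norm_sq]
  simp [hopfField]
  linear_combination (v 0 ^ 2 + v 1 ^ 2 + v 2 ^ 2) * hx

/-- The left invariant frame `j x, k x, i x` of `S³`; the last vector is tangent to the Hopf
circles. -/
def hopfFrame : SphereFrame 3 where
  frame x :=
    { toFun := hopfField x
      map_add' := fun v w => by ext i; fin_cases i <;> simp [hopfField] <;> ring
      map_smul' := fun t v => by ext i; fin_cases i <;> simp [hopfField] <;> ring
      norm_map' := norm_hopfField x }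
  inner_frame x v := inner_hopfField_self x v

lemma hopfFrame_apply (x : S3) (v : R3) : hopfFrame.frame x v = hopfField x v := rfl

/-- The Hopf map as a quadratic map `ℝ⁴ → ℝ³`. -/
def hopfPoly (x : R4) : R3 :=
  !₂[2 * (x 0 * x 2 + x 1 * x 3), 2 * (x 1 * x 2 - x 0 * x 3),
    x 0 ^ 2 + x 1 ^ 2 - x 2 ^ 2 - x 3 ^ 2]

lemma hopfMap_coe (x : S3) : (hopfMap x : R3) = hopfPoly x := by
  ext i
  fin_cases i <;> simp [hopfMap, hopfPoly, z₁, z₂, Complex.normSq_apply] <;> ring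

lemma hopfPoly_smul (t : ℝ) (x : R4) : hopfPoly (t • x) = t ^ 2 • hopfPoly x := by
  ext i
  fin_cases i <;> simp [hopfPoly] <;> ring

lemma continuous_hopfMap : Continuous hopfMap := by
  refine Continuous.subtype_mk ?_ _
  have hc (i : Fin 4) : Continuous fun x : S3 => (x : R4) i :=
    (EuclideanSpace.proj i : R4 →L[ℝ] ℝ).continuous.comp continuous_subtype_val
  have h : (fun x : S3 => (hopfMap x : R3)) = fun x : S3 => hopfPoly x := funext hopfMap_coe
  change Continuous fun x : S3 => (hopfMap x : R3)
  rw [h]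
  refine (PiLp.continuous_toLp 2 _).comp (continuous_pi fun i => ?_)
  have h0 := hc 0
  have h1 := hc 1
  have h2 := hc 2
  have h3 := hc 3
  fin_cases i <;> simp <;> fun_prop

lemma hopfMap_surjective : Function.Surjective hopfMap := by
  intro p
  have hp : ‖(p : R3)‖ ^ 2 = 1 := by rw [norm_eq_of_mem_sphere, one_pow]
  rw [R3_norm_sq] at hp
  suffices h : ∃ x : R4, ‖x‖ ^ 2 = 1 ∧ hopfPoly x = p by
    obtain ⟨x, hx, hxp⟩ := h
    refine ⟨⟨x, mem_sphere_zero_iff_norm.2 ?_⟩, Subtype.ext ?_⟩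
    · exact (sq_eq_sq₀ (norm_nonneg _) zero_le_one).1 (by rw [hx, one_pow])
    · rw [hopfMap_coe, hxp]
  have hp2 : -1 ≤ (p : R3) 2 := by nlinarith [sq_nonneg ((p : R3) 0), sq_nonneg ((p : R3) 1)]
  rcases hp2.eq_or_lt with h | h
  · have h0 : (p : R3) 0 = 0 := by nlinarith [sq_nonneg ((p : R3) 0), sq_nonneg ((p : R3) 1)]
    have h1 : (p : R3) 1 = 0 := by nlinarith [sq_nonneg ((p : R3) 0), sq_nonneg ((p : R3) 1)]
    refine ⟨!₂[0, 0, 1, 0], by simp [R4_norm_sq], ?_⟩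
    ext i; fin_cases i <;> simp [hopfPoly, h0, h1, ← h]
  · set s := √((1 + (p : R3) 2) / 2) with hs
    have hs2 : s ^ 2 = (1 + (p : R3) 2) / 2 := Real.sq_sqrt (by linarith)
    have hs0 : s ≠ 0 := by
      intro h0
      rw [h0] at hs2
      linarith
    refine ⟨!₂[s, 0, (p : R3) 0 / (2 * s), -((p : R3) 1 / (2 * s))], ?_, ?_⟩
    · rw [R4_norm_sq]
      simp
      field_simp
      linear_combination (4 * s ^ 2 - 4 + 2 * (1 + (p : R3) 2)) * hs2 + hp
    · ext i; fin_cases i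
      · simp [hopfPoly]; field_simp
      · simp [hopfPoly]; field_simp
      · simp [hopfPoly]
        field_simp
        linear_combination (4 * s ^ 2 + 2 - 2 * (p : R3) 2) * hs2 - hp

lemma isQuotientMap_hopfMap : Topology.IsQuotientMap hopfMap :=
  continuous_hopfMap.isClosedMap.isQuotientMap continuous_hopfMap hopfMap_surjective

/-- The Hermitian product of `ℂ²`. -/
def hermitian (y x : R4) : ℂ := z₁ y * (starRingEnd ℂ) (z₁ x) + z₂ y * (starRingEnd ℂ) (z₂ x)

/-- Multiplication by a complex number in `ℂ²`. -/
def complexSmul (a : ℂ) (x : R4) : R4 :=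
  !₂[a.re * x 0 - a.im * x 1, a.re * x 1 + a.im * x 0, a.re * x 2 - a.im * x 3,
    a.re * x 3 + a.im * x 2]

lemma z₁_complexSmul (a : ℂ) (x : R4) : z₁ (complexSmul a x) = a * z₁ x := by
  apply Complex.ext <;> simp [z₁, complexSmul]

lemma z₂_complexSmul (a : ℂ) (x : R4) : z₂ (complexSmul a x) = a * z₂ x := by
  apply Complex.ext <;> simp [z₂, complexSmul]

lemma complex_pair_ext {x y : R4} (h1 : z₁ x = z₁ y) (h2 : z₂ x = z₂ y) : x = y := by
  simp only [z₁, z₂, Complex.mk.injEq] at h1 h2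
  ext i; fin_cases i
  exacts [h1.1, h1.2, h2.1, h2.2]

lemma norm_complexSmul (a : ℂ) (x : R4) : ‖complexSmul a x‖ = ‖a‖ * ‖x‖ := by
  rw [← sq_eq_sq₀ (norm_nonneg _) (by positivity), mul_pow, R4_norm_sq, R4_norm_sq, Complex.sq_norm,
    Complex.normSq_apply]
  simp [complexSmul]
  ring

lemma hopfPoly_complexSmul (a : ℂ) (x : R4) : hopfPoly (complexSmul a x) =
    ‖a‖ ^ 2 • hopfPoly x := by
  rw [Complex.sq_norm, Complex.normSq_apply]
  ext i
  fin_cases i <;> simp [hopfPoly, complexSmul] <;> ring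

/-- The point `e^{it} x` of the Hopf circle of `x`. -/
def hopfRotate (t : ℝ) (x : S3) : S3 :=
  ⟨complexSmul (Complex.exp (t * Complex.I)) x, by
    rw [mem_sphere_zero_iff_norm, norm_complexSmul, Complex.norm_exp_ofReal_mul_I,
      norm_eq_of_mem_sphere, one_mul]⟩

lemma hopfRotate_coe (t : ℝ) (x : S3) :
    (hopfRotate t x : R4) = complexSmul (Complex.exp (t * Complex.I)) x := rfl

lemma hopfMap_hopfRotate (t : ℝ) (x : S3) : hopfMap (hopfRotate t x) = hopfMap x := by
  apply Subtype.ext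
  rw [hopfMap_coe, hopfMap_coe, hopfRotate, hopfPoly_complexSmul, Complex.norm_exp_ofReal_mul_I,
    one_pow, one_smul]

/-- The distance of the images of two points under the Hopf map depends only on the absolute value
of their Hermitian product, as does the distance of a point from the circle through another one. -/
lemma dist_hopfMap_sq (x y : S3) :
    dist (hopfMap x) (hopfMap y) ^ 2 = 4 * (1 - ‖hermitian x y‖ ^ 2) := by
  have hx : ‖(x : R4)‖ ^ 2 = 1 := by rw [norm_eq_of_mem_sphere, one_pow]
  have hy : ‖(y : R4)‖ ^ 2 = 1 := by rw [norm_eq_of_mem_sphere, one_pow]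
  rw [R4_norm_sq] at hx hy
  rw [Subtype.dist_eq, dist_eq_norm, R3_norm_sq, Complex.sq_norm, Complex.normSq_apply,
    hopfMap_coe, hopfMap_coe]
  simp [hopfPoly, hermitian, z₁, z₂]
  linear_combination ((x : R4) 0 ^ 2 + (x : R4) 1 ^ 2 + (x : R4) 2 ^ 2 + (x : R4) 3 ^ 2 + 1) * hx
    + ((y : R4) 0 ^ 2 + (y : R4) 1 ^ 2 + (y : R4) 2 ^ 2 + (y : R4) 3 ^ 2 + 1) * hy
    + 2 * ((x : R4) 0 ^ 2 + (x : R4) 1 ^ 2 + (x : R4) 2 ^ 2 + (x : R4) 3 ^ 2) * hy + 2 * hx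

/-- The fibres of the Hopf map are the orbits of the circle action. -/
lemma exists_hopfRotate_eq {x y : S3} (h : hopfMap y = hopfMap x) : ∃ t, hopfRotate t x = y := by
  have h1 := dist_hopfMap_sq y x
  rw [h, dist_self] at h1
  have h2 : ‖hermitian y x‖ = 1 := by
    rw [← sq_eq_sq₀ (norm_nonneg _) zero_le_one]; linarith
  have hxy : hermitian y x = Complex.exp (((hermitian y x).arg : ℝ) * Complex.I) := by
    conv_lhs => rw [← Complex.norm_mul_exp_arg_mul_I (hermitian y x), h2]
    simp
  have h3 : ‖(y : R4) - complexSmul (hermitian y x) x‖ ^ 2 = 0 := by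
    have hx : ‖(x : R4)‖ ^ 2 = 1 := by rw [norm_eq_of_mem_sphere, one_pow]
    have hy : ‖(y : R4)‖ ^ 2 = 1 := by rw [norm_eq_of_mem_sphere, one_pow]
    have h4 : ‖hermitian y x‖ ^ 2 = 1 := by rw [h2, one_pow]
    rw [norm_sub_sq_real, norm_complexSmul, mul_pow, hx, hy, h4]
    rw [Complex.sq_norm, Complex.normSq_apply] at h4
    have h5 : inner ℝ (y : R4) (complexSmul (hermitian y x) x) = 1 := by
      refine Eq.trans ?_ h4
      rw [R4_inner]
      simp [complexSmul, hermitian, z₁, z₂]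
      ring
    rw [h5]
    norm_num
  refine ⟨(hermitian y x).arg, Subtype.ext ?_⟩
  rw [hopfRotate_coe, ← hxy]
  exact (sub_eq_zero.1 (norm_eq_zero.1 (pow_eq_zero_iff two_ne_zero |>.1 h3))).symm

lemma range_hopfRotate (x : S3) :
    Set.range (fun t => hopfRotate t x) = hopfMap ⁻¹' {hopfMap x} := by
  ext y
  constructor
  · rintro ⟨t, rfl⟩
    exact hopfMap_hopfRotate t x
  · exact fun h => exists_hopfRotate_eq h

lemma hopfCircle_eq (x : S3) :
    {y : S3 | ∃ a : ℂ, z₁ y = a * z₁ x ∧ z₂ y = a * z₂ x} = hopfMap ⁻¹' {hopfMap x} := by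
  ext y
  constructor
  · rintro ⟨a, h1, h2⟩
    have h : (y : R4) = complexSmul a x :=
      complex_pair_ext (by rw [h1, z₁_complexSmul]) (by rw [h2, z₂_complexSmul])
    have ha : ‖a‖ = 1 := by
      have := norm_complexSmul a x
      rwa [← h, norm_eq_of_mem_sphere, norm_eq_of_mem_sphere, mul_one, eq_comm] at this
    apply Subtype.ext
    rw [hopfMap_coe, hopfMap_coe, h, hopfPoly_complexSmul, ha, one_pow, one_smul]
  · intro h
    obtain ⟨t, rfl⟩ := exists_hopfRotate_eq (show hopfMap y = hopfMap x from h)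
    exact ⟨_, z₁_complexSmul _ _, z₂_complexSmul _ _⟩

lemma infDist_hopfMap_sq (x y : S3) :
    Metric.infDist x (hopfMap ⁻¹' {hopfMap y}) ^ 2 = 2 - 2 * ‖hermitian x y‖ := by
  have hle : ‖hermitian x y‖ ≤ 1 := by
    have := dist_hopfMap_sq x y
    nlinarith [sq_nonneg (dist (hopfMap x) (hopfMap y)), norm_nonneg (hermitian x y)]
  -- the distance from `x` to the point `e^{it} y` of the circle
  have hdist (t : ℝ) : dist x (hopfRotate t y) ^ 2 =
      2 - 2 * (hermitian x y * Complex.exp (-(t * Complex.I))).re := by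
    rw [Subtype.dist_eq, dist_eq_norm, norm_sub_sq_real, norm_eq_of_mem_sphere,
      norm_eq_of_mem_sphere, R4_inner]
    rw [← neg_mul, ← Complex.ofReal_neg, hopfRotate_coe, Complex.exp_mul_I, Complex.exp_mul_I]
    simp [complexSmul, hermitian, z₁, z₂, Complex.cos_ofReal_re, Complex.sin_ofReal_re]
    ring
  have hinf : Metric.infDist x (hopfMap ⁻¹' {hopfMap y}) = √(2 - 2 * ‖hermitian x y‖) := by
    apply le_antisymm
    · refine (Metric.infDist_le_dist_of_mem
        (y := hopfRotate (hermitian x y).arg y) (hopfMap_hopfRotate _ _)).trans ?_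
      refine Real.le_sqrt_of_sq_le (le_of_eq ?_)
      rw [hdist]
      have : hermitian x y * Complex.exp (-((hermitian x y).arg * Complex.I)) =
          (‖hermitian x y‖ : ℂ) := by
        conv_lhs => rw [← Complex.norm_mul_exp_arg_mul_I (hermitian x y)]
        rw [mul_assoc]
        simp [← Complex.exp_add]
      rw [this, Complex.ofReal_re]
    · refine (Metric.le_infDist (s := hopfMap ⁻¹' {hopfMap y}) ⟨y, rfl⟩).2 fun z hz => ?_
      obtain ⟨t, rfl⟩ := exists_hopfRotate_eq (show hopfMap z = hopfMap y from hz)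
      refine (Real.sqrt_le_left dist_nonneg).2 ?_
      rw [hdist]
      have h1 := Complex.re_le_norm (hermitian x y * Complex.exp (-(t * Complex.I)))
      rw [norm_mul, ← neg_mul, ← Complex.ofReal_neg, Complex.norm_exp_ofReal_mul_I, mul_one] at h1
      rw [← neg_mul, ← Complex.ofReal_neg]
      linarith
  rw [hinf, Real.sq_sqrt (by linarith)]

/-- The great circle through `x` with initial velocity `hopfField x v`. For `v = 0` the quotient by
`‖v‖` is zero, and the curve is constant. -/
def hopfGeo (x : S3) (v : R3) (t : ℝ) : S3 :=
  ⟨Real.cos (‖v‖ * t) • (x : R4) + (Real.sin (‖v‖ * t) / ‖v‖) • hopfField x v, by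
    rw [mem_sphere_zero_iff_norm, ← sq_eq_sq₀ (norm_nonneg _) zero_le_one, norm_add_sq_real,
      inner_smul_left, inner_smul_right, real_inner_comm, inner_hopfField_self, norm_smul,
          norm_smul,
      norm_hopfField, norm_eq_of_mem_sphere, mul_pow, mul_pow, Real.norm_eq_abs, Real.norm_eq_abs,
      sq_abs, sq_abs]
    by_cases h : ‖v‖ = 0
    · simp [h]
    · field_simp
      linear_combination ‖v‖ * Real.cos_sq_add_sin_sq (‖v‖ * t)⟩

lemma hopfGeo_coe (x : S3) (v : R3) (t : ℝ) : (hopfGeo x v t : R4) =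
    Real.cos (‖v‖ * t) • (x : R4) + (Real.sin (‖v‖ * t) / ‖v‖) • hopfField x v := rfl

lemma hopfField_smul_add (a b : ℝ) (x y : R4) (v : R3) :
    hopfField (a • x + b • y) v = a • hopfField x v + b • hopfField y v := by
  ext i; fin_cases i <;> simp [hopfField] <;> ring

lemma hopfField_hopfField (x : R4) (v : R3) : hopfField (hopfField x v) v = -‖v‖ ^ 2 • x := by
  rw [R3_norm_sq]
  ext i; fin_cases i <;> simp [hopfField] <;> ring

lemma hopfGeo_add (x : S3) (v : R3) (s t : ℝ) :
    hopfGeo x v (s + t) = hopfGeo (hopfGeo x v t) v s := by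
  apply Subtype.ext
  rw [hopfGeo_coe, hopfGeo_coe, hopfGeo_coe, hopfField_smul_add, hopfField_hopfField, mul_add,
    Real.cos_add, Real.sin_add]
  by_cases h : ‖v‖ = 0
  · simp [h]
  · match_scalars <;> field_simp <;> ring

lemma deriv_deriv_zero_of_odd {F : Type} [NormedAddCommGroup F] [NormedSpace ℝ F] {f : ℝ → F}
    (hf : ∀ t, f (-t) = -f t) : deriv (deriv f) 0 = 0 := by
  have h1 (t) : deriv f (-t) = deriv f t := by
    have h : f = fun t => -f (-t) := by ext t; rw [hf, neg_neg]
    conv_rhs => rw [h]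
    rw [deriv.fun_neg, deriv_comp_neg, neg_neg]
  have h2 : deriv (deriv f) 0 = -deriv (deriv f) 0 := by
    have h : deriv f = fun t => deriv f (-t) := by ext t; rw [h1]
    conv_lhs => rw [h]
    rw [deriv_comp_neg, neg_zero]
  have h3 : (2 : ℝ) • deriv (deriv f) 0 = 0 := by
    rw [two_smul]
    nth_rewrite 1 [h2]
    exact neg_add_cancel _
  exact (smul_eq_zero.1 h3).resolve_left two_ne_zero

/-- In the charts of the frame `hopfFrame` the great circles through the centre are straight lines,
traversed with speed `1 / cos² (‖v‖ t / 2)`. -/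
lemma hopfGeo_near (v : R3) : ∃ φ : ℝ → ℝ, ContDiffAt ℝ ∞ φ 0 ∧ φ 0 = 0 ∧ deriv φ 0 = 1 ∧
    deriv (deriv φ) 0 = 0 ∧
    ∀ x, ∀ᶠ s in 𝓝 0, hopfGeo x v s = (sphereCharts hopfFrame).param x (φ s • v) := by
  by_cases hv : v = 0
  · refine ⟨id, contDiffAt_id, rfl, by simp, by simp, fun x => Filter.Eventually.of_forall fun s =>
      ?_⟩
    rw [hv, smul_zero, ConformalCharts.param_zero]
    apply Subtype.ext
    simp [hopfGeo_coe]
  have hk : ‖v‖ ≠ 0 := norm_ne_zero_iff.2 hv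
  have hc0 : Real.cos (‖v‖ / 2 * 0) ≠ 0 := by simp
  refine ⟨fun t => 2 / ‖v‖ * Real.tan (‖v‖ / 2 * t), ?_, by simp, ?_, ?_, fun x => ?_⟩
  · exact contDiffAt_const.mul
      ((Real.contDiffAt_tan.2 hc0).comp 0 (contDiffAt_const.mul contDiffAt_id))
  · have h1 : HasDerivAt (fun t : ℝ => ‖v‖ / 2 * t) (‖v‖ / 2) 0 := by
      simpa using (hasDerivAt_id (0 : ℝ)).const_mul (‖v‖ / 2)
    have h2 := ((Real.hasDerivAt_tan hc0).comp (0 : ℝ) h1).const_mul (2 / ‖v‖)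
    have h3 : deriv (fun t => 2 / ‖v‖ * Real.tan (‖v‖ / 2 * t)) 0 = _ := h2.deriv
    rw [h3, show Real.cos (‖v‖ / 2 * 0) = 1 by simp]
    field_simp
  · refine deriv_deriv_zero_of_odd fun t => ?_
    rw [mul_neg, Real.tan_neg, mul_neg]
  · have hcont : Filter.Tendsto (fun s : ℝ => Real.cos (‖v‖ / 2 * s)) (𝓝 0)
        (𝓝 (Real.cos (‖v‖ / 2 * 0))) := by
      apply Continuous.tendsto
      fun_prop
    filter_upwards [hcont.eventually_ne hc0] with s hs
    apply Subtype.ext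
    rw [hopfGeo_coe, sphereCharts_param]
    have h1 := Real.sin_sq_add_cos_sq (‖v‖ / 2 * s)
    have h2 : ‖v‖ * s = 2 * (‖v‖ / 2 * s) := by ring
    rw [h2, Real.cos_two_mul, Real.sin_two_mul, sphereParam, norm_smul, map_smul, mul_pow,
      Real.norm_eq_abs, sq_abs, Real.tan_eq_sin_div_cos]
    set S := Real.sin (‖v‖ / 2 * s)
    set c := Real.cos (‖v‖ / 2 * s)
    have h3 : 4 + (2 / ‖v‖ * (S / c)) ^ 2 * ‖v‖ ^ 2 = 4 / c ^ 2 := by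
      field_simp
      linear_combination 4 * h1
    rw [h3]
    have h4 : hopfFrame.frame x v = hopfField x v := rfl
    rw [h4]
    match_scalars
    · field_simp
      linear_combination 4 * h1
    · field_simp

lemma hopfGeo_vertical (x : S3) (t : ℝ) :
    hopfGeo x (EuclideanSpace.single 2 1) t = hopfRotate t x := by
  apply Subtype.ext
  have h : ‖(EuclideanSpace.single 2 1 : R3)‖ = 1 := by simp
  rw [hopfGeo_coe, hopfRotate_coe, Complex.exp_mul_I, h]
  ext i
  fin_cases i <;>
    simp [hopfField, complexSmul, Complex.cos_ofReal_re, Complex.sin_ofReal_re] <;> ring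

/-- The frame of `S²` at the image of `x` which is half the image, under the differential of the
Hopf map, of the frame `j x, k x`. -/
def hopfBaseField (x : R4) (u : R2) : R3 :=
  !₂[u 0 * (x 0 ^ 2 - x 1 ^ 2 - x 2 ^ 2 + x 3 ^ 2) + u 1 * (2 * (x 0 * x 1 - x 2 * x 3)),
    u 0 * (2 * (x 0 * x 1 + x 2 * x 3)) + u 1 * (x 1 ^ 2 + x 3 ^ 2 - x 0 ^ 2 - x 2 ^ 2),
    -(u 0 * (2 * (x 0 * x 2 - x 1 * x 3))) - u 1 * (2 * (x 0 * x 3 + x 1 * x 2))]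

/-- `hopfBaseField x` as a linear isometry onto the tangent plane of `S²` at the image of `x`. -/
def hopfBaseIsometry (x : S3) : R2 →ₗᵢ[ℝ] R3 where
  toFun := hopfBaseField x
  map_add' u v := by ext i; fin_cases i <;> simp [hopfBaseField] <;> ring
  map_smul' t u := by ext i; fin_cases i <;> simp [hopfBaseField] <;> ring
  norm_map' u := by
    have hx : ‖(x : R4)‖ ^ 2 = 1 := by rw [norm_eq_of_mem_sphere, one_pow]
    rw [R4_norm_sq] at hx
    change ‖hopfBaseField x u‖ = ‖u‖
    rw [← sq_eq_sq₀ (norm_nonneg _) (norm_nonneg _), R3_norm_sq, R2_norm_sq]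
    simp [hopfBaseField]
    linear_combination (u 0 ^ 2 + u 1 ^ 2) *
      ((x : R4) 0 ^ 2 + (x : R4) 1 ^ 2 + (x : R4) 2 ^ 2 + (x : R4) 3 ^ 2 + 1) * hx

lemma inner_hopfBaseIsometry (x : S3) (u : R2) :
    inner ℝ (hopfBaseIsometry x u) (hopfMap x : R3) = 0 := by
  change inner ℝ (hopfBaseField x u) (hopfMap x : R3) = 0
  rw [hopfMap_coe, R3_inner]
  simp [hopfBaseField, hopfPoly]
  ring

lemma hopfPoly_hopfField (x : R4) (v : R3) (d : ℝ) :
    hopfPoly (hopfField x v + d • x) =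
      hopfBaseField x !₂[2 * (v 0 * d + v 1 * v 2), 2 * (v 1 * d - v 0 * v 2)] +
        (d ^ 2 + v 2 ^ 2 - v 0 ^ 2 - v 1 ^ 2) • hopfPoly x := by
  ext i; fin_cases i <;> simp [hopfPoly, hopfField, hopfBaseField] <;> ring

/-- The Hopf map in the stereographic charts at `x` and at its image: in terms of the quaternion
`a + w₂' i + w₀' j + w₁' k` corresponding to `w` it is `2 (w₀' + i w₁') / (a + i w₂')`. -/
def hopfCoord (w : R3) : ℂ :=
  8 * (w 0 + w 1 * Complex.I) / ((4 - ‖w‖ ^ 2 : ℝ) + 4 * w 2 * Complex.I)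

/-- A frame of `S²`, obtained from a section of the Hopf map. -/
def hopfBaseFrame : SphereFrame 2 where
  frame p := hopfBaseIsometry (hopfMap_surjective p).choose
  inner_frame p u := by
    have h := inner_hopfBaseIsometry (hopfMap_surjective p).choose u
    rwa [(hopfMap_surjective p).choose_spec] at h

/-- Unless the image is the point antipodal to the image of `x`, for which the denominator of
`hopfCoord` vanishes, the Hopf map is given by `hopfCoord` in stereographic coordinates. -/
lemma hopfPoly_sphereParam (x : S3) (w : R3)
    (hw : ((4 - ‖w‖ ^ 2 : ℝ) + 4 * w 2 * Complex.I : ℂ) ≠ 0) :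
    hopfPoly (sphereParam (hopfFrame.frame x) x w) = sphereParam (hopfBaseIsometry x) (hopfPoly x)
      (Complex.orthonormalBasisOneI.repr (hopfCoord w)) := by
  set d : ℝ := 4 - ‖w‖ ^ 2 with hd
  -- the square of the absolute value of the denominator of `hopfCoord w`
  obtain ⟨N, hNd⟩ : ∃ N : ℝ, N = d ^ 2 + 16 * w 2 ^ 2 := ⟨_, rfl⟩
  have hN : N ≠ 0 := by
    rw [hNd]
    intro h0
    have h1 : d = 0 := by nlinarith [sq_nonneg d, sq_nonneg (w 2)]
    have h2 : w 2 = 0 := by nlinarith [sq_nonneg d, sq_nonneg (w 2)]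
    exact hw (by simp [h1, h2])
  obtain ⟨K, hK⟩ : ∃ K : ℝ, K = 8 / N := ⟨_, rfl⟩
  have hKN : K * (d ^ 2 + 16 * w 2 ^ 2) = 8 := by
    rw [hK, ← hNd]
    field_simp
  have hQ : Complex.orthonormalBasisOneI.repr (hopfCoord w) =
      K • (!₂[w 0 * d + 4 * (w 1 * w 2), w 1 * d - 4 * (w 0 * w 2)] : R2) := by
    have h1 : hopfCoord w = (K : ℂ) *
        (⟨w 0 * d + 4 * (w 1 * w 2), w 1 * d - 4 * (w 0 * w 2)⟩ : ℂ) := by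
      rw [hopfCoord, div_eq_iff hw]
      apply Complex.ext
      · simp
        linear_combination (-w 0) * hKN
      · simp
        linear_combination (-w 1) * hKN
    rw [h1]
    ext i; fin_cases i <;> simp
  have hr := R3_norm_sq w
  have hnorm : ‖Complex.orthonormalBasisOneI.repr (hopfCoord w)‖ ^ 2 =
      64 * (w 0 ^ 2 + w 1 ^ 2) / N := by
    rw [hQ, R2_norm_sq, hK]
    simp
    field_simp
    rw [hNd]
    ring
  have h4 : hopfFrame.frame x w = hopfField x w := rfl
  have h5 : (4 : ℝ) • hopfField x w = hopfField x ((4 : ℝ) • w) := by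
    rw [← hopfFrame_apply, ← hopfFrame_apply, map_smul]
  have h6 : !₂[2 * (((4 : ℝ) • w) 0 * d + ((4 : ℝ) • w) 1 * ((4 : ℝ) • w) 2),
      2 * (((4 : ℝ) • w) 1 * d - ((4 : ℝ) • w) 0 * ((4 : ℝ) • w) 2)] =
      (8 : ℝ) • (!₂[w 0 * d + 4 * (w 1 * w 2), w 1 * d - 4 * (w 0 * w 2)] : R2) := by
    ext i; fin_cases i <;> simp <;> ring
  have h7 (u : R2) : hopfBaseField x u = hopfBaseIsometry x u := rfl
  have hpos : (4 + ‖w‖ ^ 2) ≠ 0 := by positivity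
  have h8 : (4 + 64 * (w 0 ^ 2 + w 1 ^ 2) / N)⁻¹ = N / (4 * (4 + ‖w‖ ^ 2) ^ 2) := by
    rw [inv_eq_iff_eq_inv, inv_div]
    field_simp
    rw [hNd, hd, hr]
    ring
  rw [sphereParam, h4, ← hd, hopfPoly_smul, h5, hopfPoly_hopfField, h6, h7, map_smul, sphereParam,
    hnorm, h8, hQ, map_smul]
  match_scalars
  · rw [hK]
    field_simp
  · simp only [PiLp.smul_apply, smul_eq_mul]
    field_simp
    rw [hNd]
    ring

lemma contDiffAt_hopfCoord : ContDiffAt ℝ ∞ hopfCoord 0 := by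
  have hc (i : Fin 3) : ContDiff ℝ ∞ fun w : R3 => ((w i : ℝ) : ℂ) :=
    Complex.ofRealCLM.contDiff.comp (EuclideanSpace.proj i : R3 →L[ℝ] ℝ).contDiff
  have hn : ContDiff ℝ ∞ fun w : R3 => ((4 - ‖w‖ ^ 2 : ℝ) : ℂ) :=
    Complex.ofRealCLM.contDiff.comp (contDiff_const.sub (contDiff_norm_sq ℝ))
  have h1 : ContDiff ℝ ∞ fun w : R3 => 8 * ((w 0 : ℂ) + w 1 * Complex.I) :=
    contDiff_const.mul ((hc 0).add ((hc 1).mul contDiff_const))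
  have h2 : ContDiff ℝ ∞ fun w : R3 => ((4 - ‖w‖ ^ 2 : ℝ) : ℂ) + 4 * w 2 * Complex.I :=
    hn.add ((contDiff_const.mul (hc 2)).mul contDiff_const)
  have h3 := (h1.contDiffAt (x := 0)).mul (h2.contDiffAt.inv (by simp))
  exact h3

lemma fderiv_hopfCoord (v : R3) :
    fderiv ℝ hopfCoord 0 v = ((2 : ℝ) : ℂ) * (v 0 + v 1 * Complex.I) := by
  -- the derivative along the line spanned by `v`
  have h1 : HasFDerivAt hopfCoord (fderiv ℝ hopfCoord 0) ((0 : ℝ) • v) := by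
    rw [zero_smul]
    exact (contDiffAt_hopfCoord.differentiableAt (by simp)).hasFDerivAt
  have h2 : HasDerivAt (fun t : ℝ => t • v) v 0 := by
    simpa using (hasDerivAt_id (0 : ℝ)).smul_const v
  have h3 := h1.comp_hasDerivAt (0 : ℝ) h2
  have h4 : HasDerivAt (fun t : ℝ => (t : ℂ) * (8 * (v 0 + v 1 * Complex.I)))
      (8 * (v 0 + v 1 * Complex.I)) 0 := by
    simpa using (Complex.ofRealCLM.hasDerivAt (x := (0 : ℝ))).mul_const
      (8 * ((v 0 : ℂ) + v 1 * Complex.I))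
  have h5 : DifferentiableAt ℝ (fun t : ℝ => ((4 - ‖t • v‖ ^ 2 : ℝ) : ℂ) +
      4 * ((t • v) 2 : ℝ) * Complex.I) 0 := by
    simp only [norm_smul, mul_pow, Real.norm_eq_abs, sq_abs, PiLp.smul_apply, smul_eq_mul]
    have h60 : DifferentiableAt ℝ (fun t : ℝ => 4 - t ^ 2 * ‖v‖ ^ 2) 0 := by fun_prop
    have h70 : DifferentiableAt ℝ (fun t : ℝ => t * v 2) 0 := by fun_prop
    have h6 : DifferentiableAt ℝ (fun t : ℝ => ((4 - t ^ 2 * ‖v‖ ^ 2 : ℝ) : ℂ)) 0 :=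
      Complex.ofRealCLM.differentiableAt.comp (0 : ℝ) h60
    have h7 : DifferentiableAt ℝ (fun t : ℝ => ((t * v 2 : ℝ) : ℂ)) 0 :=
      Complex.ofRealCLM.differentiableAt.comp (0 : ℝ) h70
    exact h6.add ((h7.const_mul 4).mul_const _)
  have h8 := h4.div h5.hasDerivAt (by norm_num)
  have h9 : hopfCoord ∘ (fun t : ℝ => t • v) =
      (fun t : ℝ => (t : ℂ) * (8 * (v 0 + v 1 * Complex.I))) /
      fun t : ℝ => ((4 - ‖t • v‖ ^ 2 : ℝ) : ℂ) + 4 * ((t • v) 2 : ℝ) * Complex.I := by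
    ext t
    simp only [Function.comp_apply, Pi.div_apply, hopfCoord, PiLp.smul_apply, smul_eq_mul]
    push_cast
    ring
  rw [h9] at h3
  rw [h3.unique h8]
  simp
  ring

lemma fderiv_fderiv_eq_deriv_deriv {V F : Type} [NormedAddCommGroup V] [NormedSpace ℝ V]
    [NormedAddCommGroup F] [NormedSpace ℝ F] {f : V → F} (hf : ContDiffAt ℝ 2 f 0) (e : V) :
    fderiv ℝ (fun w => fderiv ℝ f w e) 0 e = deriv (deriv fun t : ℝ => f (t • e)) 0 := by
  have h2 (t : ℝ) : HasDerivAt (fun t : ℝ => t • e) e t := by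
    simpa using (hasDerivAt_id t).smul_const e
  have hd : ∀ᶠ w in 𝓝 (0 : V), DifferentiableAt ℝ f w := by
    filter_upwards [(hf.of_le one_le_two).eventually (by simp)] with w hw
    exact hw.differentiableAt (by simp)
  have h0 : Filter.Tendsto (fun t : ℝ => t • e) (𝓝 0) (𝓝 0) := by
    simpa using (h2 0).continuousAt.tendsto
  have h3 : deriv (fun t : ℝ => f (t • e)) =ᶠ[𝓝 0] fun t => fderiv ℝ f (t • e) e := by
    filter_upwards [h0.eventually hd] with t ht
    exact (ht.hasFDerivAt.comp_hasDerivAt t (h2 t)).deriv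
  rw [h3.deriv_eq]
  have h4 : DifferentiableAt ℝ (fun w => fderiv ℝ f w e) ((0 : ℝ) • e) := by
    rw [zero_smul]
    exact ((hf.fderiv_right (m := 1) (by norm_num)).differentiableAt (by simp)).clm_apply
      (differentiableAt_const e)
  have h5 := (h4.hasFDerivAt.comp_hasDerivAt (0 : ℝ) (h2 0)).deriv
  rw [zero_smul] at h5
  exact h5.symm

lemma laplacian_hopfCoord : ∑ i,
    fderiv ℝ (fun w => fderiv ℝ hopfCoord w (EuclideanSpace.single i 1)) 0
    (EuclideanSpace.single i 1) = 0 := by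
  refine Finset.sum_eq_zero fun i _ => ?_
  rw [fderiv_fderiv_eq_deriv_deriv (contDiffAt_hopfCoord.of_le (by norm_cast))]
  -- `hopfCoord` is odd on each coordinate axis
  refine deriv_deriv_zero_of_odd fun t => ?_
  simp only [hopfCoord, norm_smul]
  fin_cases i <;> simp <;> ring

/-- A linear isometry which is a reflection in the tangent plane at a fixed point is the reflection
in a great circle. -/
lemma isSphereReflection_of_det (b : S2 ≃ᵢ S2) (p : S2) (A : R2 ≃ₗᵢ[ℝ] R2)
    (h : ∀ u, b ((sphereCharts hopfBaseFrame).param p u) =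
      (sphereCharts hopfBaseFrame).param p (A u))
    (hA : LinearMap.det (A.toLinearEquiv : R2 →ₗ[ℝ] R2) ≠ 1) : IsSphereReflection b := by
  obtain ⟨L, hL⟩ := exists_linearIsometryEquiv_of_sphere b
  set e := hopfBaseFrame.frame p
  have he : ∀ u, inner ℝ (e u) (p : R3) = 0 := hopfBaseFrame.inner_frame p
  have hLp : L p = p := by
    have h0 := h 0
    rw [map_zero, ConformalCharts.param_zero] at h0
    rw [← hL, h0]
  have hLe (u : R2) : L (e u) = e (A u) := by
    have h1 := congrArg Subtype.val (h u)
    rw [hL, sphereCharts_param, sphereCharts_param] at h1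
    simp only [sphereParam, map_smul, map_add, hLp, A.norm_map] at h1
    have h2 : (4 + ‖u‖ ^ 2)⁻¹ ≠ 0 := by positivity
    have h3 := add_right_cancel (smul_right_injective R3 h2 h1)
    exact smul_right_injective R3 (four_ne_zero (α := ℝ)) h3
  obtain ⟨w, hw, h1, h2⟩ := (det_eq_one_or_exists_fixed A).resolve_left hA
  have hp0 : (p : R3) ≠ 0 := fun h0 => by
    have := sphere_inner_self p
    rw [h0, inner_zero_left] at this
    exact zero_ne_one this
  have hw0 : e w ≠ 0 := fun h0 => hw (e.injective (by rw [h0, map_zero]))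
  -- the plane through `p` and the fixed tangent vector
  refine ⟨Submodule.span ℝ (Set.range ![(p : R3), e w]), ?_, fun x => ?_⟩
  · rw [finrank_span_eq_card, Fintype.card_fin]
    refine linearIndependent_of_ne_zero_of_inner_eq_zero ?_ ?_
    · intro i; fin_cases i
      exacts [hp0, hw0]
    · intro i j hij
      fin_cases i <;> fin_cases j
      · exact absurd rfl hij
      · simpa [real_inner_comm] using he w
      · simpa [real_inner_comm] using he w
      · exact absurd rfl hij
  · rw [hL, eq_reflection L]
    · intro u hu
      induction hu using Submodule.span_induction with
      | mem y hy =>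
        obtain ⟨i, rfl⟩ := hy
        fin_cases i
        · exact hLp
        · exact (hLe w).trans (by rw [h1]; rfl)
      | zero => exact map_zero _
      | add y z _ _ hy hz => rw [map_add, hy, hz]
      | smul t y _ hy => rw [map_smul, hy]
    · intro u hu
      have hu1 : inner ℝ (p : R3) u = 0 :=
        hu _ (Submodule.subset_span ⟨0, rfl⟩)
      have hu2 : inner ℝ (e w) u = 0 :=
        hu _ (Submodule.subset_span ⟨1, rfl⟩)
      have hu3 : e (frameCoord e u) = u := by
        rw [frame_frameCoord he, hu1, zero_smul, sub_zero]
      rw [← hu3, hLe, h2, map_neg]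
      rw [inner_frameCoord, hu2]

/-- The model fibration given by the Hopf map. -/
def hopfFibration : ModelFibration (Subtype.val : S3 → R4) (Subtype.val : S2 → R3)
    hopfMap hopfCircles
    IsSphereReflection where
  ε := 1
  ε' := 1
  C := sphereCharts hopfFrame
  B := sphereCharts hopfBaseFrame
  contMDiffOn_chart := contMDiffOn_sphereCharts_chart hopfFrame
  contMDiff_param := contMDiff_sphereCharts_param hopfFrame
  isQuotientMap := isQuotientMap_hopfMap
  leaves_eq := by
    ext A
    constructor
    · rintro ⟨x, rfl⟩
      exact ⟨hopfMap x, (hopfCircle_eq x).symm⟩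
    · rintro ⟨y, rfl⟩
      obtain ⟨x, rfl⟩ := hopfMap_surjective y
      exact ⟨x, hopfCircle_eq x⟩
  dist_eq := by
    -- with `h = ‖hermitian x y‖` the distances are `√(4 (1 - h²))` and `t = √(2 - 2 h)`
    refine ⟨fun t => √(4 * (1 - (1 - t ^ 2 / 2) ^ 2)), fun x y => ?_⟩
    obtain ⟨y, rfl⟩ := hopfMap_surjective y
    beta_reduce
    rw [infDist_hopfMap_sq, eq_comm, ← Real.sqrt_sq (dist_nonneg (x := hopfMap x)),
      dist_hopfMap_sq]
    congr 1
    ring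
  geo := hopfGeo
  geo_add := hopfGeo_add
  geo_near := hopfGeo_near
  range_geo x := by
    rw [← range_hopfRotate]
    congr 1
    ext1 t
    exact hopfGeo_vertical x t
  Q := hopfCoord
  c := 2
  c_ne_zero := two_ne_zero
  contDiffAt_Q := contDiffAt_hopfCoord
  Q_zero := by simp [hopfCoord]
  fderiv_Q := fderiv_hopfCoord
  laplacian_Q := laplacian_hopfCoord
  π_param x := by
    -- the frame chosen at the image of `x` may come from another point of the fibre
    obtain ⟨A, hA⟩ := exists_frame_eq (hopfBaseFrame.inner_frame (hopfMap x))
      (inner_hopfBaseIsometry x)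
    refine ⟨Complex.orthonormalBasisOneI.repr.trans A, ?_⟩
    have hc : ContinuousAt (fun w : R3 => ((4 - ‖w‖ ^ 2 : ℝ) : ℂ) + 4 * (w 2 : ℝ) * Complex.I)
        0 := by
      apply Continuous.continuousAt
      have := (EuclideanSpace.proj (2 : Fin 3) : R3 →L[ℝ] ℝ).continuous
      have h2 : Continuous fun w : R3 => w 2 := this
      fun_prop
    filter_upwards [hc.eventually_ne (y := 0) (by simp)] with w hw
    apply Subtype.ext
    rw [hopfMap_coe, sphereCharts_param, sphereCharts_param, hopfPoly_sphereParam x w hw,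
      sphereParam, sphereParam, hA, hopfMap_coe]
    simp
  isReflection_of_det := isSphereReflection_of_det

end Hopf

/-! ### Maps into and out of manifolds in the preferred charts -/

section PreferredCharts

variable {k : ℕ} {M : Type} [TopologicalSpace M] [ChartedSpace (EuclideanSpace ℝ (Fin k)) M]
  {F : Type} [NormedAddCommGroup F] [NormedSpace ℝ F]

lemma hasMFDerivAt_of_chart_comp {G : F → M} {u : F} {L : F →L[ℝ] EuclideanSpace ℝ (Fin k)}
    (hc : ContinuousAt G u)
    (h : HasFDerivAt (chartAt (EuclideanSpace ℝ (Fin k)) (G u) ∘ G) L u) :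
    HasMFDerivAt 𝓘(ℝ, F) (𝓡 k) G u L := by
  exact ⟨hc, h.hasFDerivWithinAt⟩

lemma hasMFDerivAt_of_comp_chart {f : M → F} {m : M} {L : EuclideanSpace ℝ (Fin k) →L[ℝ] F}
    (hc : ContinuousAt f m)
    (h : HasFDerivAt (f ∘ (chartAt (EuclideanSpace ℝ (Fin k)) m).symm) L
      (chartAt (EuclideanSpace ℝ (Fin k)) m m)) :
    HasMFDerivAt (𝓡 k) 𝓘(ℝ, F) f m L := by
  exact ⟨hc, h.hasFDerivWithinAt⟩

lemma contMDiffAt_of_chart_comp {n : WithTop ℕ∞} {G : F → M} {u : F}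
    (hc : ContinuousAt G u)
    (h : ContDiffAt ℝ n (chartAt (EuclideanSpace ℝ (Fin k)) (G u) ∘ G) u) :
    ContMDiffAt 𝓘(ℝ, F) (𝓡 k) n G u := by
  rw [contMDiffAt_iff]
  exact ⟨hc, by simpa [Function.comp_def] using! h.contDiffWithinAt⟩

lemma contMDiffAt_of_comp_chart {n : WithTop ℕ∞} {f : M → F} {m : M}
    (hc : ContinuousAt f m)
    (h : ContDiffAt ℝ n (f ∘ (chartAt (EuclideanSpace ℝ (Fin k)) m).symm)
      (chartAt (EuclideanSpace ℝ (Fin k)) m m)) :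
    ContMDiffAt (𝓡 k) 𝓘(ℝ, F) n f m := by
  rw [contMDiffAt_iff]
  exact ⟨hc, by simpa [Function.comp_def] using! h.contDiffWithinAt⟩

end PreferredCharts

/-! ### The quotient manifold -/

/-- The Euclidean inner product, as a bilinear form. -/
def euclideanForm (k : ℕ) :
    EuclideanSpace ℝ (Fin k) →L[ℝ] EuclideanSpace ℝ (Fin k) →L[ℝ] ℝ := innerSL ℝ

@[simp] lemma euclideanForm_apply {k : ℕ} (v w : EuclideanSpace ℝ (Fin k)) :
    euclideanForm k v w = inner ℝ v w := rfl

lemma contDiff_confFactor_smul {V F : Type} [NormedAddCommGroup V] [InnerProductSpace ℝ V]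
    [NormedAddCommGroup F] [NormedSpace ℝ F] {ε : ℝ} (hε : 0 ≤ ε) (x : F) :
    ContDiff ℝ ∞ fun u : V => confFactor ε u • x :=
  (contDiff_confFactor hε).smul contDiff_const

section Quotient

variable {k : ℕ} {ε : ℝ} {X E : Type} [MetricSpace X] [NormedAddCommGroup E]
  [InnerProductSpace ℝ E] {ι : X → E}

/-- The atlas of the orbit space `X / Γ` is obtained from conformal charts of `X`: the chart at `m`
is the chart of `X` at a point `lift m` over `m`, composed with a local inverse of the
projection. -/
structure AdaptedAtlas (C : ConformalCharts k ε ι) (Γ : Subgroup (X ≃ᵢ X))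
    [ChartedSpace (EuclideanSpace ℝ (Fin k)) (OrbitSpace Γ)] where
  lift : OrbitSpace Γ → X
  orbitProj_lift : ∀ m, orbitProj Γ (lift m) = m
  chartAt_self : ∀ m : OrbitSpace Γ, chartAt (EuclideanSpace ℝ (Fin k)) m m = 0
  symm_apply : ∀ (m : OrbitSpace Γ) (u : EuclideanSpace ℝ (Fin k)),
    (chartAt (EuclideanSpace ℝ (Fin k)) m).symm u = orbitProj Γ (C.param (lift m) u)
  chart_apply : ∀ (m : OrbitSpace Γ) (z : X),
    orbitProj Γ z ∈ (chartAt (EuclideanSpace ℝ (Fin k)) m).source →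
    ∃ a ∈ Γ, a z ∈ (C.chart (lift m)).source ∧ ∀ᶠ y in 𝓝 z,
      chartAt (EuclideanSpace ℝ (Fin k)) m (orbitProj Γ y) = C.chart (lift m) (a y)

variable (C : ConformalCharts k ε ι) {Γ : Subgroup (X ≃ᵢ X)}

namespace AdaptedAtlas

variable {C} [ChartedSpace (EuclideanSpace ℝ (Fin k)) (OrbitSpace Γ)] (𝒜 : AdaptedAtlas C Γ)

include 𝒜

lemma zero_mem_target (m : OrbitSpace Γ) : (0 : EuclideanSpace ℝ (Fin k)) ∈
    (chartAt (EuclideanSpace ℝ (Fin k)) m).target := by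
  rw [← 𝒜.chartAt_self m]
  exact (chartAt (EuclideanSpace ℝ (Fin k)) m).map_source (mem_chart_source _ m)

lemma target_mem_nhds (m : OrbitSpace Γ) : (chartAt (EuclideanSpace ℝ (Fin k)) m).target ∈ 𝓝 0 :=
  (chartAt (EuclideanSpace ℝ (Fin k)) m).open_target.mem_nhds (𝒜.zero_mem_target m)

/-- Two adapted charts are related by a change of conformal charts of `X` and an orthogonal
transformation. -/
lemma exists_transition {m m' : OrbitSpace Γ} {u : EuclideanSpace ℝ (Fin k)}
    (hu : (chartAt (EuclideanSpace ℝ (Fin k)) m).symm u ∈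
        (chartAt (EuclideanSpace ℝ (Fin k)) m').source) :
    ∃ (y : X) (A : EuclideanSpace ℝ (Fin k) ≃ₗᵢ[ℝ] EuclideanSpace ℝ (Fin k)),
      C.param y (A u) ∈ (C.chart (𝒜.lift m')).source ∧
      (chartAt (EuclideanSpace ℝ (Fin k)) m' ∘ (chartAt (EuclideanSpace ℝ (Fin k)) m).symm) =ᶠ[𝓝 u]
          (C.transition y (𝒜.lift m') ∘ A) := by
  rw [𝒜.symm_apply] at hu
  obtain ⟨a, ha, haz, h⟩ := 𝒜.chart_apply m' _ hu
  refine ⟨a (𝒜.lift m), C.linearPart a (𝒜.lift m), ?_, ?_⟩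
  · rwa [← C.apply_param]
  · filter_upwards [(C.continuous_param (𝒜.lift m)).continuousAt.eventually h] with v hv
    rw [Function.comp_apply, 𝒜.symm_apply, hv, C.apply_param]
    rfl

lemma contDiffAt_transition {m m' : OrbitSpace Γ} {u : EuclideanSpace ℝ (Fin k)}
    (hu : (chartAt (EuclideanSpace ℝ (Fin k)) m).symm u ∈
        (chartAt (EuclideanSpace ℝ (Fin k)) m').source) :
    ContDiffAt ℝ ∞ (chartAt (EuclideanSpace ℝ (Fin k)) m' ∘
        (chartAt (EuclideanSpace ℝ (Fin k)) m).symm) u := by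
  obtain ⟨y, A, hy, h⟩ := 𝒜.exists_transition hu
  exact ((C.contDiffAt_transition hy).comp u A.toContinuousLinearEquiv.contDiff.contDiffAt)
    |>.congr_of_eventuallyEq h

lemma inner_fderiv_transition {m m' : OrbitSpace Γ} {u : EuclideanSpace ℝ (Fin k)}
    (hu : (chartAt (EuclideanSpace ℝ (Fin k)) m).symm u ∈
        (chartAt (EuclideanSpace ℝ (Fin k)) m').source) (v w : EuclideanSpace ℝ (Fin k)) :
    confFactor ε (chartAt (EuclideanSpace ℝ (Fin k)) m'
        ((chartAt (EuclideanSpace ℝ (Fin k)) m).symm u)) *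
      inner ℝ (fderiv ℝ (chartAt (EuclideanSpace ℝ (Fin k)) m' ∘
          (chartAt (EuclideanSpace ℝ (Fin k)) m).symm) u v)
        (fderiv ℝ (chartAt (EuclideanSpace ℝ (Fin k)) m' ∘
            (chartAt (EuclideanSpace ℝ (Fin k)) m).symm) u w) = confFactor ε u * inner ℝ v w := by
  obtain ⟨y, A, hy, h⟩ := 𝒜.exists_transition hu
  have h0 := h.eq_of_nhds
  simp only [Function.comp_apply] at h0
  have hd : DifferentiableAt ℝ (C.transition y (𝒜.lift m')) (A u) :=
    (C.contDiffAt_transition hy).differentiableAt (by simp)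
  have h1 : fderiv ℝ (chartAt (EuclideanSpace ℝ (Fin k)) m' ∘
      (chartAt (EuclideanSpace ℝ (Fin k)) m).symm) u =
      (fderiv ℝ (C.transition y (𝒜.lift m')) (A u)).comp
        (A.toContinuousLinearEquiv : EuclideanSpace ℝ (Fin k) →L[ℝ] EuclideanSpace ℝ (Fin k)) := by
    rw [h.fderiv_eq]
    exact (hd.hasFDerivAt.comp u A.toContinuousLinearEquiv.hasFDerivAt).fderiv
  rw [h0, h1, ← A.inner_map_map v w, ← confFactor_congr (A.norm_map u)]
  exact C.inner_fderiv_transition hy (A v) (A w)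

/-- In a neighbourhood of `z`, the adapted chart at the image of `z` is, up to an orthogonal
transformation, the chart of `X` at `z`. -/
lemma chart_orbitProj (z : X) : ∃ a ∈ Γ, a z = 𝒜.lift (orbitProj Γ z) ∧
    ∀ᶠ y in 𝓝 z, chartAt (EuclideanSpace ℝ (Fin k)) (orbitProj Γ z) (orbitProj Γ y) =
        C.linearPart a z (C.chart z y) := by
  obtain ⟨a, ha, haz, h⟩ := 𝒜.chart_apply (orbitProj Γ z) z (mem_chart_source _ _)
  have h0 := h.self_of_nhds
  rw [𝒜.chartAt_self] at h0
  have hz : a z = 𝒜.lift (orbitProj Γ z) := by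
    rw [← C.param_chart haz, ← h0, C.param_zero]
  refine ⟨a, ha, hz, ?_⟩
  filter_upwards [h, (C.chart z).open_source.mem_nhds (C.mem_source z)] with y hy hys
  rw [hy, ← hz, C.chart_apply hys]

lemma extChartAt_symm_apply (m : OrbitSpace Γ) (u : EuclideanSpace ℝ (Fin k)) :
    (extChartAt (𝓡 k) m).symm u = orbitProj Γ (C.param (𝒜.lift m) u) := 𝒜.symm_apply m u

lemma extChartAt_self (m : OrbitSpace Γ) : extChartAt (𝓡 k) m m = 0 := 𝒜.chartAt_self m

lemma hasMFDerivAt_extChartAt_symm {m : OrbitSpace Γ} {u : EuclideanSpace ℝ (Fin k)}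
    (hu : u ∈ (chartAt (EuclideanSpace ℝ (Fin k)) m).target) :
    HasMFDerivAt (𝓡 k) (𝓡 k) (extChartAt (𝓡 k) m).symm u
      (fderiv ℝ (chartAt (EuclideanSpace ℝ (Fin k))
        ((chartAt (EuclideanSpace ℝ (Fin k)) m).symm u) ∘
        (chartAt (EuclideanSpace ℝ (Fin k)) m).symm) u) := by
  refine hasMFDerivAt_of_chart_comp ?_ ?_
  · exact (chartAt (EuclideanSpace ℝ (Fin k)) m).symm.continuousAt hu
  · exact ((𝒜.contDiffAt_transition (mem_chart_source _ _)).differentiableAt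
      (by simp)).hasFDerivAt

section Manifold

omit 𝒜 in
/-- The Euclidean inner product on the tangent space at `m`, identified with `ℝᵏ` by the preferred
chart at `m`. -/
def tangentInner (m : OrbitSpace Γ) :
    TangentSpace (𝓡 k) m →L[ℝ] TangentSpace (𝓡 k) m →L[ℝ] ℝ := euclideanForm k

variable [IsManifold (𝓡 k) ∞ (OrbitSpace Γ)]

/-- In the trivialization given by the chart at `x` the form is the multiple `confFactor` of the
Euclidean one, since the changes of charts preserve the conformal metric. -/
lemma contMDiff_tangentInner : ContMDiff (𝓡 k)
    ((𝓡 k).prod 𝓘(ℝ, EuclideanSpace ℝ (Fin k) →L[ℝ] EuclideanSpace ℝ (Fin k) →L[ℝ] ℝ)) ∞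
    (fun m : OrbitSpace Γ => Bundle.TotalSpace.mk'
      (EuclideanSpace ℝ (Fin k) →L[ℝ] EuclideanSpace ℝ (Fin k) →L[ℝ] ℝ) m
      (tangentInner (k := k) m)) := by
  intro x
  rw [Bundle.contMDiffAt_section]
  have hsm : ContMDiffAt (𝓡 k) 𝓘(ℝ, EuclideanSpace ℝ (Fin k) →L[ℝ] EuclideanSpace ℝ (Fin k) →L[ℝ] ℝ)
      ∞ (fun m : OrbitSpace Γ => confFactor ε (extChartAt (𝓡 k) x m) • euclideanForm k) x := by
    have h1 : ContMDiffAt (𝓡 k) 𝓘(ℝ, EuclideanSpace ℝ (Fin k)) ∞ (extChartAt (𝓡 k) x) x :=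
      contMDiffAt_extChartAt
    have h2 : ContDiff ℝ ∞ fun u : EuclideanSpace ℝ (Fin k) =>
        confFactor ε u • euclideanForm k :=
      contDiff_confFactor_smul C.nonneg (euclideanForm k)
    exact h2.contMDiff.contMDiffAt.comp x h1
  refine hsm.congr_of_eventuallyEq ?_
  filter_upwards [(chartAt (EuclideanSpace ℝ (Fin k)) x).open_source.mem_nhds
    (mem_chart_source _ x)] with m hm
  have hmx := (chartAt (EuclideanSpace ℝ (Fin k)) x).left_inv hm
  have h1 := 𝒜.inner_fderiv_transition (m := x) (m' := m)
    (u := chartAt (EuclideanSpace ℝ (Fin k)) x m) (by rw [hmx]; exact mem_chart_source _ m)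
  rw [hmx, 𝒜.chartAt_self, confFactor_zero] at h1
  ext v w
  rw [hom_trivializationAt_apply]
  have h2 := h1 v w
  rw [one_mul] at h2
  simp [ContinuousLinearMap.inCoordinates, hm]
  refine Eq.trans ?_ h2
  have hs : ∀ u : EuclideanSpace ℝ (Fin k),
      Bundle.Trivialization.symmL ℝ
          (trivializationAt (EuclideanSpace ℝ (Fin k)) (TangentSpace (𝓡 k)) x) m u =
      fderiv ℝ (chartAt (EuclideanSpace ℝ (Fin k)) m ∘ (chartAt (EuclideanSpace ℝ (Fin k)) x).symm)
          (chartAt (EuclideanSpace ℝ (Fin k)) x m) u := by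
    intro u
    rw [TangentBundle.symmL_trivializationAt_eq_core hm,
      tangentBundleCore_coordChange_achart]
    change fderivWithin ℝ
        (chartAt (EuclideanSpace ℝ (Fin k)) m ∘ (chartAt (EuclideanSpace ℝ (Fin k)) x).symm)
            (Set.range id) (chartAt (EuclideanSpace ℝ (Fin k)) x m) u = _
    rw [Set.range_id, fderivWithin_univ]
  rw [← hs, ← hs]
  erw [hom_trivializationAt_apply]
  simp [ContinuousLinearMap.inCoordinates]
  rfl

/-- The Riemannian metric of `X / Γ`: since the adapted charts are isometric at their centres, it is
the Euclidean inner product on the tangent space at `m` identified with `ℝᵏ` by the chart at `m`. -/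
def metric : RiemMetric k (OrbitSpace Γ) where
  inner m := tangentInner m
  symm _ v w := real_inner_comm (F := EuclideanSpace ℝ (Fin k)) w v
  pos _ v hv := (real_inner_self_pos (F := EuclideanSpace ℝ (Fin k)) (x := v)).2 hv
  isVonNBounded x := by
    change Bornology.IsVonNBounded ℝ {v : EuclideanSpace ℝ (Fin k) | inner ℝ v v < 1}
    refine (NormedSpace.isVonNBounded_ball ℝ (EuclideanSpace ℝ (Fin k)) 1).subset fun v hv => ?_
    have hv' : inner ℝ v v < 1 := hv
    rw [real_inner_self_eq_norm_sq, sq_lt_one_iff₀ (norm_nonneg _)] at hv'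
    simpa using hv'
  contMDiff := 𝒜.contMDiff_tangentInner

/-- The metric is conformal in the adapted charts, with the same factor as in the charts of `X`. -/
lemma coordMetric_eq {m : OrbitSpace Γ} {u : EuclideanSpace ℝ (Fin k)}
    (hu : u ∈ (chartAt (EuclideanSpace ℝ (Fin k)) m).target) :
    coordMetric 𝒜.metric m u = Matrix.of fun i j => if i = j then confFactor ε u else 0 := by
  have h1 := 𝒜.inner_fderiv_transition (m := m)
    (m' := (chartAt (EuclideanSpace ℝ (Fin k)) m).symm u) (u := u) (mem_chart_source _ _)
  rw [𝒜.chartAt_self, confFactor_zero] at h1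
  ext i j
  have h2 := h1 (EuclideanSpace.single i 1) (EuclideanSpace.single j 1)
  rw [one_mul] at h2
  simp only [coordMetric, Matrix.of_apply]
  rw [(𝒜.hasMFDerivAt_extChartAt_symm hu).mfderiv]
  refine h2.trans ?_
  simp [EuclideanSpace.inner_single_left]

lemma coordMetric_zero (m : OrbitSpace Γ) : coordMetric 𝒜.metric m 0 = 1 := by
  rw [𝒜.coordMetric_eq (𝒜.zero_mem_target m)]
  ext i j
  simp [confFactor_zero, Matrix.one_apply]

/-- The adapted charts are normal at their centres up to second order. -/
lemma partialDeriv_coordMetric (m : OrbitSpace Γ) (l i j : Fin k) :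
    partialDeriv l (fun z => coordMetric 𝒜.metric m z i j) 0 = 0 := by
  have h : (fun z => coordMetric 𝒜.metric m z i j) =ᶠ[𝓝 0]
      fun z => if i = j then confFactor ε z else 0 := by
    filter_upwards [𝒜.target_mem_nhds m] with z hz
    rw [𝒜.coordMetric_eq hz, Matrix.of_apply]
  rw [partialDeriv, h.fderiv_eq]
  by_cases hij : i = j
  · simp [hij, fderiv_confFactor_zero C.nonneg]
  · simp [hij]

lemma christoffel_zero (m : OrbitSpace Γ) (l i j : Fin k) :
    christoffel 𝒜.metric m l i j 0 = 0 := by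
  simp [christoffel, 𝒜.partialDeriv_coordMetric]

/-- The Laplacian at a point is the Euclidean one in the adapted chart centred there, because the
Christoffel symbols vanish at the centre. -/
lemma laplaceBeltrami_eq (f : OrbitSpace Γ → ℝ) (m : OrbitSpace Γ) :
    laplaceBeltrami 𝒜.metric f m =
      ∑ i, partialDeriv i (partialDeriv i fun u => f (orbitProj Γ (C.param (𝒜.lift m) u))) 0 := by
  have h : f ∘ (extChartAt (𝓡 k) m).symm = fun u => f (orbitProj Γ (C.param (𝒜.lift m) u)) :=
    funext fun u => congrArg f (𝒜.extChartAt_symm_apply m u)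
  simp only [laplaceBeltrami, 𝒜.extChartAt_self, h, 𝒜.coordMetric_zero, 𝒜.christoffel_zero]
  simp [Matrix.one_apply]

end Manifold

lemma contMDiffAt_of_comp {F : Type} [NormedAddCommGroup F] [NormedSpace ℝ F] {n : WithTop ℕ∞}
    {f : OrbitSpace Γ → F} {m : OrbitSpace Γ} (hf : ContinuousAt f m)
    (h : ContDiffAt ℝ n (fun u => f (orbitProj Γ (C.param (𝒜.lift m) u))) 0) :
    ContMDiffAt (𝓡 k) 𝓘(ℝ, F) n f m := by
  refine contMDiffAt_of_comp_chart hf ?_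
  rw [𝒜.chartAt_self]
  refine h.congr_of_eventuallyEq (Filter.Eventually.of_forall fun u => ?_)
  exact congrArg f (𝒜.symm_apply m u)

lemma hasMFDerivAt_of_comp {F : Type} [NormedAddCommGroup F] [NormedSpace ℝ F]
    {f : OrbitSpace Γ → F} {m : OrbitSpace Γ} {L : EuclideanSpace ℝ (Fin k) →L[ℝ] F}
    (hf : ContinuousAt f m)
    (h : HasFDerivAt (fun u => f (orbitProj Γ (C.param (𝒜.lift m) u))) L 0) :
    HasMFDerivAt (𝓡 k) 𝓘(ℝ, F) f m L := by
  refine hasMFDerivAt_of_comp_chart hf ?_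
  rw [𝒜.chartAt_self]
  exact h.congr_of_eventuallyEq (Filter.Eventually.of_forall fun u =>
    congrArg f (𝒜.symm_apply m u))

/-! ### The projection to the quotient -/

/-- The projection, and a local inverse of it, in adapted charts. -/
lemma exists_local_expression (x : X) :
    ∃ A : EuclideanSpace ℝ (Fin k) ≃ₗᵢ[ℝ] EuclideanSpace ℝ (Fin k), ∀ᶠ y in 𝓝 x,
      chartAt (EuclideanSpace ℝ (Fin k)) (orbitProj Γ x) (orbitProj Γ y) = A (C.chart x y) ∧
      C.param x (A.symm (chartAt (EuclideanSpace ℝ (Fin k)) (orbitProj Γ x) (orbitProj Γ y))) =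
        y := by
  obtain ⟨a, ha, haz, h⟩ := 𝒜.chart_orbitProj x
  refine ⟨C.linearPart a x, ?_⟩
  filter_upwards [h, (C.chart x).open_source.mem_nhds (C.mem_source x)] with y hy hys
  rw [hy, LinearIsometryEquiv.symm_apply_apply, C.param_chart hys]
  exact ⟨rfl, rfl⟩

section Smooth

variable [ChartedSpace (EuclideanSpace ℝ (Fin k)) X]

lemma contMDiff_orbitProj
    (hchart : ∀ x, ContMDiffOn (𝓡 k) (𝓡 k) ∞ (C.chart x) (C.chart x).source) :
    ContMDiff (𝓡 k) (𝓡 k) ∞ (orbitProj Γ) := by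
  intro x
  rw [contMDiffAt_iff_target]
  refine ⟨(continuous_orbitProj).continuousAt, ?_⟩
  obtain ⟨A, hA⟩ := 𝒜.exists_local_expression x
  have h : ContMDiffAt (𝓡 k) (𝓡 k) ∞ (A ∘ C.chart x) x :=
    A.toContinuousLinearEquiv.contDiff.contMDiff.contMDiffAt.comp x
      ((hchart x).contMDiffAt ((C.chart x).open_source.mem_nhds (C.mem_source x)))
  refine h.congr_of_eventuallyEq ?_
  filter_upwards [hA] with y hy using hy.1

variable [IsManifold (𝓡 k) ∞ (OrbitSpace Γ)]

lemma isRiemannianQuotient [LocallyCompactSpace X] [SecondCountableTopology X]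
    (hΓ : ActsDiscontinuously Γ) (hfree : ActsFreely Γ)
    (hchart : ∀ x, ContMDiffOn (𝓡 k) (𝓡 k) ∞ (C.chart x) (C.chart x).source)
    (hparam : ∀ x, ContMDiff (𝓡 k) (𝓡 k) ∞ (C.param x)) :
    IsRiemannianQuotient ι (orbitProj Γ) 𝒜.metric where
  t2 := hΓ.t2Space_orbitSpace
  secondCountable := secondCountableTopology_orbitSpace
  isCoveringMap := hΓ.isCoveringMap_orbitProj hfree
  isLocalDiffeomorph x := by
    obtain ⟨e, hx, he⟩ := (hΓ.isCoveringMap_orbitProj hfree).isLocalHomeomorph x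
    have hq := 𝒜.contMDiff_orbitProj hchart
    refine ⟨⟨e.toPartialEquiv, e.open_source, e.open_target, ?_, ?_⟩, hx, fun y _ => ?_⟩
    · exact (he ▸ hq).contMDiffOn
    · intro m hm
      refine ContMDiffAt.contMDiffWithinAt ?_
      obtain ⟨A, hA⟩ := 𝒜.exists_local_expression (e.symm m)
      have hm' : orbitProj Γ (e.symm m) = m := by rw [he]; exact e.right_inv hm
      rw [hm'] at hA
      have h : ContMDiffAt (𝓡 k) (𝓡 k) ∞
          (C.param (e.symm m) ∘ A.symm ∘ extChartAt (𝓡 k) m) m :=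
        (hparam _).contMDiffAt.comp m
          (A.symm.toContinuousLinearEquiv.contDiff.contMDiff.contMDiffAt.comp m
            contMDiffAt_extChartAt)
      refine h.congr_of_eventuallyEq ?_
      filter_upwards [(e.symm.continuousAt hm).eventually hA, e.open_target.mem_nhds hm]
        with m' hm' hmt
      have h1 : orbitProj Γ (e.symm m') = m' := by rw [he]; exact e.right_inv hmt
      rw [h1] at hm'
      exact hm'.2.symm
    · exact congrFun he y
  isometric x v w := by
    obtain ⟨A, hA⟩ := 𝒜.exists_local_expression x
    set L : EuclideanSpace ℝ (Fin k) →L[ℝ] E := (fderiv ℝ (ι ∘ C.param x) 0).comp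
      (A.symm.toContinuousLinearEquiv : EuclideanSpace ℝ (Fin k) →L[ℝ] EuclideanSpace ℝ (Fin k))
      with hL
    set G : OrbitSpace Γ → E := fun m => (ι ∘ C.param x)
      (A.symm (chartAt (EuclideanSpace ℝ (Fin k)) (orbitProj Γ x) m)) with hG
    have hL0 : HasFDerivAt (fun u => (ι ∘ C.param x) (A.symm u)) L 0 := by
      have h0 := C.differentiableAt_param x 0
      rw [← map_zero A.symm] at h0
      have := h0.hasFDerivAt.comp (0 : EuclideanSpace ℝ (Fin k))
        A.symm.toContinuousLinearEquiv.hasFDerivAt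
      rw [map_zero] at this
      exact this
    have hGd : HasMFDerivAt (𝓡 k) 𝓘(ℝ, E) G (orbitProj Γ x) L := by
      refine hasMFDerivAt_of_comp_chart ?_ ?_
      · refine ContinuousAt.comp (f := chartAt (EuclideanSpace ℝ (Fin k)) (orbitProj Γ x))
          (g := fun u => (ι ∘ C.param x) (A.symm u)) ?_
          ((chartAt (EuclideanSpace ℝ (Fin k)) (orbitProj Γ x)).continuousAt
            (mem_chart_source _ _))
        rw [𝒜.chartAt_self]
        exact hL0.continuousAt
      · rw [𝒜.chartAt_self]
        refine hL0.congr_of_eventuallyEq ?_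
        filter_upwards [𝒜.target_mem_nhds (orbitProj Γ x)] with u hu
        simp only [hG, Function.comp_apply]
        rw [(chartAt (EuclideanSpace ℝ (Fin k)) (orbitProj Γ x)).right_inv hu]
    -- near `x`, `ι` is the composite of `G` with the projection, and the differential of `G` is
    -- isometric because the conformal factor is `1` at the origin
    have hq : MDifferentiableAt (𝓡 k) (𝓡 k) (orbitProj Γ) x :=
      (𝒜.contMDiff_orbitProj hchart).mdifferentiable (by simp) x
    have hιd : HasMFDerivAt (𝓡 k) 𝓘(ℝ, E) ι x
        (L.comp (mfderiv (𝓡 k) (𝓡 k) (orbitProj Γ) x)) := by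
      refine (hGd.comp x hq.hasMFDerivAt).congr_of_eventuallyEq ?_
      filter_upwards [hA] with y hy
      simp only [hG, Function.comp_apply, hy.2]
    rw [hιd.mfderiv]
    have key : ∀ a b : EuclideanSpace ℝ (Fin k), inner ℝ (L a) (L b) = inner ℝ a b := by
      intro a b
      refine (C.inner_fderiv_param x 0 (A.symm a) (A.symm b)).trans ?_
      rw [confFactor_zero, one_mul, A.symm.inner_map_map]
    exact (key _ _).symm

end Smooth

end AdaptedAtlas

section Existence

/-- The chart at `m` of the orbit space of a group acting by covering transformations. -/
def quotientChart (hcov : IsCoveringMap (orbitProj Γ)) (m : OrbitSpace Γ) :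
    OpenPartialHomeomorph (OrbitSpace Γ) (EuclideanSpace ℝ (Fin k)) :=
  (hcov.isLocalHomeomorph (Quotient.out m)).choose.symm.trans (C.chart (Quotient.out m))

lemma mem_quotientChart_source (hcov : IsCoveringMap (orbitProj Γ)) (m : OrbitSpace Γ) :
    m ∈ (quotientChart C hcov m).source ∧ quotientChart C hcov m m = 0 := by
  have h := (hcov.isLocalHomeomorph (Quotient.out m)).choose_spec
  unfold quotientChart
  set e := (hcov.isLocalHomeomorph (Quotient.out m)).choose
  have h1 : orbitProj Γ (Quotient.out m) = m := Quotient.out_eq m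
  have h2 : m ∈ e.target := by
    have := e.map_source h.1
    rwa [← h.2, h1] at this
  have h3 : e.symm m = Quotient.out m := by
    have := e.left_inv h.1
    rwa [← h.2, h1] at this
  refine ⟨?_, ?_⟩
  · rw [OpenPartialHomeomorph.trans_source]
    refine ⟨h2, ?_⟩
    rw [Set.mem_preimage, h3]
    exact C.mem_source _
  · rw [OpenPartialHomeomorph.trans_apply, h3, C.chart_self]

/-- The smooth structure of the orbit space of a group acting by covering transformations. -/
@[reducible]
def quotientChartedSpace (hcov : IsCoveringMap (orbitProj Γ)) :
    ChartedSpace (EuclideanSpace ℝ (Fin k)) (OrbitSpace Γ) where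
  atlas := Set.range (quotientChart C hcov)
  chartAt := quotientChart C hcov
  mem_chart_source m := (mem_quotientChart_source C hcov m).1
  chart_mem_atlas m := ⟨m, rfl⟩

/-- The charts of the orbit space are adapted to those of `X`. -/
def quotientAdaptedAtlas (hcov : IsCoveringMap (orbitProj Γ)) :
    @AdaptedAtlas k ε X E _ _ _ ι C Γ (quotientChartedSpace C hcov) := by
  letI := quotientChartedSpace C hcov
  exact
  { lift := Quotient.out
    orbitProj_lift := Quotient.out_eq
    chartAt_self := fun m => (mem_quotientChart_source C hcov m).2
    symm_apply := fun m u =>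
      (congrFun (hcov.isLocalHomeomorph (Quotient.out m)).choose_spec.2 _).symm
    chart_apply := fun m z hz => by
      have h := (hcov.isLocalHomeomorph (Quotient.out m)).choose_spec
      change orbitProj Γ z ∈ (quotientChart C hcov m).source at hz
      change ∃ a ∈ Γ, a z ∈ (C.chart (Quotient.out m)).source ∧ ∀ᶠ y in 𝓝 z,
        quotientChart C hcov m (orbitProj Γ y) = C.chart (Quotient.out m) (a y)
      unfold quotientChart at hz ⊢
      set e := (hcov.isLocalHomeomorph (Quotient.out m)).choose
      rw [OpenPartialHomeomorph.trans_source] at hz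
      have h1 : orbitProj Γ (e.symm (orbitProj Γ z)) = orbitProj Γ z := by
        rw [h.2]
        exact e.right_inv (h.2 ▸ hz.1)
      obtain ⟨a, ha, haz⟩ := orbitProj_eq_iff.1 h1.symm
      refine ⟨a, ha, ?_, ?_⟩
      · rw [haz]
        exact hz.2
      · have h2 : a z ∈ e.source := by
          rw [haz]
          exact e.map_target hz.1
        filter_upwards [a.continuous.continuousAt.preimage_mem_nhds
          (e.open_source.mem_nhds h2)] with y hy
        rw [OpenPartialHomeomorph.trans_apply]
        congr 1
        have h3 : orbitProj Γ y = e (a y) := by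
          rw [← h.2, orbitProj_apply ha]
        rw [h3]
        exact e.left_inv hy }

lemma isManifold_quotient (hcov : IsCoveringMap (orbitProj Γ)) :
    @IsManifold ℝ _ _ _ _ _ _ (𝓡 k) ∞ (OrbitSpace Γ) _ (quotientChartedSpace C hcov) := by
  let := quotientChartedSpace C hcov
  have 𝒜 := quotientAdaptedAtlas C hcov
  refine isManifold_of_contDiffOn (𝓡 k) ∞ (OrbitSpace Γ) ?_
  rintro _ _ ⟨m, rfl⟩ ⟨m', rfl⟩ u hu
  have hu2 : u ∈ ((quotientChart C hcov m).symm.trans (quotientChart C hcov m')).source := hu.1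
  rw [OpenPartialHomeomorph.trans_source] at hu2
  exact (𝒜.contDiffAt_transition (m := m) (m' := m') hu2.2).contDiffWithinAt

end Existence

end Quotient

/-! ### Descent of isometries and the leaf space -/

namespace ModelFibration

variable {X Y E E' : Type} [MetricSpace X] [MetricSpace Y] [NormedAddCommGroup E]
  [InnerProductSpace ℝ E] [NormedAddCommGroup E'] [InnerProductSpace ℝ E'] [ChartedSpace R3 X]
  {ι : X → E} {κ : Y → E'} {π : X → Y} {leaves : Set (Set X)} {isReflection : (Y ≃ᵢ Y) → Prop}
  (𝓜 : ModelFibration ι κ π leaves isReflection) {Γ : Subgroup (X ≃ᵢ X)}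

include 𝓜

lemma surjective : Function.Surjective π := 𝓜.isQuotientMap.surjective

lemma image_fibre (hΓ : PreservesLeaves Γ leaves) {a : X ≃ᵢ X} (ha : a ∈ Γ) (x : X) :
    a '' (π ⁻¹' {π x}) = π ⁻¹' {π (a x)} := by
  have h := hΓ a ha (π ⁻¹' {π x}) (by rw [𝓜.leaves_eq]; exact ⟨π x, rfl⟩)
  rw [𝓜.leaves_eq] at h
  obtain ⟨y, hy⟩ := h
  have h1 : a x ∈ π ⁻¹' {y} := by
    change π ⁻¹' {y} = _ at hy
    rw [hy]
    exact ⟨x, rfl, rfl⟩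
  rw [← hy, show π (a x) = y from h1]

/-- The distance of two points of the base is determined by the distance of a point of the total
space from a fibre, so an isometry that permutes the fibres descends to an isometry. -/
lemma exists_descent (hΓ : PreservesLeaves Γ leaves) {a : X ≃ᵢ X} (ha : a ∈ Γ) :
    ∃ b : Y ≃ᵢ Y, ∀ x, π (a x) = b (π x) := by
  have hwell : ∀ {a : X ≃ᵢ X}, a ∈ Γ → ∀ x x', π x = π x' → π (a x) = π (a x') := by
    intro a ha x x' h
    have h1 : a x ∈ a '' (π ⁻¹' {π x'}) := ⟨x, h, rfl⟩
    rw [𝓜.image_fibre hΓ ha] at h1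
    exact h1
  obtain ⟨G, hG⟩ := 𝓜.dist_eq
  have hdist : ∀ x x', dist (π (a x)) (π (a x')) = dist (π x) (π x') := by
    intro x x'
    rw [hG, hG, ← 𝓜.image_fibre hΓ ha, Metric.infDist_image a.isometry]
  set s := Function.surjInv 𝓜.surjective with hs
  have hπs : ∀ y, π (s y) = y := Function.surjInv_eq 𝓜.surjective
  refine ⟨IsometryEquiv.mk' (fun y => π (a (s y))) (fun y => π (a⁻¹ (s y))) (fun y => ?_)
    (Isometry.of_dist_eq fun y y' => ?_), fun x => ?_⟩
  · have := hwell ha (s (π (a⁻¹ (s y)))) (a⁻¹ (s y)) (hπs _)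
    rw [IsometryEquiv.apply_inv_self, hπs] at this
    exact this
  · rw [hdist, hπs, hπs]
  · exact hwell ha _ _ (hπs _).symm

lemma exists_descentHom (hΓ : PreservesLeaves Γ leaves) :
    ∃ ρ : Γ →* (Y ≃ᵢ Y), (∀ (a : Γ) (x : X), π ((a : X ≃ᵢ X) x) = ρ a (π x)) ∧
      ρ.range = descendedGroup π Γ := by
  choose ρ hρ using fun a : Γ => 𝓜.exists_descent hΓ a.2
  have huniq : ∀ b b' : Y ≃ᵢ Y, (∀ x, b (π x) = b' (π x)) → b = b' := fun b b' h =>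
    IsometryEquiv.ext fun y => by
      obtain ⟨x, rfl⟩ := 𝓜.surjective y
      exact h x
  refine ⟨MonoidHom.mk' ρ fun a a' => huniq _ _ fun x => ?_, hρ, ?_⟩
  · rw [← hρ, IsometryEquiv.mul_apply, ← hρ, ← hρ]
    rfl
  · ext b
    constructor
    · rintro ⟨a, rfl⟩
      exact ⟨a, a.2, hρ a⟩
    · rintro ⟨a, ha, h⟩
      exact ⟨⟨a, ha⟩, huniq _ _ fun x => by rw [← h]; exact (hρ ⟨a, ha⟩ x).symm⟩

/-- The map of orbit spaces induced by `π`. -/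
def descend (hΓ : PreservesLeaves Γ leaves) :
    OrbitSpace Γ → OrbitSpace (descendedGroup π Γ) :=
  Quotient.lift (fun x => orbitProj (descendedGroup π Γ) (π x)) (by
    rintro x _ ⟨a, ha, rfl⟩
    obtain ⟨b, hb⟩ := 𝓜.exists_descent hΓ ha
    exact orbitProj_eq_iff.2 ⟨b, ⟨a, ha, hb⟩, (hb x).symm⟩)

lemma descend_orbitProj (hΓ : PreservesLeaves Γ leaves) (x : X) :
    𝓜.descend hΓ (orbitProj Γ x) = orbitProj (descendedGroup π Γ) (π x) := rfl

lemma isQuotientMap_descend (hΓ : PreservesLeaves Γ leaves) :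
    Topology.IsQuotientMap (𝓜.descend hΓ) := by
  have h : Topology.IsQuotientMap (𝓜.descend hΓ ∘ orbitProj Γ) :=
    (isOpenQuotientMap_orbitProj (Γ := descendedGroup π Γ)).isQuotientMap.comp 𝓜.isQuotientMap
  refine Topology.IsQuotientMap.of_comp continuous_orbitProj ?_ h
  exact (isOpenQuotientMap_orbitProj (Γ := Γ)).isQuotientMap.continuous_iff.2 h.continuous

lemma image_orbitProj_fibre (hΓ : PreservesLeaves Γ leaves) (y : Y) :
    orbitProj Γ '' (π ⁻¹' {y}) = 𝓜.descend hΓ ⁻¹' {orbitProj (descendedGroup π Γ) y} := by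
  ext m
  constructor
  · rintro ⟨x, rfl, rfl⟩
    exact 𝓜.descend_orbitProj hΓ x
  · intro hm
    obtain ⟨x, rfl⟩ := orbitProj_surjective m
    obtain ⟨b, ⟨a, ha, hab⟩, hb⟩ := orbitProj_eq_iff.1 (show _ = _ from hm)
    exact ⟨a x, (hab x).trans hb, orbitProj_apply ha x⟩

lemma mem_quotientLeaves_iff (hΓ : PreservesLeaves Γ leaves) (A : Set (OrbitSpace Γ)) :
    A ∈ quotientLeaves Γ leaves ↔ ∃ x : X, A = 𝓜.descend hΓ ⁻¹' {𝓜.descend hΓ (orbitProj Γ x)} := by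
  simp only [quotientLeaves, 𝓜.leaves_eq, Set.mem_range, exists_exists_eq_and,
    𝓜.image_orbitProj_fibre hΓ, 𝓜.descend_orbitProj, Set.mem_ofPred_eq]
  exact 𝓜.surjective.exists

lemma isLeafSpace (hΓ : PreservesLeaves Γ leaves) :
    IsLeafSpace (quotientLeaves Γ leaves) (𝓜.descend hΓ) := by
  refine ⟨𝓜.isQuotientMap_descend hΓ, ?_⟩
  ext A
  rw [𝓜.mem_quotientLeaves_iff hΓ]
  exact (((𝓜.isQuotientMap_descend hΓ).surjective.comp orbitProj_surjective).exists
    (p := fun l => A = 𝓜.descend hΓ ⁻¹' {l})).symm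

/-! ### Geodesics of the quotient -/

section Geodesics

variable [ChartedSpace R3 (OrbitSpace Γ)] (𝒜 : AdaptedAtlas 𝓜.C Γ)

lemma geo_zero (x : X) (v : R3) : 𝓜.geo x v 0 = x := by
  obtain ⟨φ, -, h0, -, -, h⟩ := 𝓜.geo_near v
  rw [(h x).self_of_nhds, h0, zero_smul, 𝓜.C.param_zero]

lemma continuous_geo (x : X) (v : R3) : Continuous (𝓜.geo x v) := by
  rw [continuous_iff_continuousAt]
  intro t
  obtain ⟨φ, hφ, h0, -, -, h⟩ := 𝓜.geo_near v
  have hsub : Filter.Tendsto (fun s : ℝ => s - t) (𝓝 t) (𝓝 0) := by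
    simpa using (continuous_sub_right t).tendsto t
  have h1 : ContinuousAt (fun s => 𝓜.C.param (𝓜.geo x v t) (φ (s - t) • v)) t := by
    have h2 : ContinuousAt (fun s => φ (s - t)) t :=
      ContinuousAt.comp (g := φ) (f := fun s => s - t) (by simpa using hφ.continuousAt)
        (continuous_sub_right t).continuousAt
    exact (𝓜.C.continuous_param _).continuousAt.comp (f := fun s => φ (s - t) • v)
      (h2.smul continuousAt_const)
  refine h1.congr ?_
  filter_upwards [hsub.eventually (h (𝓜.geo x v t))] with s hs
  rw [← hs, ← 𝓜.geo_add, sub_add_cancel]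

/-- In the preferred chart at `c t`, the image `c` of a geodesic of `X` is near `t` a segment
of a straight line, with velocity `A v` and without acceleration at time `t`. -/
lemma exists_geo_expression (v : R3) : ∃ φ : ℝ → ℝ, ContDiffAt ℝ ∞ φ 0 ∧ deriv φ 0 = 1 ∧
    deriv (deriv φ) 0 = 0 ∧ ∀ (x : X) (t : ℝ) (A : R3 ≃ₗᵢ[ℝ] R3),
      (∀ᶠ y in 𝓝 (𝓜.geo x v t), chartAt R3 (orbitProj Γ (𝓜.geo x v t)) (orbitProj Γ y) =
        A (𝓜.C.chart (𝓜.geo x v t) y)) →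
      (fun s => chartAt R3 (orbitProj Γ (𝓜.geo x v t)) (orbitProj Γ (𝓜.geo x v s))) =ᶠ[𝓝 t]
        fun s => φ (s - t) • A v := by
  obtain ⟨φ, hφ, h0, h1, h2, h⟩ := 𝓜.geo_near v
  refine ⟨φ, hφ, h1, h2, fun x t A hA => ?_⟩
  have hsub : Filter.Tendsto (fun s : ℝ => s - t) (𝓝 t) (𝓝 0) := by
    simpa using (continuous_sub_right t).tendsto t
  filter_upwards [hsub.eventually (h (𝓜.geo x v t)),
    (𝓜.continuous_geo x v).continuousAt.eventually hA] with s hs hs2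
  rw [hs2, ← sub_add_cancel s t, 𝓜.geo_add, hs, 𝓜.C.chart_param, map_smul]
  simp

include 𝒜

lemma contDiffAt_chart_geo (x : X) (v : R3) (t : ℝ) {n : ℕ∞} : ContDiffAt ℝ n
    (fun s => chartAt R3 (orbitProj Γ (𝓜.geo x v t)) (orbitProj Γ (𝓜.geo x v s))) t := by
  obtain ⟨φ, hφ, -, -, h⟩ := 𝓜.exists_geo_expression (Γ := Γ) v
  obtain ⟨A, hA⟩ := 𝒜.exists_local_expression (𝓜.geo x v t)
  refine ContDiffAt.congr_of_eventuallyEq ?_ (h x t A (hA.mono fun _ hy => hy.1))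
  have h2 : ContDiffAt ℝ n (fun s => φ (s - t)) t := by
    refine ContDiffAt.comp t (g := φ) (f := fun s => s - t) ?_
      (contDiffAt_id.sub contDiffAt_const)
    simpa using hφ.of_le (by exact_mod_cast le_top)
  exact h2.smul contDiffAt_const

lemma contMDiff_geo (x : X) (v : R3) :
    ContMDiff 𝓘(ℝ, ℝ) (𝓡 3) ∞ (fun t => orbitProj Γ (𝓜.geo x v t)) := fun t =>
  contMDiffAt_of_chart_comp (continuous_orbitProj.comp (𝓜.continuous_geo x v)).continuousAt
    (𝓜.contDiffAt_chart_geo 𝒜 x v t)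

omit 𝒜 in
lemma velocity_geo (x : X) (v : R3) (t : ℝ) {A : R3 ≃ₗᵢ[ℝ] R3}
    (hA : ∀ᶠ y in 𝓝 (𝓜.geo x v t), chartAt R3 (orbitProj Γ (𝓜.geo x v t)) (orbitProj Γ y) =
        A (𝓜.C.chart (𝓜.geo x v t) y)) :
    velocity (n := 3) (fun t => orbitProj Γ (𝓜.geo x v t)) t = A v := by
  obtain ⟨φ, hφ, h1, -, h⟩ := 𝓜.exists_geo_expression (Γ := Γ) v
  have h2 : HasDerivAt (fun s => chartAt R3 (orbitProj Γ (𝓜.geo x v t))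
      (orbitProj Γ (𝓜.geo x v s))) (A v) t := by
    refine HasDerivAt.congr_of_eventuallyEq ?_ (h x t A hA)
    have h3 : HasDerivAt φ 1 (t - t) := by
      rw [sub_self, ← h1]
      exact (hφ.differentiableAt (by simp)).hasDerivAt
    simpa using (h3.comp_sub_const t t).smul_const (A v)
  have h4 := hasMFDerivAt_of_chart_comp (G := fun t => orbitProj Γ (𝓜.geo x v t))
    (continuous_orbitProj.comp (𝓜.continuous_geo x v)).continuousAt h2.hasFDerivAt
  rw [velocity, h4.mfderiv]
  exact one_smul ℝ (A v)

variable [IsManifold (𝓡 3) ∞ (OrbitSpace Γ)]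

lemma isGeodesic_geo (x : X) (v : R3) :
    IsGeodesic 𝒜.metric (fun t => orbitProj Γ (𝓜.geo x v t)) := by
  refine ⟨𝓜.contMDiff_geo 𝒜 x v, fun t k => ?_⟩
  obtain ⟨φ, hφ, -, h2, h⟩ := 𝓜.exists_geo_expression (Γ := Γ) v
  obtain ⟨A, hA⟩ := 𝒜.exists_local_expression (𝓜.geo x v t)
  have hu := h x t A (hA.mono fun _ hy => hy.1)
  have hd : deriv (deriv fun s => chartAt R3 (orbitProj Γ (𝓜.geo x v t))
      (orbitProj Γ (𝓜.geo x v s))) t = 0 := by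
    rw [hu.deriv.deriv_eq]
    have hd1 : ∀ᶠ s in 𝓝 t, deriv (fun s => φ (s - t) • A v) s = deriv φ (s - t) • A v := by
      have hsub : Filter.Tendsto (fun s : ℝ => s - t) (𝓝 t) (𝓝 0) := by
        simpa using (continuous_sub_right t).tendsto t
      filter_upwards [hsub.eventually ((hφ.of_le (m := 1) (by simp)).eventually (by simp))]
        with s hs
      exact (((hs.differentiableAt (by simp)).hasDerivAt.comp_sub_const s t).smul_const (A v)).deriv
    rw [Filter.EventuallyEq.deriv_eq hd1]
    have hφ' : HasDerivAt (deriv φ) 0 (t - t) := by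
      have hd' : ContDiffAt ℝ ∞ (fun s => fderiv ℝ φ s 1) 0 :=
        (hφ.fderiv_right (m := ∞) (by simp)).clm_apply contDiffAt_const
      have h3 : HasDerivAt (deriv φ) (deriv (deriv φ) 0) 0 :=
        (hd'.differentiableAt (by simp)).hasDerivAt
      rw [h2] at h3
      rwa [sub_self]
    simpa using ((hφ'.comp_sub_const t t).smul_const (A v)).deriv
  -- the curve is at the centre of the chart, where the Christoffel symbols vanish
  dsimp only
  rw [𝒜.extChartAt_self]
  simp only [𝒜.christoffel_zero, zero_mul, Finset.sum_const_zero, add_zero]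
  exact congrArg (fun w : R3 => w k) hd

lemma isGeodesicallyComplete : IsGeodesicallyComplete 𝒜.metric := by
  intro m w
  obtain ⟨x, rfl⟩ := orbitProj_surjective m
  obtain ⟨A, hA⟩ := 𝒜.exists_local_expression x
  refine ⟨_, 𝓜.isGeodesic_geo 𝒜 x (A.symm w), ?_⟩
  have h := 𝓜.velocity_geo x (A.symm w) 0 (A := A)
    (by rw [𝓜.geo_zero]; exact hA.mono fun _ hy => hy.1)
  refine Bundle.TotalSpace.ext (congrArg (orbitProj Γ) (𝓜.geo_zero x _)) ?_
  refine heq_of_eq (h.trans ?_)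
  exact A.apply_symm_apply w

end Geodesics

end ModelFibration

/-! ### The Riemannian foliation of the quotient -/

namespace ModelFibration

variable {X Y E E' : Type} [MetricSpace X] [MetricSpace Y] [NormedAddCommGroup E]
  [InnerProductSpace ℝ E] [NormedAddCommGroup E'] [InnerProductSpace ℝ E'] [ChartedSpace R3 X]
  {ι : X → E} {κ : Y → E'} {π : X → Y} {leaves : Set (Set X)} {isReflection : (Y ≃ᵢ Y) → Prop}
  (𝓜 : ModelFibration ι κ π leaves isReflection) {Γ : Subgroup (X ≃ᵢ X)}

lemma fderiv_Q_eq_zero_iff (v : R3) : fderiv ℝ 𝓜.Q 0 v = 0 ↔ v 0 = 0 ∧ v 1 = 0 := by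
  rw [𝓜.fderiv_Q, mul_eq_zero, Complex.ofReal_eq_zero, or_iff_right 𝓜.c_ne_zero, Complex.ext_iff]
  simp

lemma inner_fderiv_Q (v w : R3) : inner ℝ (fderiv ℝ 𝓜.Q 0 v) (fderiv ℝ 𝓜.Q 0 w) =
    𝓜.c ^ 2 * (v 0 * w 0 + v 1 * w 1) := by
  rw [𝓜.fderiv_Q, 𝓜.fderiv_Q, Complex.inner]
  simp
  ring

lemma surjective_fderiv_Q : Function.Surjective (fderiv ℝ 𝓜.Q 0) := by
  intro z
  refine ⟨!₂[z.re / 𝓜.c, z.im / 𝓜.c, 0], ?_⟩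
  have hc : (𝓜.c : ℂ) ≠ 0 := Complex.ofReal_ne_zero.2 𝓜.c_ne_zero
  rw [𝓜.fderiv_Q]
  simp only [Matrix.cons_val_zero, Matrix.cons_val_one, Complex.ofReal_div]
  field_simp
  exact Complex.re_add_im z

/-- In the chart at the point over `z`, a lift of the projection to `Y` is given by `Q`, up to
a linear isometry. -/
lemma exists_π_lift (hΓ : PreservesLeaves Γ leaves) {a : X ≃ᵢ X} (ha : a ∈ Γ) (z : X) :
    ∃ S : ℂ ≃ₗᵢ[ℝ] R2, ∀ᶠ u in 𝓝 0,
      π (a⁻¹ (𝓜.C.param (a z) u)) = 𝓜.B.param (π z) (S (𝓜.Q u)) := by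
  obtain ⟨R, hR⟩ := 𝓜.π_param (a z)
  obtain ⟨b, hb⟩ := 𝓜.exists_descent hΓ (Γ.inv_mem ha)
  refine ⟨R.trans (𝓜.B.linearPart b (π (a z))), hR.mono fun u hu => ?_⟩
  rw [hb, hu, 𝓜.B.apply_param, ← hb, IsometryEquiv.inv_apply_self]
  rfl

section Foliation

variable [ChartedSpace R3 (OrbitSpace Γ)] (𝒜 : AdaptedAtlas 𝓜.C Γ)

/-- The tangent spaces of the leaves of the quotient. In the identification of the tangent space
at `m` with `ℝ³` by the preferred chart at `m`, it is the last axis. -/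
def vertical (m : OrbitSpace Γ) : Submodule ℝ (TangentSpace (𝓡 3) m) :=
  (LinearMap.ker (fderiv ℝ 𝓜.Q 0).toLinearMap : Submodule ℝ R3)

/-- The local expression of the projection to the leaf space: a local inverse `e.symm` of the
projection to the quotient, followed by `π` and by the chart of `Y` at `y`. -/
def localSubmersion (e : OpenPartialHomeomorph X (OrbitSpace Γ)) (y : Y) (m : OrbitSpace Γ) : R2 :=
  𝓜.B.chart y (π (e.symm m))

/-- The domain of `localSubmersion`. -/
def submersionDomain (e : OpenPartialHomeomorph X (OrbitSpace Γ)) (y : Y) : Set (OrbitSpace Γ) :=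
  e.target ∩ e.symm ⁻¹' (π ⁻¹' (𝓜.B.chart y).source)

omit [ChartedSpace R3 (OrbitSpace Γ)] in
lemma isOpen_submersionDomain (e : OpenPartialHomeomorph X (OrbitSpace Γ)) (y : Y) :
    IsOpen (𝓜.submersionDomain e y) :=
  e.symm.isOpen_inter_preimage ((𝓜.B.chart y).open_source.preimage 𝓜.isQuotientMap.continuous)

variable {𝓜} in
omit [ChartedSpace R3 (OrbitSpace Γ)] in
lemma continuousAt_localSubmersion {e : OpenPartialHomeomorph X (OrbitSpace Γ)} {y : Y}
    {m : OrbitSpace Γ} (hm : m ∈ 𝓜.submersionDomain e y) :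
    ContinuousAt (𝓜.localSubmersion e y) m :=
  ((𝓜.B.chart y).continuousAt hm.2).comp (f := π ∘ e.symm)
    (𝓜.isQuotientMap.continuous.continuousAt.comp (f := e.symm) (e.symm.continuousAt hm.1))

/-- `localSubmersion` in the preferred chart. -/
lemma exists_localSubmersion_eq (hΓ : PreservesLeaves Γ leaves)
    {e : OpenPartialHomeomorph X (OrbitSpace Γ)} (he : orbitProj Γ = e) {y : Y}
    {m : OrbitSpace Γ} (hm : m ∈ 𝓜.submersionDomain e y) :
    ∃ S : ℂ ≃ₗᵢ[ℝ] R2,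
      (fun u => 𝓜.localSubmersion e y (orbitProj Γ (𝓜.C.param (𝒜.lift m) u))) =ᶠ[𝓝 0]
        fun u => 𝓜.B.transition (π (e.symm m)) y (S (𝓜.Q u)) := by
  have hmz : orbitProj Γ (e.symm m) = m := by rw [he]; exact e.right_inv hm.1
  obtain ⟨a, ha, haz⟩ := orbitProj_eq_iff.1 (hmz.trans (𝒜.orbitProj_lift m).symm)
  obtain ⟨S, hS⟩ := 𝓜.exists_π_lift hΓ ha (e.symm m)
  refine ⟨S, ?_⟩
  rw [haz] at hS
  have h1 : Filter.Tendsto (fun u => a⁻¹ (𝓜.C.param (𝒜.lift m) u)) (𝓝 0) (𝓝 (e.symm m)) := by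
    have h2 := (a⁻¹).continuous.continuousAt.tendsto.comp (𝓜.C.tendsto_param (𝒜.lift m))
    have h3 : a⁻¹ (𝒜.lift m) = e.symm m := by rw [← haz, IsometryEquiv.inv_apply_self]
    rwa [h3] at h2
  filter_upwards [hS, h1 (e.open_source.mem_nhds (e.map_target hm.1))] with u hu hus
  rw [ConformalCharts.transition, ← hu, localSubmersion]
  congr 2
  rw [← orbitProj_apply (Γ.inv_mem ha), he]
  exact e.left_inv hus

/-- The differential of `localSubmersion` is the composite of `fderiv ℝ Q 0` with a conformal
linear map. -/
lemma exists_fderiv_localSubmersion (hΓ : PreservesLeaves Γ leaves)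
    {e : OpenPartialHomeomorph X (OrbitSpace Γ)} (he : orbitProj Γ = e) {y : Y}
    {m : OrbitSpace Γ} (hm : m ∈ 𝓜.submersionDomain e y) :
    ∃ T : ℂ →L[ℝ] R2,
      (∀ z w, confFactor 𝓜.ε' (𝓜.localSubmersion e y m) * inner ℝ (T z) (T w) = inner ℝ z w) ∧
      ContDiffAt ℝ ∞ (fun u => 𝓜.localSubmersion e y (orbitProj Γ (𝓜.C.param (𝒜.lift m) u))) 0 ∧
      HasFDerivAt (fun u => 𝓜.localSubmersion e y (orbitProj Γ (𝓜.C.param (𝒜.lift m) u)))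
        (T.comp (fderiv ℝ 𝓜.Q 0)) 0 := by
  obtain ⟨S, hS⟩ := 𝓜.exists_localSubmersion_eq 𝒜 hΓ he hm
  have hsrc : 𝓜.B.param (π (e.symm m)) 0 ∈ (𝓜.B.chart y).source := by
    rw [𝓜.B.param_zero]
    exact hm.2
  have hT := 𝓜.B.contDiffAt_transition hsrc
  have hT0 : 𝓜.B.transition (π (e.symm m)) y 0 = 𝓜.localSubmersion e y m := by
    rw [ConformalCharts.transition, 𝓜.B.param_zero, localSubmersion]
  have hSQ : S (𝓜.Q 0) = 0 := by rw [𝓜.Q_zero, map_zero]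
  have hSQd : ContDiffAt ℝ ∞ (fun u => S (𝓜.Q u)) 0 :=
    S.toContinuousLinearEquiv.contDiff.contDiffAt.comp _ 𝓜.contDiffAt_Q
  have hSQd' : HasFDerivAt (fun u => S (𝓜.Q u))
      ((S.toContinuousLinearEquiv : ℂ →L[ℝ] R2).comp (fderiv ℝ 𝓜.Q 0)) 0 :=
    S.toContinuousLinearEquiv.hasFDerivAt.comp _
      (𝓜.contDiffAt_Q.differentiableAt (by simp)).hasFDerivAt
  refine ⟨(fderiv ℝ (𝓜.B.transition (π (e.symm m)) y) 0).comp
    (S.toContinuousLinearEquiv : ℂ →L[ℝ] R2), fun z w => ?_, ?_, ?_⟩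
  · have := 𝓜.B.inner_fderiv_transition hsrc (S z) (S w)
    rw [hT0, confFactor_zero, one_mul, S.inner_map_map] at this
    exact this
  · rw [← hSQ] at hT
    exact (ContDiffAt.comp (0 : R3) (f := fun u => S (𝓜.Q u)) hT hSQd).congr_of_eventuallyEq hS
  · have h1 := (hT.differentiableAt (by simp)).hasFDerivAt
    rw [← hSQ] at h1
    have h2 := HasFDerivAt.comp (0 : R3) (f := fun u => S (𝓜.Q u)) h1 hSQd'
    rw [hSQ] at h2
    exact h2.congr_of_eventuallyEq hS

include 𝒜

lemma exists_hasMFDerivAt_localSubmersion (hΓ : PreservesLeaves Γ leaves)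
    {e : OpenPartialHomeomorph X (OrbitSpace Γ)} (he : orbitProj Γ = e) {y : Y}
    {m : OrbitSpace Γ} (hm : m ∈ 𝓜.submersionDomain e y) :
    ∃ T : ℂ →L[ℝ] R2,
      (∀ z w, confFactor 𝓜.ε' (𝓜.localSubmersion e y m) * inner ℝ (T z) (T w) = inner ℝ z w) ∧
      (∀ z, T z = 0 ↔ z = 0) ∧
      HasMFDerivAt (𝓡 3) 𝓘(ℝ, R2) (𝓜.localSubmersion e y) m (T.comp (fderiv ℝ 𝓜.Q 0)) := by
  obtain ⟨T, hT, -, hd⟩ := 𝓜.exists_fderiv_localSubmersion 𝒜 hΓ he hm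
  refine ⟨T, hT, fun z => ⟨fun h => ?_, fun h => by rw [h, map_zero]⟩,
    𝒜.hasMFDerivAt_of_comp (continuousAt_localSubmersion hm) hd⟩
  have := hT z z
  rw [h, inner_zero_left, mul_zero] at this
  exact inner_self_eq_zero.1 this.symm

lemma mfderiv_localSubmersion_eq_zero_iff (hΓ : PreservesLeaves Γ leaves)
    {e : OpenPartialHomeomorph X (OrbitSpace Γ)} (he : orbitProj Γ = e) {y : Y}
    {m : OrbitSpace Γ} (hm : m ∈ 𝓜.submersionDomain e y) (v : TangentSpace (𝓡 3) m) :
    v ∈ 𝓜.vertical m ↔ mfderiv (𝓡 3) 𝓘(ℝ, R2) (𝓜.localSubmersion e y) m v = 0 := by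
  obtain ⟨T, -, hT, hd⟩ := 𝓜.exists_hasMFDerivAt_localSubmersion 𝒜 hΓ he hm
  rw [hd.mfderiv]
  exact (hT _).symm

variable [IsManifold (𝓡 3) ∞ (OrbitSpace Γ)]

/-- The base metric is that of `Y` divided by `c²`, as the differential of `π` multiplies the
lengths of horizontal vectors by `c`. -/
lemma isRiemannianSubmersionOn (hΓ : PreservesLeaves Γ leaves)
    {e : OpenPartialHomeomorph X (OrbitSpace Γ)} (he : orbitProj Γ = e) (y : Y) :
    IsRiemannianSubmersionOn 𝒜.metric (𝓜.submersionDomain e y) (𝓜.localSubmersion e y)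
      (fun u => confFactor 𝓜.ε' u • ((𝓜.c ^ 2)⁻¹ • euclideanForm 2)) where
  contMDiffOn m hm := by
    obtain ⟨T, -, hc, -⟩ := 𝓜.exists_fderiv_localSubmersion 𝒜 hΓ he hm
    exact (𝒜.contMDiffAt_of_comp (continuousAt_localSubmersion hm) hc).contMDiffWithinAt
  isOpen_image := by
    rw [isOpen_iff_mem_nhds]
    rintro _ ⟨m, hm, rfl⟩
    obtain ⟨T, hT, hc, hd⟩ := 𝓜.exists_fderiv_localSubmersion 𝒜 hΓ he hm
    have hs := hc.hasStrictFDerivAt' hd (by simp)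
    have hTinj : Function.Injective T := by
      rw [injective_iff_map_eq_zero]
      intro z h
      have := hT z z
      rw [h, inner_zero_left, mul_zero] at this
      exact inner_self_eq_zero.1 this.symm
    have hTsurj : Function.Surjective T := by
      refine (LinearMap.injective_iff_surjective_of_finrank_eq_finrank (f := T.toLinearMap) ?_).1
        hTinj
      rw [Complex.finrank_real_complex, finrank_euclideanSpace_fin]
    have hr : (T.comp (fderiv ℝ 𝓜.Q 0)).range = ⊤ :=
      LinearMap.range_eq_top.2 (hTsurj.comp 𝓜.surjective_fderiv_Q)
    have hmap := hs.map_nhds_eq_of_surj hr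
    have h0 : 𝓜.localSubmersion e y (orbitProj Γ (𝓜.C.param (𝒜.lift m) 0)) =
        𝓜.localSubmersion e y m := by
      rw [𝓜.C.param_zero, 𝒜.orbitProj_lift]
    rw [h0] at hmap
    rw [← hmap, Filter.mem_map]
    have hcont : Filter.Tendsto (fun u => orbitProj Γ (𝓜.C.param (𝒜.lift m) u)) (𝓝 0) (𝓝 m) := by
      have := (continuous_orbitProj (Γ := Γ)).continuousAt.tendsto.comp
        (𝓜.C.tendsto_param (𝒜.lift m))
      rwa [𝒜.orbitProj_lift] at this
    filter_upwards [hcont ((𝓜.isOpen_submersionDomain e y).mem_nhds hm)] with u hu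
    exact ⟨_, hu, rfl⟩
  isMetricOn :=
    { contDiffOn := (contDiff_confFactor_smul 𝓜.B.nonneg _).contDiffOn
      symm := fun u _ v w => by simp [real_inner_comm]
      pos := fun u _ v hv => by
        have h1 := confFactor_pos 𝓜.B.nonneg u
        have h2 := sq_pos_of_ne_zero 𝓜.c_ne_zero
        have h3 := real_inner_self_pos.2 hv
        simp only [smul_apply, euclideanForm_apply, smul_eq_mul]
        positivity }
  surjective m hm := by
    obtain ⟨T, -, hT, hd⟩ := 𝓜.exists_hasMFDerivAt_localSubmersion 𝒜 hΓ he hm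
    have hTsurj : Function.Surjective T := by
      refine (LinearMap.injective_iff_surjective_of_finrank_eq_finrank (f := T.toLinearMap) ?_).1
        ((injective_iff_map_eq_zero T).2 fun z => (hT z).1)
      rw [Complex.finrank_real_complex, finrank_euclideanSpace_fin]
    rw [hd.mfderiv]
    exact hTsurj.comp 𝓜.surjective_fderiv_Q
  isometric m hm v w hv hw := by
    obtain ⟨T, hTi, hT, hd⟩ := 𝓜.exists_hasMFDerivAt_localSubmersion 𝒜 hΓ he hm
    -- a horizontal vector is orthogonal to the last axis
    have hor : ∀ v : R3, (∀ u : R3, mfderiv (𝓡 3) 𝓘(ℝ, R2) (𝓜.localSubmersion e y) m u = 0 →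
        𝒜.metric.inner m u v = 0) → v 2 = 0 := by
      intro v hv
      have h1 : inner ℝ (EuclideanSpace.single (2 : Fin 3) (1 : ℝ)) v = 0 :=
        hv (EuclideanSpace.single (2 : Fin 3) (1 : ℝ))
          ((𝓜.mfderiv_localSubmersion_eq_zero_iff 𝒜 hΓ he hm _).1
            ((𝓜.fderiv_Q_eq_zero_iff _).2 (by simp)))
      simpa [EuclideanSpace.inner_single_left] using h1
    have hv2 := hor v hv
    have hw2 := hor w hw
    rw [hd.mfderiv]
    have key : ∀ v w : R3, v 2 = 0 → w 2 = 0 → confFactor 𝓜.ε' (𝓜.localSubmersion e y m) *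
        ((𝓜.c ^ 2)⁻¹ * inner ℝ (T (fderiv ℝ 𝓜.Q 0 v)) (T (fderiv ℝ 𝓜.Q 0 w))) = inner ℝ v w := by
      intro v w hv hw
      rw [mul_left_comm, hTi, 𝓜.inner_fderiv_Q, R3_inner, hv,
        inv_mul_cancel_left₀ (pow_ne_zero 2 𝓜.c_ne_zero)]
      ring
    exact key v w hv2 hw2

omit [IsManifold (𝓡 3) ∞ (OrbitSpace Γ)] in
/-- A curve tangent to the leaves stays in a fibre of the projection to the leaf space. -/
lemma descend_eq_of_velocity_mem (hcov : IsCoveringMap (orbitProj Γ))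
    (hΓ : PreservesLeaves Γ leaves) {c : ℝ → OrbitSpace Γ} (hc : ContMDiff 𝓘(ℝ, ℝ) (𝓡 3) ∞ c)
    (hv : ∀ t, velocity (n := 3) c t ∈ 𝓜.vertical (c t)) (s t : ℝ) :
    𝓜.descend hΓ (c s) = 𝓜.descend hΓ (c t) := by
  have hloc : IsLocallyConstant (𝓜.descend hΓ ∘ c) := by
    rw [IsLocallyConstant.iff_eventually_eq]
    intro t
    obtain ⟨x, hx⟩ := orbitProj_surjective (c t)
    obtain ⟨e, hxe, he⟩ := hcov.isLocalHomeomorph x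
    have hex : e.symm (c t) = x := by rw [← hx, he]; exact e.left_inv hxe
    set W := 𝓜.submersionDomain e (π x) with hW
    have hcW : c t ∈ W := by
      refine ⟨?_, ?_⟩
      · rw [← hx, he]; exact e.map_source hxe
      · rw [Set.mem_preimage, hex]; exact 𝓜.B.mem_source _
    obtain ⟨r, hr, hball⟩ := Metric.mem_nhds_iff.1
      (hc.continuous.continuousAt.preimage_mem_nhds ((𝓜.isOpen_submersionDomain e _).mem_nhds hcW))
    have hder : ∀ s ∈ Metric.ball t r,
        HasFDerivAt (𝓜.localSubmersion e (π x) ∘ c) (0 : ℝ →L[ℝ] R2) s := by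
      intro s hs
      obtain ⟨T, -, -, hd⟩ := 𝓜.exists_hasMFDerivAt_localSubmersion 𝒜 hΓ he (hball hs)
      have h1 := hd.comp s ((hc s).mdifferentiableAt (by simp)).hasMFDerivAt
      have h2 := h1.hasFDerivAt
      refine h2.congr_fderiv ?_
      ext1
      have h3 : fderiv ℝ 𝓜.Q 0 (velocity (n := 3) c s) = 0 := hv s
      change T (fderiv ℝ 𝓜.Q 0 (velocity (n := 3) c s)) = 0
      rw [h3, map_zero]
    have hconst : ∀ s ∈ Metric.ball t r,
        𝓜.localSubmersion e (π x) (c s) = 𝓜.localSubmersion e (π x) (c t) := fun s hs =>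
      (convex_ball t r).is_const_of_fderivWithin_eq_zero (𝕜 := ℝ)
        (f := 𝓜.localSubmersion e (π x) ∘ c)
        (fun s hs => (hder s hs).differentiableAt.differentiableWithinAt)
        (fun s hs => (hder s hs).hasFDerivWithinAt.fderivWithin
          (Metric.isOpen_ball.uniqueDiffWithinAt hs)) hs (Metric.mem_ball_self hr)
    have hdesc : ∀ m ∈ W, 𝓜.descend hΓ m =
        orbitProj (descendedGroup π Γ) (𝓜.B.param (π x) (𝓜.localSubmersion e (π x) m)) := by
      intro m hm
      rw [localSubmersion, 𝓜.B.param_chart hm.2, ← 𝓜.descend_orbitProj hΓ, he, e.right_inv hm.1]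
    filter_upwards [Metric.ball_mem_nhds t hr] with s hs
    rw [Function.comp_apply, Function.comp_apply, hdesc _ (hball hs), hdesc _ hcW, hconst s hs]
  exact hloc.apply_eq_of_preconnectedSpace s t

omit [IsManifold (𝓡 3) ∞ (OrbitSpace Γ)] in
/-- The geodesics in the direction of the last axis are tangent to the leaves. -/
lemma velocity_geo_mem_vertical (hcov : IsCoveringMap (orbitProj Γ))
    (hΓ : PreservesLeaves Γ leaves) (x : X) (t : ℝ) :
    velocity (n := 3) (fun t => orbitProj Γ (𝓜.geo x (EuclideanSpace.single 2 1) t)) t ∈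
      𝓜.vertical (orbitProj Γ (𝓜.geo x (EuclideanSpace.single 2 1) t)) := by
  set c : ℝ → OrbitSpace Γ := fun t => orbitProj Γ (𝓜.geo x (EuclideanSpace.single 2 1) t) with hc
  set z := 𝓜.geo x (EuclideanSpace.single 2 1) t with hz
  have hcd : ContMDiff 𝓘(ℝ, ℝ) (𝓡 3) ∞ c := 𝓜.contMDiff_geo 𝒜 x _
  have hcont := 𝓜.continuous_geo x (EuclideanSpace.single 2 1)
  have hπ : ∀ s, π (𝓜.geo x (EuclideanSpace.single 2 1) s) = π x := fun s => by
    have : 𝓜.geo x (EuclideanSpace.single 2 1) s ∈ π ⁻¹' {π x} := by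
      rw [← 𝓜.range_geo]
      exact ⟨s, rfl⟩
    exact this
  obtain ⟨e, hxe, he⟩ := hcov.isLocalHomeomorph z
  have hcW : c t ∈ 𝓜.submersionDomain e (π x) := by
    have hex : e.symm (c t) = z := by simp only [hc, he]; exact e.left_inv hxe
    refine ⟨?_, ?_⟩
    · simp only [hc, he]; exact e.map_source hxe
    · rw [Set.mem_preimage, hex, Set.mem_preimage, hπ]; exact 𝓜.B.mem_source _
  have h1 : 𝓜.localSubmersion e (π x) ∘ c =ᶠ[𝓝 t] fun _ => 0 := by
    filter_upwards [hcont.continuousAt.preimage_mem_nhds (e.open_source.mem_nhds hxe)] with s hs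
    have hes : e.symm (c s) = 𝓜.geo x (EuclideanSpace.single 2 1) s := by
      simp only [hc, he]; exact e.left_inv hs
    rw [Function.comp_apply, localSubmersion, hes, hπ, 𝓜.B.chart_self]
  rw [𝓜.mfderiv_localSubmersion_eq_zero_iff 𝒜 hΓ he hcW]
  obtain ⟨T, -, -, hd⟩ := 𝓜.exists_hasMFDerivAt_localSubmersion 𝒜 hΓ he hcW
  have h2 := (hd.comp t ((hcd t).mdifferentiableAt (by simp)).hasMFDerivAt).hasFDerivAt
  have h3 := HasFDerivAt.unique (𝕜 := ℝ) (E := ℝ) (F := R2) h2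
    ((hasFDerivAt_const (0 : R2) t).congr_of_eventuallyEq h1)
  rw [hd.mfderiv]
  exact congrArg (fun f : ℝ →L[ℝ] R2 => f 1) h3

omit [IsManifold (𝓡 3) ∞ (OrbitSpace Γ)] in
/-- The integral manifolds of `vertical` are the fibres of the projection to the leaf space: each
fibre is the image of one geodesic in the direction of the last axis. -/
lemma leafThrough_vertical (hcov : IsCoveringMap (orbitProj Γ))
    (hΓ : PreservesLeaves Γ leaves) (x : X) :
    leafThrough 𝓜.vertical (orbitProj Γ x) =
      𝓜.descend hΓ ⁻¹' {𝓜.descend hΓ (orbitProj Γ x)} := by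
  ext m
  constructor
  · rintro ⟨c, hc, hv, h0, rfl⟩
    rw [← h0]
    exact 𝓜.descend_eq_of_velocity_mem 𝒜 hcov hΓ hc hv 1 0
  · intro hm
    rw [𝓜.descend_orbitProj, ← 𝓜.image_orbitProj_fibre hΓ, ← 𝓜.range_geo] at hm
    obtain ⟨_, ⟨t, rfl⟩, rfl⟩ := hm
    have hgeo := 𝓜.contMDiff_geo 𝒜 x (EuclideanSpace.single 2 1)
    have hmul : ContMDiff 𝓘(ℝ, ℝ) 𝓘(ℝ, ℝ) ∞ fun s : ℝ => t * s :=
      (contDiff_const.mul contDiff_id).contMDiff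
    refine ⟨fun s => orbitProj Γ (𝓜.geo x (EuclideanSpace.single 2 1) (t * s)),
      hgeo.comp hmul, fun s => ?_, ?_, ?_⟩
    · have h1 : HasMFDerivAt 𝓘(ℝ, ℝ) 𝓘(ℝ, ℝ) (fun s : ℝ => t * s) s
          (ContinuousLinearMap.toSpanSingleton ℝ t) :=
        (((hasDerivAt_id s).const_mul t).congr_deriv (mul_one t)).hasFDerivAt.hasMFDerivAt
      have h2 := (((hgeo (t * s)).mdifferentiableAt (by simp)).hasMFDerivAt).comp s h1
      have h3 := h2.mfderiv
      have h4 := Submodule.smul_mem _ t (𝓜.velocity_geo_mem_vertical 𝒜 hcov hΓ x (t * s))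
      have h5 : ∀ L : ℝ →L[ℝ] R3, L (ContinuousLinearMap.toSpanSingleton ℝ t 1) = t • L 1 := by
        intro L
        rw [← map_smul]
        simp
      have h6 := (congrArg (fun f : ℝ →L[ℝ] R3 => f 1) h3).trans (h5 _)
      exact (congrArg (fderiv ℝ 𝓜.Q 0) h6).trans h4
    · simp only [mul_zero, 𝓜.geo_zero]
    · simp only [mul_one]

lemma isRiemannianFoliationByGeodesics (hcov : IsCoveringMap (orbitProj Γ))
    (hΓ : PreservesLeaves Γ leaves) :
    IsRiemannianFoliationByGeodesics 𝒜.metric 2 𝓜.vertical (quotientLeaves Γ leaves) where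
  local_submersion m := by
    obtain ⟨x, rfl⟩ := orbitProj_surjective m
    obtain ⟨e, hxe, he⟩ := hcov.isLocalHomeomorph x
    refine ⟨𝓜.submersionDomain e (π x), 𝓜.isOpen_submersionDomain e _, ⟨?_, ?_⟩,
      𝓜.localSubmersion e (π x), _, 𝓜.isRiemannianSubmersionOn 𝒜 hΓ he (π x), fun m hm v =>
      𝓜.mfderiv_localSubmersion_eq_zero_iff 𝒜 hΓ he hm v⟩
    · rw [he]; exact e.map_source hxe
    · rw [Set.mem_preimage, he, e.left_inv hxe]; exact 𝓜.B.mem_source _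
  leaves_eq := by
    ext A
    rw [𝓜.mem_quotientLeaves_iff hΓ, Set.mem_range, orbitProj_surjective.exists]
    simp only [𝓜.leafThrough_vertical 𝒜 hcov hΓ, eq_comm]
  geodesic A hA := by
    obtain ⟨x, rfl⟩ := (𝓜.mem_quotientLeaves_iff hΓ A).1 hA
    refine ⟨_, 𝓜.isGeodesic_geo 𝒜 x (EuclideanSpace.single 2 1), fun t =>
      ⟨𝓜.velocity_geo_mem_vertical 𝒜 hcov hΓ x t, ?_⟩, ?_⟩
    · obtain ⟨L, hL⟩ := 𝒜.exists_local_expression (𝓜.geo x (EuclideanSpace.single 2 1) t)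
      rw [𝓜.velocity_geo x _ t (hL.mono fun _ hy => hy.1)]
      intro h
      have h' : (EuclideanSpace.single 2 1 : R3) = 0 := (map_eq_zero_iff L L.injective).1 h
      simpa using congrArg (fun v : R3 => v 2) h'
    · rw [𝓜.descend_orbitProj, ← 𝓜.image_orbitProj_fibre hΓ, ← 𝓜.range_geo, ← Set.range_comp]
      rfl

end Foliation

end ModelFibration

/-! ### The quotient orbifold -/

namespace ConformalCharts

variable {ε : ℝ} {Y E : Type} [MetricSpace Y] [NormedAddCommGroup E] [InnerProductSpace ℝ E]
  {κ : Y → E} (B : ConformalCharts 2 ε κ) (Δ : Subgroup (Y ≃ᵢ Y))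

/-- The stabilizer of `p`, acting on the tangent plane by its linear parts in the chart at `p`. -/
def localGroup (p : Y) : Subgroup (R2 ≃ₗᵢ[ℝ] R2) where
  carrier := {A | ∃ b ∈ Δ, b p = p ∧ ∀ u, b (B.param p u) = B.param p (A u)}
  one_mem' := ⟨1, Δ.one_mem, rfl, fun _ => rfl⟩
  mul_mem' := by
    rintro A A' ⟨b, hb, hp, h⟩ ⟨b', hb', hp', h'⟩
    refine ⟨b * b', Δ.mul_mem hb hb', ?_, fun u => ?_⟩
    · rw [IsometryEquiv.mul_apply, hp', hp]
    · rw [IsometryEquiv.mul_apply, h', h]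
      rfl
  inv_mem' := by
    rintro A ⟨b, hb, hp, h⟩
    refine ⟨b⁻¹, Δ.inv_mem hb, ?_, fun u => ?_⟩
    · conv_lhs => rw [← hp]
      rw [IsometryEquiv.inv_apply_self]
    · have h1 : B.param p u = b (B.param p (A⁻¹ u)) := by
        rw [h]
        exact congrArg _ (A.apply_symm_apply u).symm
      rw [h1, IsometryEquiv.inv_apply_self]

variable {Δ}

/-- All elements of the stabilizers act as rotations on the tangent planes. -/
def ActsByRotations (Δ : Subgroup (Y ≃ᵢ Y)) : Prop :=
  ∀ p : Y, ∀ A ∈ B.localGroup Δ p,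
    LinearMap.det (A.toLinearEquiv : R2 →ₗ[ℝ] R2) = 1

lemma linearPart_mem_localGroup {b : Y ≃ᵢ Y} (hb : b ∈ Δ) {p : Y} (hp : b p = p) :
    B.linearPart b p ∈ B.localGroup Δ p :=
  ⟨b, hb, hp, fun u => by rw [B.apply_param, hp]⟩

lemma finite_localGroup [LocallyCompactSpace Y] (hΔ : ActsDiscontinuously Δ) (p : Y) :
    Finite (B.localGroup Δ p) := by
  have := (hΔ.finite_stabilizer p).to_subtype
  choose b hb hp h using fun A : B.localGroup Δ p => A.2
  refine Finite.of_injective (β := {b | b ∈ Δ ∧ b p = p}) (fun A => ⟨b A, hb A, hp A⟩)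
    fun A A' hA => ?_
  have hbb : b A = b A' := congrArg Subtype.val hA
  refine Subtype.ext (LinearIsometryEquiv.ext fun u => B.param_injective p ?_)
  rw [← h A, ← h A', hbb]

lemma exists_radius [LocallyCompactSpace Y] (hΔ : ActsDiscontinuously Δ) (p : Y) :
    ∃ r : ℝ, 0 < r ∧ ∀ a ∈ Δ, ∀ u ∈ Metric.ball (0 : R2) r, ∀ v ∈ Metric.ball (0 : R2) r,
      a (B.param p u) = B.param p v → a p = p := by
  obtain ⟨U, hU, h⟩ := hΔ.exists_nhds p
  obtain ⟨r, hr, hball⟩ := Metric.mem_nhds_iff.1 (B.tendsto_param p hU)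
  refine ⟨r, hr, fun a ha u hu v hv hauv => h a ha _ (hball hu) ?_⟩
  rw [hauv]
  exact hball hv

section Discontinuous

variable [LocallyCompactSpace Y] (hΔ : ActsDiscontinuously Δ)

/-- The radius of a disc around `p`, in the chart at `p`, on which two points are equivalent under
the group only if they are equivalent under the stabilizer of `p`. -/
def radius (p : Y) : ℝ := (B.exists_radius hΔ p).choose

/-- The disc of radius `radius`. -/
def disc (p : Y) : Set R2 := Metric.ball 0 (B.radius hΔ p)

lemma radius_pos (p : Y) : 0 < B.radius hΔ p := (B.exists_radius hΔ p).choose_spec.1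

lemma zero_mem_disc (p : Y) : (0 : R2) ∈ B.disc hΔ p := Metric.mem_ball_self (B.radius_pos hΔ p)

lemma isOpen_disc (p : Y) : IsOpen (B.disc hΔ p) := Metric.isOpen_ball

variable {hΔ} in
lemma map_mem_disc {p : Y} (A : R2 ≃ₗᵢ[ℝ] R2) {u : R2} (hu : u ∈ B.disc hΔ p) :
    A u ∈ B.disc hΔ p := by
  rw [disc, mem_ball_zero_iff] at hu ⊢
  rwa [A.norm_map]

variable {hΔ} in
lemma fixes_centre {p : Y} {u v : R2} (hu : u ∈ B.disc hΔ p) (hv : v ∈ B.disc hΔ p)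
    {a : Y ≃ᵢ Y} (ha : a ∈ Δ) (h : a (B.param p u) = B.param p v) : a p = p :=
  (B.exists_radius hΔ p).choose_spec.2 a ha u hu v hv h

variable {hΔ} in
lemma orbitProj_param_eq_iff {p : Y} {u v : R2} (hu : u ∈ B.disc hΔ p) (hv : v ∈ B.disc hΔ p) :
    orbitProj Δ (B.param p u) = orbitProj Δ (B.param p v) ↔
      ∃ A ∈ B.localGroup Δ p, A u = v := by
  rw [orbitProj_eq_iff]
  constructor
  · rintro ⟨a, ha, h⟩
    have hp := B.fixes_centre hu hv ha h
    refine ⟨_, B.linearPart_mem_localGroup ha hp, B.param_injective p ?_⟩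
    rw [← h, B.apply_param, hp]
  · rintro ⟨A, ⟨b, hb, -, h⟩, rfl⟩
    exact ⟨b, hb, h u⟩

/-- The orbifold chart at `p`: the disc around `p`, with the stabilizer of `p` and the metric of
`Y`. -/
def orbifoldChart (p : Y) : OrbifoldChart (OrbitSpace Δ) where
  dom := B.disc hΔ p
  isOpen_dom := B.isOpen_disc hΔ p
  isConnected_dom := ⟨⟨0, B.zero_mem_disc hΔ p⟩, (convex_ball _ _).isPreconnected⟩
  metric u := confFactor ε u • euclideanForm 2
  isMetricOn :=
    { contDiffOn := (contDiff_confFactor_smul B.nonneg _).contDiffOn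
      symm := fun u _ v w => by simp [real_inner_comm]
      pos := fun u _ v hv => by
        have h1 := confFactor_pos B.nonneg u
        have h2 := real_inner_self_pos.2 hv
        simp only [smul_apply, euclideanForm_apply, smul_eq_mul]
        positivity }
  group := B.localGroup Δ p
  finite_group := B.finite_localGroup hΔ p
  mapsTo A _ u hu := B.map_mem_disc A hu
  isometric A _ u _ v w := by
    simp only [smul_apply, euclideanForm_apply, smul_eq_mul, A.inner_map_map,
      confFactor_congr (A.norm_map u)]
  proj u := orbitProj Δ (B.param p u)
  continuousOn_proj := (continuous_orbitProj.comp (B.continuous_param p)).continuousOn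
  isOpen_image V _ hV := by
    rw [← Function.comp_def, Set.image_comp]
    exact isOpenMap_orbitProj _ (B.isOpenMap_param p _ hV)
  proj_eq_iff _ hu _ hv := B.orbitProj_param_eq_iff hu hv

omit [LocallyCompactSpace Y] in
/-- Near points with the same image in the quotient, two charts are related by a local isometry. -/
lemma exists_transition {p p' : Y} {a : Y ≃ᵢ Y} {u u' : R2}
    (hau : a (B.param p u) = B.param p' u') :
    ∃ τ : R2 → R2, τ u = u' ∧ ContDiffAt ℝ ∞ τ u ∧ ∀ᶠ y in 𝓝 u,
      a (B.param p y) = B.param p' (τ y) ∧ ContDiffAt ℝ ∞ τ y ∧ ∀ v w,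
        confFactor ε (τ y) * inner ℝ (fderiv ℝ τ y v) (fderiv ℝ τ y w) =
          confFactor ε y * inner ℝ v w := by
  set A := B.linearPart a p with hA
  set T := B.transition (a p) p' with hT
  have hsrc : ∀ᶠ y in 𝓝 u, B.param (a p) (A y) ∈ (B.chart p').source := by
    refine ContinuousAt.eventually_mem (f := fun y => B.param (a p) (A y)) ?_
      ((B.chart p').open_source.mem_nhds ?_)
    · exact ((B.continuous_param (a p)).comp A.continuous).continuousAt
    · rw [← B.apply_param, hau]
      exact B.param_mem_source p' u'
  have hsm : ∀ᶠ y in 𝓝 u, ContDiffAt ℝ ∞ (T ∘ A) y := hsrc.mono fun y hy =>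
    (B.contDiffAt_transition hy).comp y A.toContinuousLinearEquiv.contDiff.contDiffAt
  refine ⟨T ∘ A, ?_, hsm.self_of_nhds, ?_⟩
  · rw [Function.comp_apply, hT, transition, ← B.apply_param, hau, B.chart_param]
  · filter_upwards [hsrc, hsm] with y hy hys
    refine ⟨?_, hys, fun v w => ?_⟩
    · rw [Function.comp_apply, B.param_transition hy, B.apply_param]
    · have hd : DifferentiableAt ℝ T (A y) :=
        (B.contDiffAt_transition hy).differentiableAt (by simp)
      have h1 : fderiv ℝ (T ∘ A) y =
          (fderiv ℝ T (A y)).comp (A.toContinuousLinearEquiv : R2 →L[ℝ] R2) :=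
        (hd.hasFDerivAt.comp y A.toContinuousLinearEquiv.hasFDerivAt).fderiv
      rw [h1, ← A.inner_map_map v w, ← confFactor_congr (A.norm_map y)]
      exact B.inner_fderiv_transition hy (A v) (A w)

/-- The orbifold structure of the quotient of `Y` by a discontinuous group. -/
def quotientOrbifold [SecondCountableTopology Y] : RiemannianOrbifold (OrbitSpace Δ) where
  t2 := hΔ.t2Space_orbitSpace
  secondCountable := secondCountableTopology_orbitSpace
  charts := Set.range (B.orbifoldChart hΔ)
  covering l := by
    obtain ⟨p, rfl⟩ := orbitProj_surjective l
    exact ⟨_, ⟨p, rfl⟩, 0, B.zero_mem_disc hΔ p, congrArg _ (B.param_zero p)⟩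
  compatible := by
    rintro _ ⟨p, rfl⟩ _ ⟨p', rfl⟩ u hu u' hu' h
    obtain ⟨a, ha, hau⟩ := orbitProj_eq_iff.1 (show orbitProj Δ (B.param p u) =
      orbitProj Δ (B.param p' u') from h)
    obtain ⟨τ, hτ, hτs, hev⟩ := B.exists_transition hau
    refine ⟨τ, hτ, ?_⟩
    filter_upwards [hev, hτs.continuousAt.preimage_mem_nhds
      ((B.isOpen_disc hΔ p').mem_nhds (hτ ▸ hu'))] with y hy hyd
    refine ⟨hyd, ?_, hy.2.1, hy.2.2⟩
    change orbitProj Δ (B.param p' (τ y)) = orbitProj Δ (B.param p y)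
    rw [← hy.1, orbitProj_apply ha]

lemma isQuotientOf [SecondCountableTopology Y] :
    (B.quotientOrbifold hΔ).IsQuotientOf κ (orbitProj Δ) := by
  rintro _ ⟨p, rfl⟩ u hu y hy
  obtain ⟨a, ha, hau⟩ := orbitProj_eq_iff.1 (hy.symm : orbitProj Δ (B.param p u) = orbitProj Δ y)
  set A := B.linearPart a p with hA
  have hτ : ∀ z, a (B.param p z) = B.param (a p) (A z) := B.apply_param a p
  refine ⟨fun z => a (B.param p z), hau, Filter.Eventually.of_forall fun z => ⟨?_, ?_, ?_⟩⟩
  · exact orbitProj_apply ha _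
  · rw [funext hτ]
    exact (B.contDiff_symm (a p)).contDiffAt.comp z A.toContinuousLinearEquiv.contDiff.contDiffAt
  · intro v w
    have h1 : fderiv ℝ (κ ∘ fun z => a (B.param p z)) z =
        (fderiv ℝ (κ ∘ B.param (a p)) (A z)).comp
          (A.toContinuousLinearEquiv : R2 →L[ℝ] R2) := by
      rw [funext hτ]
      exact ((B.differentiableAt_param (a p) (A z)).hasFDerivAt.comp z
        A.toContinuousLinearEquiv.hasFDerivAt).fderiv
    rw [h1]
    refine (B.inner_fderiv_param (a p) (A z) (A v) (A w)).trans ?_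
    rw [A.inner_map_map, confFactor_congr (A.norm_map z)]
    rfl

lemma onlyConePoints [SecondCountableTopology Y] (hrot : B.ActsByRotations Δ) :
    (B.quotientOrbifold hΔ).OnlyConePoints := by
  rintro _ ⟨p, rfl⟩ u - A hA -
  exact hrot p A hA

end Discontinuous

/-! ### Rotations of the plane in complex notation -/

end ConformalCharts

/-- The identification of `ℝ²` with `ℂ`. -/
def toComplex : R2 ≃ₗᵢ[ℝ] ℂ := Complex.orthonormalBasisOneI.repr.symm

lemma exists_rotation {A : R2 ≃ₗᵢ[ℝ] R2}
    (hA : LinearMap.det (A.toLinearEquiv : R2 →ₗ[ℝ] R2) = 1) :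
    ∃ ζ : ℂ, ∀ z, toComplex (A (toComplex.symm z)) = ζ * z := by
  set f : ℂ ≃ₗᵢ[ℝ] ℂ := (toComplex.symm.trans A).trans toComplex with hf
  have hdet : LinearMap.det (f.toLinearEquiv : ℂ →ₗ[ℝ] ℂ) = 1 := by
    rw [← hA]
    exact LinearMap.det_conj (A.toLinearEquiv : R2 →ₗ[ℝ] R2) toComplex.toLinearEquiv
  obtain ⟨a, ha | ha⟩ := linear_isometry_complex f
  · refine ⟨a, fun z => ?_⟩
    have : f z = rotation a z := by rw [ha]
    rw [rotation_apply] at this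
    exact this
  · exfalso
    have h1 : (f.toLinearEquiv : ℂ →ₗ[ℝ] ℂ) =
        ((rotation a).toLinearEquiv : ℂ →ₗ[ℝ] ℂ) ∘ₗ
            (Complex.conjLIE.toLinearEquiv : ℂ →ₗ[ℝ] ℂ) := by
      rw [ha]
      rfl
    rw [h1, LinearMap.det_comp, det_rotation, Complex.det_conjLIE] at hdet
    norm_num at hdet

namespace ConformalCharts

variable {ε : ℝ} {Y E : Type} [MetricSpace Y] [NormedAddCommGroup E] [InnerProductSpace ℝ E]
  {κ : Y → E} (B : ConformalCharts 2 ε κ) {Δ : Subgroup (Y ≃ᵢ Y)}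

lemma eq_one_of_fixed {A : R2 ≃ₗᵢ[ℝ] R2}
    (hA : LinearMap.det (A.toLinearEquiv : R2 →ₗ[ℝ] R2) = 1) {u : R2} (hu : u ≠ 0)
    (h : A u = u) : A = 1 := by
  obtain ⟨ζ, hζ⟩ := exists_rotation hA
  have h1 := hζ (toComplex u)
  rw [LinearIsometryEquiv.symm_apply_apply, h] at h1
  have hu' : toComplex u ≠ 0 := by simpa using hu
  have h2 : ζ = 1 := mul_right_cancel₀ hu' (by rw [← h1, one_mul])
  refine LinearIsometryEquiv.ext fun v => toComplex.injective ?_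
  have h3 := hζ (toComplex v)
  rwa [LinearIsometryEquiv.symm_apply_apply, h2, one_mul] at h3

/-- The order of the local group at `p`, the order of the cone point. -/
def order (Δ : Subgroup (Y ≃ᵢ Y)) (p : Y) : ℕ := Nat.card (B.localGroup Δ p)

/-- A finite group of rotations, of order `n`, consists of the multiplications by the `n`-th roots
of unity. -/
lemma pow_order_eq_iff (hrot : B.ActsByRotations Δ) (p : Y) [Finite (B.localGroup Δ p)]
    (u v : R2) : toComplex u ^ B.order Δ p = toComplex v ^ B.order Δ p ↔
      ∃ A ∈ B.localGroup Δ p, A u = v := by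
  choose ζ hζ using fun A : B.localGroup Δ p => exists_rotation (hrot p A A.2)
  have hζ' : ∀ (A : B.localGroup Δ p) (u : R2),
      toComplex ((A : R2 ≃ₗᵢ[ℝ] R2) u) = ζ A * toComplex u := fun A u => by
    rw [← hζ, LinearIsometryEquiv.symm_apply_apply]
  have hn : B.order Δ p ≠ 0 := Nat.card_pos.ne'
  have hζmul : ∀ A A', ζ (A * A') = ζ A * ζ A' := by
    intro A A'
    have h1 := hζ' (A * A') (toComplex.symm 1)
    have h2 := hζ' A ((A' : R2 ≃ₗᵢ[ℝ] R2) (toComplex.symm 1))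
    rw [hζ' A', LinearIsometryEquiv.apply_symm_apply, mul_one] at h2
    rw [LinearIsometryEquiv.apply_symm_apply, mul_one] at h1
    rw [← h1, ← h2]
    rfl
  have hζ1 : ζ 1 = 1 := by
    have h1 := hζ' 1 (toComplex.symm 1)
    rw [LinearIsometryEquiv.apply_symm_apply, mul_one] at h1
    rw [← h1]
    exact toComplex.apply_symm_apply 1
  let ζhom : B.localGroup Δ p →* ℂ := ⟨⟨ζ, hζ1⟩, hζmul⟩
  have hζpow : ∀ A, ζ A ^ B.order Δ p = 1 := by
    intro A
    have h1 : ζhom (A ^ B.order Δ p) = ζhom A ^ B.order Δ p := map_pow ζhom A _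
    rw [order, pow_card_eq_one', map_one] at h1
    exact h1.symm
  have hinj : Function.Injective ζ := by
    intro A A' h
    refine Subtype.ext (LinearIsometryEquiv.ext fun u => toComplex.injective ?_)
    rw [hζ', hζ', h]
  constructor
  · intro h
    by_cases hu : toComplex u = 0
    · have hv : toComplex v = 0 := by
        rw [hu, zero_pow hn] at h
        exact pow_eq_zero_iff hn |>.1 h.symm
      have hu0 : u = 0 := by simpa using hu
      have hv0 : v = 0 := by simpa using hv
      exact ⟨1, one_mem _, by rw [hu0, hv0, map_zero]⟩
    · -- the `n` values of the injective map `ζ` are `n`-th roots of unity, hence all of them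
      have hmem : toComplex v / toComplex u ∈ Set.range ζ := by
        have hfin : Set.range ζ =
            ((Polynomial.nthRoots (B.order Δ p) (1 : ℂ)).toFinset : Set ℂ) := by
          refine Set.eq_of_subset_of_ncard_le ?_ ?_ (Finset.finite_toSet _)
          · rintro _ ⟨A, rfl⟩
            rw [Finset.mem_coe, Multiset.mem_toFinset,
              Polynomial.mem_nthRoots (Nat.pos_of_ne_zero hn)]
            exact hζpow A
          · rw [Set.ncard_coe_finset, ← Set.image_univ, Set.ncard_image_of_injective _ hinj,
              Set.ncard_univ]
            exact (Multiset.toFinset_card_le _).trans (Polynomial.card_nthRoots _ _)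
        rw [hfin, Finset.mem_coe, Multiset.mem_toFinset,
          Polynomial.mem_nthRoots (Nat.pos_of_ne_zero hn), div_pow, ← h]
        exact div_self (pow_ne_zero _ hu)
      obtain ⟨A, hA⟩ := hmem
      refine ⟨A, A.2, toComplex.injective ?_⟩
      rw [hζ', hA, div_mul_cancel₀ _ hu]
  · rintro ⟨A, hA, rfl⟩
    rw [hζ' ⟨A, hA⟩, mul_pow, hζpow, one_mul]

/-! ### Regular points -/

/-- The elements of the group that fix `y` are trivial near `y`. -/
def IsRegularPoint (Δ : Subgroup (Y ≃ᵢ Y)) (y : Y) : Prop :=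
  ∀ b ∈ Δ, b y = y → ∀ᶠ z in 𝓝 y, b z = z

omit [InnerProductSpace ℝ E] [NormedAddCommGroup E] in
lemma IsRegularPoint.apply {y : Y} (h : IsRegularPoint Δ y) {a : Y ≃ᵢ Y} (ha : a ∈ Δ) :
    IsRegularPoint Δ (a y) := by
  intro b hb hby
  have h1 := h (a⁻¹ * b * a) (Δ.mul_mem (Δ.mul_mem (Δ.inv_mem ha) hb) ha) (by
    rw [IsometryEquiv.mul_apply, IsometryEquiv.mul_apply, hby, IsometryEquiv.inv_apply_self])
  have h2 : Filter.Tendsto (⇑(a⁻¹)) (𝓝 (a y)) (𝓝 y) := by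
    have := (a⁻¹).continuous.tendsto (a y)
    rwa [IsometryEquiv.inv_apply_self] at this
  filter_upwards [h2.eventually h1] with z hz
  rw [IsometryEquiv.mul_apply, IsometryEquiv.mul_apply, IsometryEquiv.apply_inv_self] at hz
  exact (a⁻¹).injective hz

lemma order_eq_one {p : Y} (h : IsRegularPoint Δ p) : B.order Δ p = 1 := by
  rw [order, Subgroup.card_eq_one, Subgroup.eq_bot_iff_forall]
  rintro A ⟨b, hb, hp, hA⟩
  have h1 : ∀ᶠ u in 𝓝 (0 : R2), A u = u := by
    filter_upwards [(B.tendsto_param p).eventually (h b hb hp)] with u hu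
    rw [hA] at hu
    exact B.param_injective p hu
  -- a linear map that is the identity near the origin is the identity
  have h2 : fderiv ℝ A 0 = fderiv ℝ (fun u : R2 => u) 0 :=
    Filter.EventuallyEq.fderiv_eq h1
  rw [fderiv_fun_id, show fderiv ℝ A 0 = (A.toContinuousLinearEquiv : R2 →L[ℝ] R2) from
    A.toContinuousLinearEquiv.fderiv] at h2
  exact LinearIsometryEquiv.ext fun u => congrArg (fun f : R2 →L[ℝ] R2 => f u) h2

section Discontinuous

variable [LocallyCompactSpace Y] {hΔ : ActsDiscontinuously Δ}

lemma isRegularPoint_of_isotropy {p : Y} {u : R2} (hu : u ∈ B.disc hΔ p)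
    (h : ∀ A ∈ B.localGroup Δ p, A u = u → A = 1) : IsRegularPoint Δ (B.param p u) := by
  intro b hb hbu
  have hp := B.fixes_centre hu hu hb hbu
  have hA : B.linearPart b p = 1 := h _ (B.linearPart_mem_localGroup hb hp) (by
    rw [B.apply_param, hp] at hbu
    exact B.param_injective p hbu)
  filter_upwards [(B.chart p).open_source.mem_nhds (B.param_mem_source p u)] with z hz
  rw [← B.param_chart hz, B.apply_param, hp, hA]
  rfl

lemma isRegularPoint_of_ne_zero (hrot : B.ActsByRotations Δ) {p : Y} {u : R2}
    (hu : u ∈ B.disc hΔ p) (h0 : u ≠ 0) : IsRegularPoint Δ (B.param p u) :=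
  B.isRegularPoint_of_isotropy hu fun A hA h => eq_one_of_fixed (hrot p A hA) h0 h

/-- At regular points the power map has nonzero derivative. -/
lemma deriv_pow_ne_zero (hΔ : ActsDiscontinuously Δ) {p : Y} {u : R2}
    (h : IsRegularPoint Δ (B.param p u)) :
    (B.order Δ p : ℂ) * toComplex u ^ (B.order Δ p - 1) ≠ 0 := by
  by_cases h0 : u = 0
  · rw [h0, B.param_zero] at h
    rw [B.order_eq_one h]
    simp
  · have := B.finite_localGroup hΔ p
    have hn : B.order Δ p ≠ 0 := Nat.card_pos.ne'
    exact mul_ne_zero (Nat.cast_ne_zero.2 hn) (pow_ne_zero _ (by simpa using h0))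

end Discontinuous

end ConformalCharts

/-! ### Smoothing the quotient orbifold -/

/-- Two open continuous maps on an open set, with the same fibres, have homeomorphic images. -/
lemma exists_openPartialHomeomorph_of_fibres_eq {Z L P : Type} [TopologicalSpace Z]
    [TopologicalSpace L] [TopologicalSpace P] {D : Set Z} (hD : IsOpen D) {f : Z → L} {g : Z → P}
    (hf : ContinuousOn f D) (hg : ContinuousOn g D)
    (hfo : ∀ V ⊆ D, IsOpen V → IsOpen (f '' V)) (hgo : ∀ V ⊆ D, IsOpen V → IsOpen (g '' V))
    (hfg : ∀ u ∈ D, ∀ v ∈ D, f u = f v ↔ g u = g v) (z₀ : Z) :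
    ∃ e : OpenPartialHomeomorph L P, e.source = f '' D ∧ e.target = g '' D ∧
      (∀ u ∈ D, e (f u) = g u) ∧ ∀ u ∈ D, e.symm (g u) = f u := by
  classical
  have hZ : Nonempty Z := ⟨z₀⟩
  set F : L → P := fun l => g (Function.invFunOn f D l) with hF
  set G : P → L := fun l => f (Function.invFunOn g D l) with hG
  have hFu : ∀ u ∈ D, F (f u) = g u := fun u hu =>
    (hfg _ (Function.invFunOn_mem ⟨u, hu, rfl⟩) u hu).1 (Function.invFunOn_eq ⟨u, hu, rfl⟩)
  have hGu : ∀ u ∈ D, G (g u) = f u := fun u hu =>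
    (hfg _ (Function.invFunOn_mem ⟨u, hu, rfl⟩) u hu).2 (Function.invFunOn_eq ⟨u, hu, rfl⟩)
  have hcont : ∀ {L P : Type} [TopologicalSpace L] [TopologicalSpace P] (f : Z → L) (g : Z → P)
      (F : L → P), ContinuousOn g D → (∀ V ⊆ D, IsOpen V → IsOpen (f '' V)) →
      (∀ u ∈ D, F (f u) = g u) → ContinuousOn F (f '' D) := by
    rintro L P _ _ f g F hg hfo hFu _ ⟨u, hu, rfl⟩
    refine ContinuousAt.continuousWithinAt fun V hV => ?_
    rw [hFu u hu] at hV
    obtain ⟨V', hV', hV'o, huV⟩ := mem_nhds_iff.1 hV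
    rw [Filter.mem_map]
    refine Filter.mem_of_superset ((hfo (D ∩ g ⁻¹' V') Set.inter_subset_left
      (hg.isOpen_inter_preimage hD hV'o)).mem_nhds ⟨u, ⟨hu, huV⟩, rfl⟩) ?_
    rintro _ ⟨v, hv, rfl⟩
    rw [Set.mem_preimage, hFu v hv.1]
    exact hV' hv.2
  let e : OpenPartialHomeomorph L P :=
    { toFun := F
      invFun := G
      source := f '' D
      target := g '' D
      map_source' := by
        rintro _ ⟨u, hu, rfl⟩
        exact ⟨u, hu, (hFu u hu).symm⟩
      map_target' := by
        rintro _ ⟨u, hu, rfl⟩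
        exact ⟨u, hu, (hGu u hu).symm⟩
      left_inv' := by
        rintro _ ⟨u, hu, rfl⟩
        rw [hFu u hu, hGu u hu]
      right_inv' := by
        rintro _ ⟨u, hu, rfl⟩
        rw [hGu u hu, hFu u hu]
      open_source := hfo D subset_rfl hD
      open_target := hgo D subset_rfl hD
      continuousOn_toFun := hcont f g F hg hfo hFu
      continuousOn_invFun := hcont g f G hf hgo hGu }
  exact ⟨e, rfl, rfl, hFu, hGu⟩

lemma isOpenMap_pow {n : ℕ} (hn : n ≠ 0) : IsOpenMap fun z : ℂ => z ^ n := by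
  have h : AnalyticOnNhd ℂ (fun z : ℂ => z ^ n) Set.univ := fun z _ => analyticAt_id.pow n
  refine h.is_constant_or_isOpenMap.resolve_left ?_
  rintro ⟨w, hw⟩
  have h0 := hw 0
  have h1 := hw 1
  rw [zero_pow hn] at h0
  rw [one_pow, ← h0] at h1
  exact one_ne_zero h1

namespace ConformalCharts

variable {ε : ℝ} {Y E : Type} [MetricSpace Y] [NormedAddCommGroup E] [InnerProductSpace ℝ E]
  {κ : Y → E} (B : ConformalCharts 2 ε κ) {Δ : Subgroup (Y ≃ᵢ Y)} [LocallyCompactSpace Y]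
  (hΔ : ActsDiscontinuously Δ) (hrot : B.ActsByRotations Δ)

include hΔ in
lemma order_ne_zero (p : Y) : B.order Δ p ≠ 0 := by
  have := B.finite_localGroup hΔ p
  exact Nat.card_pos.ne'

include hrot in
/-- On the disc around `p`, the projection to the quotient and the map `z ↦ zⁿ` have the same
fibres, which are the orbits of the stabilizer of `p`. -/
lemma exists_smoothChart (p : Y) : ∃ e : OpenPartialHomeomorph (OrbitSpace Δ) ℂ,
    e.source = (fun u => orbitProj Δ (B.param p u)) '' B.disc hΔ p ∧
    e.target = (fun u => toComplex u ^ B.order Δ p) '' B.disc hΔ p ∧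
    (∀ u ∈ B.disc hΔ p, e (orbitProj Δ (B.param p u)) = toComplex u ^ B.order Δ p) ∧
    ∀ u ∈ B.disc hΔ p, e.symm (toComplex u ^ B.order Δ p) = orbitProj Δ (B.param p u) := by
  have := B.finite_localGroup hΔ p
  refine exists_openPartialHomeomorph_of_fibres_eq (B.isOpen_disc hΔ p) ?_ ?_ ?_ ?_ ?_ 0
  · exact (continuous_orbitProj.comp (B.continuous_param p)).continuousOn
  · exact (toComplex.continuous.pow _).continuousOn
  · exact fun V _ hV => (isOpenMap_orbitProj.comp (B.isOpenMap_param p)) V hV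
  · exact fun V _ hV => ((isOpenMap_pow (B.order_ne_zero hΔ p)).comp
      toComplex.toHomeomorph.isOpenMap) V hV
  · intro u hu v hv
    rw [B.orbitProj_param_eq_iff hu hv, B.pow_order_eq_iff hrot]

/-- The chart of the smoothing at the image of `p`: if the stabilizer of `p` has order `n`, the
orbit of the point with the complex coordinate `z` in the chart of `Y` at `p` is mapped to `zⁿ`. -/
def smoothChart (p : Y) : OpenPartialHomeomorph (OrbitSpace Δ) ℂ :=
  (B.exists_smoothChart hΔ hrot p).choose

lemma smoothChart_source (p : Y) : (B.smoothChart hΔ hrot p).source =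
    (fun u => orbitProj Δ (B.param p u)) '' B.disc hΔ p :=
  (B.exists_smoothChart hΔ hrot p).choose_spec.1

lemma smoothChart_target (p : Y) : (B.smoothChart hΔ hrot p).target =
    (fun u => toComplex u ^ B.order Δ p) '' B.disc hΔ p :=
  (B.exists_smoothChart hΔ hrot p).choose_spec.2.1

lemma smoothChart_apply {p : Y} {u : R2} (hu : u ∈ B.disc hΔ p) :
    B.smoothChart hΔ hrot p (orbitProj Δ (B.param p u)) = toComplex u ^ B.order Δ p :=
  (B.exists_smoothChart hΔ hrot p).choose_spec.2.2.1 u hu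

lemma smoothChart_symm_apply {p : Y} {u : R2} (hu : u ∈ B.disc hΔ p) :
    (B.smoothChart hΔ hrot p).symm (toComplex u ^ B.order Δ p) = orbitProj Δ (B.param p u) :=
  (B.exists_smoothChart hΔ hrot p).choose_spec.2.2.2 u hu

lemma mem_smoothChart_source (p : Y) : orbitProj Δ p ∈ (B.smoothChart hΔ hrot p).source := by
  rw [smoothChart_source]
  exact ⟨0, B.zero_mem_disc hΔ p, congrArg _ (B.param_zero p)⟩

/-- At regular points the charts of the smoothing are smooth and conformal functions of the
conformal charts of `Y`. -/
lemma smoothChart_conformal {p p' : Y} {u : R2} (hreg : IsRegularPoint Δ (B.param p u))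
    (hsrc : orbitProj Δ (B.param p u) ∈ (B.smoothChart hΔ hrot p').source) :
    ContDiffAt ℝ ∞ (fun w => B.smoothChart hΔ hrot p' (orbitProj Δ (B.param p w))) u ∧
    ConformalAt (fun w => B.smoothChart hΔ hrot p' (orbitProj Δ (B.param p w))) u := by
  rw [smoothChart_source] at hsrc
  obtain ⟨u', hu', h⟩ := hsrc
  obtain ⟨a, ha, hau⟩ := orbitProj_eq_iff.1 h.symm
  obtain ⟨τ, hτ, hτs, hev⟩ := B.exists_transition hau
  have hreg' : IsRegularPoint Δ (B.param p' u') := hau ▸ hreg.apply ha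
  have hd := B.deriv_pow_ne_zero hΔ hreg'
  have heq : (fun w => B.smoothChart hΔ hrot p' (orbitProj Δ (B.param p w))) =ᶠ[𝓝 u]
      (fun z : ℂ => z ^ B.order Δ p') ∘ toComplex ∘ τ := by
    filter_upwards [hev, hτs.continuousAt.preimage_mem_nhds
      ((B.isOpen_disc hΔ p').mem_nhds (hτ ▸ hu'))] with y hy hyd
    rw [← orbitProj_apply ha, hy.1, B.smoothChart_apply hΔ hrot hyd]
    rfl
  have hpow : ConformalAt (fun z : ℂ => z ^ B.order Δ p') ((toComplex ∘ τ) u) := by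
    refine (hasDerivAt_pow (B.order Δ p') _).differentiableAt.conformalAt ?_
    rw [(hasDerivAt_pow (B.order Δ p') _).deriv, Function.comp_apply, hτ]
    exact hd
  have hτc : ConformalAt τ u := by
    rw [conformalAt_iff']
    refine ⟨(confFactor ε (τ u))⁻¹ * confFactor ε u, mul_pos (inv_pos.2 (confFactor_pos B.nonneg _))
      (confFactor_pos B.nonneg _), fun v w => ?_⟩
    rw [mul_assoc, ← hev.self_of_nhds.2.2 v w,
      inv_mul_cancel_left₀ (confFactor_pos B.nonneg _).ne']
  have hcx : ConformalAt toComplex (τ u) :=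
    ⟨_, toComplex.toContinuousLinearEquiv.hasFDerivAt, toComplex.toLinearIsometry.isConformalMap⟩
  refine ⟨?_, ?_⟩
  · refine ContDiffAt.congr_of_eventuallyEq ?_ heq
    exact ((contDiff_id.pow _).contDiffAt (x := (toComplex ∘ τ) u)).comp u
      (toComplex.toContinuousLinearEquiv.contDiff.contDiffAt.comp u hτs)
  · obtain ⟨V, hV, hVo, huV⟩ := eventually_nhds_iff.1 heq
    exact (hpow.comp u (hcx.comp u hτc)).congr huV hVo fun y hy => hV y hy

/-- Two charts of the smoothing centred at different points meet only at regular points; the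
hypothesis says that the centres represent different points of the quotient. -/
lemma smoothChart_transition {p p' : Y} (hpp' : orbitProj Δ p = orbitProj Δ p' → p = p') {z : ℂ}
    (hz : z ∈ ((B.smoothChart hΔ hrot p).symm.trans (B.smoothChart hΔ hrot p')).source) :
    ContDiffAt ℝ ∞ ((B.smoothChart hΔ hrot p).symm.trans (B.smoothChart hΔ hrot p')) z ∧
      ConformalAt ((B.smoothChart hΔ hrot p).symm.trans (B.smoothChart hΔ hrot p')) z := by
  set ψ := B.smoothChart hΔ hrot p with hψ
  set ψ' := B.smoothChart hΔ hrot p' with hψ'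
  rw [OpenPartialHomeomorph.trans_source, OpenPartialHomeomorph.symm_source] at hz
  by_cases hp : p = p'
  · have heq : ∀ y ∈ ψ.target, (ψ.symm.trans ψ') y = id y := fun y hy => by
      rw [OpenPartialHomeomorph.trans_apply, hψ', ← hp]
      exact ψ.right_inv hy
    exact ⟨contDiffAt_id.congr_of_eventuallyEq (Filter.eventuallyEq_of_mem
      (ψ.open_target.mem_nhds hz.1) heq), (conformalAt_id z).congr hz.1 ψ.open_target heq⟩
  have hz1 := hz.1
  rw [hψ, smoothChart_target] at hz1
  obtain ⟨u, hu, rfl⟩ := hz1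
  beta_reduce at hz ⊢
  have hsrc : orbitProj Δ (B.param p u) ∈ ψ'.source := by
    have := hz.2
    rwa [Set.mem_preimage, hψ, B.smoothChart_symm_apply hΔ hrot hu] at this
  -- at least one of the two charts is not centred at the point, which is therefore regular
  have hreg : IsRegularPoint Δ (B.param p u) := by
    by_cases h0 : u = 0
    · rw [hψ', smoothChart_source] at hsrc
      obtain ⟨u', hu', h⟩ := hsrc
      obtain ⟨a, ha, hau⟩ := orbitProj_eq_iff.1 h
      rw [← hau]
      refine (B.isRegularPoint_of_ne_zero hrot hu' ?_).apply ha
      rintro rfl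
      refine hp (hpp' ?_)
      have h' : orbitProj Δ (B.param p' 0) = orbitProj Δ (B.param p u) := h
      rw [h0, B.param_zero, B.param_zero] at h'
      exact h'.symm
    · exact B.isRegularPoint_of_ne_zero hrot hu h0
  obtain ⟨hks, hkc⟩ := B.smoothChart_conformal hΔ hrot hreg hsrc
  have hd := B.deriv_pow_ne_zero hΔ hreg
  have han : AnalyticAt ℂ (fun z : ℂ => z ^ B.order Δ p) (toComplex u) := analyticAt_id.pow _
  have hder := (hasDerivAt_pow (B.order Δ p) (toComplex u)).deriv
  have hd' : deriv (fun z : ℂ => z ^ B.order Δ p) (toComplex u) ≠ 0 := by rwa [hder]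
  -- a local inverse of the power map
  set g := han.hasStrictDerivAt.localInverse _ _ _ hd' with hg
  have hga : AnalyticAt ℂ g (toComplex u ^ B.order Δ p) := han.analyticAt_localInverse hd'
  have hg0 : g (toComplex u ^ B.order Δ p) = toComplex u :=
    HasStrictFDerivAt.localInverse_apply_image ..
  have hgr : ∀ᶠ z in 𝓝 (toComplex u ^ B.order Δ p), g z ^ B.order Δ p = z :=
    HasStrictDerivAt.eventually_right_inverse ..
  have hgd : ConformalAt g (toComplex u ^ B.order Δ p) := by
    refine hga.differentiableAt.conformalAt ?_
    rw [(HasStrictDerivAt.to_localInverse ..).hasDerivAt.deriv]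
    exact inv_ne_zero hd'
  have hgs : ContDiffAt ℝ ∞ g (toComplex u ^ B.order Δ p) := hga.contDiffAt.restrict_scalars ℝ
  set σ : ℂ → R2 := fun z => toComplex.symm (g z) with hσ
  have hσ0 : σ (toComplex u ^ B.order Δ p) = u := by
    rw [hσ]
    simp only [hg0, LinearIsometryEquiv.symm_apply_apply]
  have hσs : ContDiffAt ℝ ∞ σ (toComplex u ^ B.order Δ p) :=
    toComplex.symm.toContinuousLinearEquiv.contDiff.contDiffAt.comp _ hgs
  have hσc : ConformalAt σ (toComplex u ^ B.order Δ p) :=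
    ConformalAt.comp (g := toComplex.symm) _ ⟨_, toComplex.symm.toContinuousLinearEquiv.hasFDerivAt,
      toComplex.symm.toLinearIsometry.isConformalMap⟩ hgd
  have heq : (ψ.symm.trans ψ') =ᶠ[𝓝 (toComplex u ^ B.order Δ p)]
      (fun w => ψ' (orbitProj Δ (B.param p w))) ∘ σ := by
    filter_upwards [hgr, hσs.continuousAt.preimage_mem_nhds
      ((B.isOpen_disc hΔ p).mem_nhds (hσ0.symm ▸ hu))] with y hy hyd
    rw [Function.comp_apply, ← B.smoothChart_symm_apply hΔ hrot hyd,
      OpenPartialHomeomorph.trans_apply]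
    simp only [hσ, LinearIsometryEquiv.apply_symm_apply, hy]
    rfl
  refine ⟨?_, ?_⟩
  · refine ContDiffAt.congr_of_eventuallyEq ?_ heq
    refine ContDiffAt.comp _ ?_ hσs
    rwa [hσ0]
  · obtain ⟨V, hV, hVo, huV⟩ := eventually_nhds_iff.1 heq
    refine (ConformalAt.comp (g := fun w => ψ' (orbitProj Δ (B.param p w))) _ ?_ hσc).congr
      huV hVo fun y hy => hV y hy
    rwa [hσ0]

/-- The smoothing of the quotient orbifold. -/
@[reducible]
def smoothing : ChartedSpace ℂ (OrbitSpace Δ) where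
  atlas := Set.range fun l : OrbitSpace Δ => B.smoothChart hΔ hrot (Quotient.out l)
  chartAt l := B.smoothChart hΔ hrot (Quotient.out l)
  mem_chart_source l := by
    have h := B.mem_smoothChart_source hΔ hrot (Quotient.out l)
    rwa [show orbitProj Δ (Quotient.out l) = l from Quotient.out_eq l] at h
  chart_mem_atlas l := ⟨l, rfl⟩

lemma isSmoothedBy_smoothing [SecondCountableTopology Y] :
    @RiemannianOrbifold.IsSmoothedBy _ _ (B.quotientOrbifold hΔ) (B.smoothing hΔ hrot) := by
  let _ := B.smoothing hΔ hrot
  have hout : ∀ l l' : OrbitSpace Δ, orbitProj Δ (Quotient.out l) = orbitProj Δ (Quotient.out l') →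
      Quotient.out l = Quotient.out l' := fun l l' h => by
    have h1 : orbitProj Δ (Quotient.out l) = l := Quotient.out_eq l
    have h2 : orbitProj Δ (Quotient.out l') = l' := Quotient.out_eq l'
    rw [← h1, h, h2]
  refine ⟨⟨?_, ?_⟩, ?_⟩
  · refine isManifold_of_contDiffOn 𝓘(ℝ, ℂ) ∞ (OrbitSpace Δ) ?_
    rintro _ _ ⟨l, rfl⟩ ⟨l', rfl⟩ z hz
    exact (B.smoothChart_transition hΔ hrot (hout l l') hz.1).1.contDiffWithinAt
  · refine hasGroupoid_of_pregroupoid conformalPregroupoid ?_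
    rintro _ _ ⟨l, rfl⟩ ⟨l', rfl⟩ z hz
    exact (B.smoothChart_transition hΔ hrot (hout l l') hz).2
  · rintro _ ⟨p, rfl⟩ u hu hiso _ ⟨l, rfl⟩ hsrc
    have hreg := B.isRegularPoint_of_isotropy hu hiso
    obtain ⟨h1, h2⟩ := B.smoothChart_conformal hΔ hrot hreg hsrc
    refine ⟨h1, ?_⟩
    obtain ⟨r, hr, h⟩ := (conformalAt_iff' ..).1 h2
    have hc := confFactor_pos B.nonneg u
    refine ⟨r * (confFactor ε u)⁻¹, mul_pos hr (inv_pos.2 hc), fun v w => ?_⟩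
    refine (h v w).trans ?_
    change r * inner ℝ v w = r * (confFactor ε u)⁻¹ * (confFactor ε u * inner ℝ v w)
    rw [mul_assoc, inv_mul_cancel_left₀ hc.ne']

end ConformalCharts

/-! ### Conformal maps of plane domains -/

open ComplexConjugate in
/-- A smooth conformal map of a connected plane domain is holomorphic or antiholomorphic. -/
lemma differentiableOn_or_conj_of_conformal {K : ℂ → ℂ} {U : Set ℂ} (hU : IsOpen U)
    (hU' : IsPreconnected U) (hs : ∀ z ∈ U, ContDiffAt ℝ ∞ K z) (hc : ∀ z ∈ U, ConformalAt K z) :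
    DifferentiableOn ℂ K U ∨ DifferentiableOn ℂ (fun z => conj (K z)) U := by
  -- `α` vanishes where the differential is complex linear, `β` where it is antilinear; so the sets
  -- `α ≠ 0` and `β ≠ 0` are open, disjoint, and cover `U`
  set α : ℂ → ℂ := fun z => fderiv ℝ K z Complex.I - Complex.I * fderiv ℝ K z 1 with hα
  set β : ℂ → ℂ := fun z => fderiv ℝ K z Complex.I + Complex.I * fderiv ℝ K z 1 with hβ
  have hdiff : ContinuousOn (fderiv ℝ K) U := fun z hz =>
    ((hs z hz).fderiv_right (m := ∞) (by simp)).continuousAt.continuousWithinAt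
  have hαc : ContinuousOn α U := (hdiff.clm_apply continuousOn_const).sub
    (continuousOn_const.mul (hdiff.clm_apply continuousOn_const))
  have hβc : ContinuousOn β U := (hdiff.clm_apply continuousOn_const).add
    (continuousOn_const.mul (hdiff.clm_apply continuousOn_const))
  have hαβ : ∀ z ∈ U, α z = 0 ∨ β z = 0 := by
    intro z hz
    rcases (conformalAt_iff_isConformalMap_fderiv.1 (hc z hz)).is_complex_or_conj_linear with
      ⟨L, hL⟩ | ⟨L, hL⟩
    · left
      have h1 : ∀ w, fderiv ℝ K z w = L w := fun w => by rw [← hL]; rfl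
      rw [hα]
      simp only [h1]
      rw [← smul_eq_mul, ← map_smul, smul_eq_mul, mul_one, sub_self]
    · right
      have h1 : ∀ w, fderiv ℝ K z w = L (conj w) := fun w => by
        have := congrArg (fun f : ℂ →L[ℝ] ℂ => f (conj w)) hL
        simpa using this.symm
      rw [hβ]
      simp only [h1, map_one, Complex.conj_I]
      rw [← smul_eq_mul, ← map_smul, smul_eq_mul, mul_one, map_neg, neg_add_cancel]
  have hne : ∀ z ∈ U, ¬ (α z = 0 ∧ β z = 0) := by
    rintro z hz ⟨h1, h2⟩
    have h3 : fderiv ℝ K z Complex.I = 0 := by linear_combination (h1 + h2) / 2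
    have h4 : fderiv ℝ K z 1 = 0 := by
      have : Complex.I * fderiv ℝ K z 1 = 0 := by linear_combination (h2 - h1) / 2
      exact (mul_eq_zero.1 this).resolve_left Complex.I_ne_zero
    refine (conformalAt_iff_isConformalMap_fderiv.1 (hc z hz)).ne_zero ?_
    ext1 w
    have hw : w = w.re • (1 : ℂ) + w.im • Complex.I := by
      simp [Complex.re_add_im]
    rw [hw, map_add, map_smul, map_smul, h3, h4]
    simp
  have key := hU'.subset_or_subset
    (hαc.isOpen_inter_preimage hU (isOpen_compl_singleton (x := (0 : ℂ))))
    (hβc.isOpen_inter_preimage hU (isOpen_compl_singleton (x := (0 : ℂ))))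
    (by
      rw [Set.disjoint_left]
      rintro z ⟨hz, hz1⟩ ⟨-, hz2⟩
      exact (hαβ z hz).elim hz1 hz2)
    (fun z hz => by
      by_cases h : α z = 0
      · exact Or.inr ⟨hz, fun h' => hne z hz ⟨h, h'⟩⟩
      · exact Or.inl ⟨hz, h⟩)
  rcases key with key | key
  · right
    intro z hz
    refine DifferentiableAt.differentiableWithinAt ?_
    have hd := ((hs z hz).differentiableAt (by simp)).hasFDerivAt
    have hβ0 : β z = 0 := (hαβ z hz).resolve_left (key hz).2
    have hd' : HasFDerivAt (fun z => conj (K z))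
        ((Complex.conjCLE : ℂ →L[ℝ] ℂ).comp (fderiv ℝ K z)) z :=
      Complex.conjCLE.hasFDerivAt.comp z hd
    rw [differentiableAt_complex_iff_differentiableAt_real]
    refine ⟨hd'.differentiableAt, ?_⟩
    rw [hd'.fderiv]
    have h1 : fderiv ℝ K z Complex.I = -(Complex.I * fderiv ℝ K z 1) :=
      eq_neg_of_add_eq_zero_left hβ0
    simp [h1]
  · left
    intro z hz
    refine DifferentiableAt.differentiableWithinAt ?_
    rw [differentiableAt_complex_iff_differentiableAt_real]
    exact ⟨(hs z hz).differentiableAt (by simp),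
      sub_eq_zero.1 ((hαβ z hz).resolve_right (key hz).2)⟩

lemma isPreconnected_punctured_ball (r : ℝ) : IsPreconnected (Metric.ball (0 : ℂ) r \ {0}) := by
  rcases le_or_gt r 0 with hr | hr
  · rw [Metric.ball_eq_empty.2 hr, Set.empty_sdiff]
    exact isPreconnected_empty
  -- the punctured disc is the image of a half plane under the exponential map
  have h : Metric.ball (0 : ℂ) r \ {0} = Complex.exp '' {z | z.re < Real.log r} := by
    ext w
    constructor
    · rintro ⟨hw, hw0⟩
      refine ⟨Complex.log w, ?_, Complex.exp_log hw0⟩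
      change (Complex.log w).re < _
      rw [Complex.log_re]
      exact Real.log_lt_log (norm_pos_iff.2 hw0) (mem_ball_zero_iff.1 hw)
    · rintro ⟨z, hz, rfl⟩
      refine ⟨?_, Complex.exp_ne_zero z⟩
      rw [mem_ball_zero_iff, Complex.norm_exp, ← Real.lt_log_iff_exp_lt hr]
      exact hz
  rw [h]
  exact (convex_halfSpace_re_lt _).isPreconnected.image _ Complex.continuous_exp.continuousOn

open ComplexConjugate in
/-- An isolated singularity of a smooth conformal map, at which it is continuous, is removable. -/
lemma analyticAt_or_conj_of_conformal {K : ℂ → ℂ} (hK : ContinuousAt K 0)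
    (hs : ∀ᶠ z in 𝓝 0, z ≠ 0 → ContDiffAt ℝ ∞ K z ∧ ConformalAt K z) :
    AnalyticAt ℂ K 0 ∨ AnalyticAt ℂ (fun z => conj (K z)) 0 := by
  obtain ⟨r, hr, hball⟩ := Metric.eventually_nhds_iff_ball.1 hs
  have hopen : IsOpen (Metric.ball (0 : ℂ) r \ {0}) :=
    Metric.isOpen_ball.sdiff isClosed_singleton
  have hev : ∀ᶠ z in 𝓝[≠] (0 : ℂ), z ∈ Metric.ball (0 : ℂ) r \ {0} := by
    filter_upwards [self_mem_nhdsWithin, nhdsWithin_le_nhds (Metric.ball_mem_nhds _ hr)]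
      with z hz hz' using ⟨hz', hz⟩
  refine (differentiableOn_or_conj_of_conformal hopen (isPreconnected_punctured_ball r)
    (fun z hz => (hball z hz.1 hz.2).1) (fun z hz => (hball z hz.1 hz.2).2)).imp
    (fun h => ?_) (fun h => ?_)
  · exact Complex.analyticAt_of_differentiable_on_punctured_nhds_of_continuousAt
      (hev.mono fun z hz => h.differentiableAt (hopen.mem_nhds hz)) hK
  · exact Complex.analyticAt_of_differentiable_on_punctured_nhds_of_continuousAt
      (hev.mono fun z hz => h.differentiableAt (hopen.mem_nhds hz))
      (Complex.continuous_conj.continuousAt.comp hK)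

/-! ### The harmonic morphism -/

lemma hasFDerivAt_comp_complex {V : Type} [NormedAddCommGroup V] [NormedSpace ℝ V] {Φ : ℂ → ℂ}
    {d : ℂ} {f : V → ℂ} {f' : V →L[ℝ] ℂ} {w : V} (hΦ : HasDerivAt Φ d (f w))
    (hf : HasFDerivAt f f' w) : HasFDerivAt (fun w => Φ (f w)) (d • f') w := by
  refine ((hΦ.hasFDerivAt.restrictScalars ℝ).comp w hf).congr_fderiv ?_
  ext v
  simp [mul_comm]

namespace ModelFibration

variable {X Y E E' : Type} [MetricSpace X] [MetricSpace Y] [NormedAddCommGroup E]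
  [InnerProductSpace ℝ E] [NormedAddCommGroup E'] [InnerProductSpace ℝ E'] [ChartedSpace R3 X]
  {ι : X → E} {κ : Y → E'} {π : X → Y} {leaves : Set (Set X)} {isReflection : (Y ≃ᵢ Y) → Prop}
  (𝓜 : ModelFibration ι κ π leaves isReflection) {Γ : Subgroup (X ≃ᵢ X)}

/-- The real part of a holomorphic function of `Q` has Laplacian zero at the origin, since the
components of `Q` are harmonic there and its differential is conformal on the complement of its
kernel. -/
lemma laplacian_re_comp_Q {Φ : ℂ → ℂ} (hΦ : AnalyticAt ℂ Φ 0) :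
    ∑ i, partialDeriv i (partialDeriv i fun w => (Φ (𝓜.Q w)).re) 0 = 0 := by
  have hQc : ContinuousAt 𝓜.Q 0 := 𝓜.contDiffAt_Q.continuousAt
  have hΦ' := hΦ
  rw [← 𝓜.Q_zero] at hΦ'
  have hQ1 : ∀ᶠ w in 𝓝 0, DifferentiableAt ℝ 𝓜.Q w :=
    ((𝓜.contDiffAt_Q.of_le (m := 1) (by simp)).eventually (by simp)).mono fun w hw =>
      hw.differentiableAt (by simp)
  have h1 : ∀ i : Fin 3, partialDeriv i (fun w => (Φ (𝓜.Q w)).re) =ᶠ[𝓝 0] fun w =>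
      (deriv Φ (𝓜.Q w) * fderiv ℝ 𝓜.Q w (EuclideanSpace.single i 1)).re := by
    intro i
    filter_upwards [hQ1, hQc.eventually hΦ'.eventually_analyticAt] with w hw hw2
    have h2 := Complex.reCLM.hasFDerivAt.comp w
      (hasFDerivAt_comp_complex hw2.differentiableAt.hasDerivAt hw.hasFDerivAt)
    rw [partialDeriv]
    change fderiv ℝ (Complex.reCLM ∘ fun w => Φ (𝓜.Q w)) w _ = _
    rw [h2.fderiv]
    simp
  have h2 : ∀ i : Fin 3, partialDeriv i (partialDeriv i fun w => (Φ (𝓜.Q w)).re) 0 =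
      (deriv Φ 0 * fderiv ℝ (fun w => fderiv ℝ 𝓜.Q w (EuclideanSpace.single i 1)) 0
        (EuclideanSpace.single i 1) + fderiv ℝ 𝓜.Q 0 (EuclideanSpace.single i 1) *
        (deriv (deriv Φ) 0 * fderiv ℝ 𝓜.Q 0 (EuclideanSpace.single i 1))).re := by
    intro i
    rw [partialDeriv, (h1 i).fderiv_eq]
    have hd1 : HasFDerivAt (fun w => deriv Φ (𝓜.Q w)) (deriv (deriv Φ) 0 • fderiv ℝ 𝓜.Q 0) 0 := by
      refine hasFDerivAt_comp_complex ?_ hQ1.self_of_nhds.hasFDerivAt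
      rw [𝓜.Q_zero]
      exact hΦ.deriv.differentiableAt.hasDerivAt
    have hd2 : DifferentiableAt ℝ (fun w => fderiv ℝ 𝓜.Q w (EuclideanSpace.single i 1)) 0 :=
      ((𝓜.contDiffAt_Q.fderiv_right (m := ∞) (by simp)).differentiableAt (by simp)).clm_apply
        (differentiableAt_const _)
    have hd3 := Complex.reCLM.hasFDerivAt.comp (0 : R3) (hd1.mul hd2.hasFDerivAt)
    change fderiv ℝ (Complex.reCLM ∘ fun w => deriv Φ (𝓜.Q w) *
      fderiv ℝ 𝓜.Q w (EuclideanSpace.single i 1)) 0 _ = _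
    refine (congrArg (fun f : R3 →L[ℝ] ℝ => f (EuclideanSpace.single i 1)) hd3.fderiv).trans ?_
    simp [𝓜.Q_zero]
  -- the first order terms contribute `Φ''(0) c² (1² + i² + 0²) = 0`
  simp only [h2]
  rw [← Complex.re_sum, Finset.sum_add_distrib, ← Finset.mul_sum, 𝓜.laplacian_Q]
  simp only [𝓜.fderiv_Q, Fin.sum_univ_three]
  simp

variable [LocallyCompactSpace Y] [SecondCountableTopology Y]
  (hΓ : PreservesLeaves Γ leaves) (hΔ : ActsDiscontinuously (descendedGroup π Γ))
  (hrot : 𝓜.B.ActsByRotations (descendedGroup π Γ))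
  [ChartedSpace R3 (OrbitSpace Γ)] (𝒜 : AdaptedAtlas 𝓜.C Γ)
  [ChartedSpace ℂ (OrbitSpace (descendedGroup π Γ))]
  (hL : (𝓜.B.quotientOrbifold hΔ).IsSmoothedBy)

include hrot hL

/-- In the charts of a smoothing, the projection to the leaf space is locally a holomorphic
function of `Q`, or the conjugate of one. -/
lemma exists_descend_eq (m : OrbitSpace Γ)
    {ψ : OpenPartialHomeomorph (OrbitSpace (descendedGroup π Γ)) ℂ}
    (hψ : ψ ∈ atlas ℂ (OrbitSpace (descendedGroup π Γ))) (hm : 𝓜.descend hΓ m ∈ ψ.source) :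
    ∃ H : ℂ → ℂ, AnalyticAt ℂ H 0 ∧
      ((∀ᶠ w in 𝓝 0, ψ (𝓜.descend hΓ (orbitProj Γ (𝓜.C.param (𝒜.lift m) w))) = H (𝓜.Q w)) ∨
        ∀ᶠ w in 𝓝 0, ψ (𝓜.descend hΓ (orbitProj Γ (𝓜.C.param (𝒜.lift m) w))) =
          starRingEnd ℂ (H (𝓜.Q w))) := by
  set x := 𝒜.lift m with hx
  set p := π x with hp
  obtain ⟨R, hR⟩ := 𝓜.π_param x
  set K : ℂ → ℂ := fun z => ψ (orbitProj (descendedGroup π Γ) (𝓜.B.param p (R z))) with hK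
  have hw : ∀ᶠ w in 𝓝 0, ψ (𝓜.descend hΓ (orbitProj Γ (𝓜.C.param x w))) = K (𝓜.Q w) :=
    hR.mono fun w hw => by rw [𝓜.descend_orbitProj, hw]
  have hlp : orbitProj (descendedGroup π Γ) p ∈ ψ.source := by
    rwa [← 𝒜.orbitProj_lift m, 𝓜.descend_orbitProj] at hm
  have hcont : Continuous fun z => orbitProj (descendedGroup π Γ) (𝓜.B.param p (R z)) :=
    continuous_orbitProj.comp ((𝓜.B.continuous_param p).comp R.continuous)
  have h0 : orbitProj (descendedGroup π Γ) (𝓜.B.param p (R 0)) =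
      orbitProj (descendedGroup π Γ) p := by
    rw [map_zero, 𝓜.B.param_zero]
  have hKc : ContinuousAt K 0 := by
    refine ContinuousAt.comp (g := ψ) ?_ hcont.continuousAt
    rw [h0]
    exact ψ.continuousAt hlp
  -- near `p` the only possible cone point is `p` itself
  have hKs : ∀ᶠ z in 𝓝 0, z ≠ 0 → ContDiffAt ℝ ∞ K z ∧ ConformalAt K z := by
    have hsrc : ∀ᶠ z in 𝓝 0, orbitProj (descendedGroup π Γ) (𝓜.B.param p (R z)) ∈ ψ.source :=
      hcont.continuousAt.eventually_mem (ψ.open_source.mem_nhds (by rwa [h0]))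
    have hdisc : ∀ᶠ z in 𝓝 0, R z ∈ 𝓜.B.disc hΔ p :=
      R.continuous.continuousAt.eventually_mem ((𝓜.B.isOpen_disc hΔ p).mem_nhds (by
        rw [map_zero]; exact 𝓜.B.zero_mem_disc hΔ p))
    filter_upwards [hsrc, hdisc] with z hz hzd hz0
    have hRz : R z ≠ 0 := by simpa using hz0
    obtain ⟨h1, r, hr, h2⟩ := hL.2 _ ⟨p, rfl⟩ (R z) hzd (fun A hA h =>
      ConformalCharts.eq_one_of_fixed (hrot p A hA) hRz h) ψ hψ hz
    have h3 : ConformalAt (fun u => ψ (orbitProj (descendedGroup π Γ) (𝓜.B.param p u))) (R z) := by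
      rw [conformalAt_iff']
      refine ⟨r * confFactor 𝓜.ε' (R z), mul_pos hr (confFactor_pos 𝓜.B.nonneg _),
        fun v w => ?_⟩
      rw [mul_assoc]
      exact h2 v w
    exact ⟨ContDiffAt.comp z
      (g := fun u => ψ (orbitProj (descendedGroup π Γ) (𝓜.B.param p u))) (f := R) h1
          R.toContinuousLinearEquiv.contDiff.contDiffAt,
      ConformalAt.comp (f := R) z h3 ⟨_, R.toContinuousLinearEquiv.hasFDerivAt,
        R.toLinearIsometry.isConformalMap⟩⟩
  rcases analyticAt_or_conj_of_conformal hKc hKs with h | h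
  · exact ⟨K, h, Or.inl hw⟩
  · refine ⟨_, h, Or.inr (hw.mono fun w hw => ?_)⟩
    rw [hw, Complex.conj_conj]

variable [IsManifold (𝓡 3) ∞ (OrbitSpace Γ)]

omit [IsManifold (𝓡 3) ∞ (OrbitSpace Γ)] in
lemma contDiffAt_descend (m : OrbitSpace Γ)
    {ψ : OpenPartialHomeomorph (OrbitSpace (descendedGroup π Γ)) ℂ}
    (hψ : ψ ∈ atlas ℂ (OrbitSpace (descendedGroup π Γ))) (hm : 𝓜.descend hΓ m ∈ ψ.source) :
    ContDiffAt ℝ ∞ (fun w => ψ (𝓜.descend hΓ (orbitProj Γ (𝓜.C.param (𝒜.lift m) w)))) 0 := by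
  obtain ⟨H, hH, h⟩ := 𝓜.exists_descend_eq hΓ hΔ hrot 𝒜 hL m hψ hm
  have hHs : ContDiffAt ℝ ∞ H (𝓜.Q 0) := by
    rw [𝓜.Q_zero]
    exact hH.contDiffAt.restrict_scalars ℝ
  have hHQ : ContDiffAt ℝ ∞ (fun w => H (𝓜.Q w)) 0 := hHs.comp (0 : R3) 𝓜.contDiffAt_Q
  rcases h with h | h
  · exact hHQ.congr_of_eventuallyEq h
  · exact (Complex.conjCLE.contDiff.contDiffAt.comp (0 : R3) hHQ).congr_of_eventuallyEq h

lemma isSmoothHarmonicMorphism : IsSmoothHarmonicMorphism 𝒜.metric (𝓜.descend hΓ) := by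
  have hcont : Continuous (𝓜.descend hΓ) := (𝓜.isQuotientMap_descend hΓ).continuous
  refine ⟨fun m => ?_, fun V f hV hf => ?_⟩
  · rw [contMDiffAt_iff_target]
    refine ⟨hcont.continuousAt, ?_⟩
    have hsrc := mem_chart_source ℂ (𝓜.descend hΓ m)
    exact 𝒜.contMDiffAt_of_comp (((chartAt ℂ (𝓜.descend hΓ m)).continuousAt hsrc).comp
        hcont.continuousAt)
      (𝓜.contDiffAt_descend hΓ hΔ hrot 𝒜 hL m (chart_mem_atlas ℂ _) hsrc)
  · -- the function is locally the real part of a holomorphic function of `Q`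
    have key : ∀ m ∈ 𝓜.descend hΓ ⁻¹' V, ContinuousAt f (𝓜.descend hΓ m) ∧
        ∃ Φ : ℂ → ℂ, AnalyticAt ℂ Φ 0 ∧
          (fun w => f (𝓜.descend hΓ (orbitProj Γ (𝓜.C.param (𝒜.lift m) w)))) =ᶠ[𝓝 0]
            fun w => (Φ (𝓜.Q w)).re := by
      intro m hm
      set l := 𝓜.descend hΓ m with hl
      set ψ := chartAt ℂ l with hψ
      have hsrc : l ∈ ψ.source := mem_chart_source ℂ l
      have hψa : ψ ∈ atlas ℂ (OrbitSpace (descendedGroup π Γ)) := chart_mem_atlas ℂ l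
      have hopen : IsOpen (ψ.target ∩ ψ.symm ⁻¹' V) := ψ.isOpen_inter_preimage_symm hV
      have hz0 : ψ l ∈ ψ.target ∩ ψ.symm ⁻¹' V :=
        ⟨ψ.map_source hsrc, by rwa [Set.mem_preimage, ψ.left_inv hsrc]⟩
      obtain ⟨r, hr, hball⟩ := Metric.isOpen_iff.1 hopen _ hz0
      have hharm := (hf ψ hψa).mono hball
      obtain ⟨F, hF, hFf⟩ := hharm.exists_analyticOnNhd_ball_re_eq
      have hfc : ContinuousAt f l := by
        have h1 : ContinuousAt (f ∘ ψ.symm) (ψ l) := (hf ψ hψa _ hz0).1.continuousAt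
        have h2 : ContinuousAt ((f ∘ ψ.symm) ∘ ψ) l := h1.comp (ψ.continuousAt hsrc)
        refine h2.congr ?_
        filter_upwards [ψ.open_source.mem_nhds hsrc] with y hy
        simp only [Function.comp_apply, ψ.left_inv hy]
      refine ⟨hfc, ?_⟩
      obtain ⟨H, hH, h⟩ := 𝓜.exists_descend_eq hΓ hΔ hrot 𝒜 hL m hψa hsrc
      have hlim : Filter.Tendsto (fun w => 𝓜.descend hΓ (orbitProj Γ (𝓜.C.param (𝒜.lift m) w)))
          (𝓝 0) (𝓝 l) := by
        have h1 := (hcont.comp (continuous_orbitProj (Γ := Γ))).continuousAt.tendsto.comp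
          (𝓜.C.tendsto_param (𝒜.lift m))
        rwa [Function.comp_apply, 𝒜.orbitProj_lift] at h1
      have hev : ∀ᶠ w in 𝓝 0, f (𝓜.descend hΓ (orbitProj Γ (𝓜.C.param (𝒜.lift m) w))) =
          (F (ψ (𝓜.descend hΓ (orbitProj Γ (𝓜.C.param (𝒜.lift m) w))))).re := by
        filter_upwards [hlim.eventually (ψ.open_source.mem_nhds hsrc),
          ((ψ.continuousAt hsrc).tendsto.comp hlim).eventually (Metric.ball_mem_nhds _ hr)]
          with w hw1 hw2
        have h2 := hFf hw2
        simp only [Function.comp_apply] at h2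
        rw [h2]
        exact congrArg f (ψ.left_inv hw1).symm
      have hlift0 : 𝓜.descend hΓ (orbitProj Γ (𝓜.C.param (𝒜.lift m) 0)) = l := by
        rw [𝓜.C.param_zero, 𝒜.orbitProj_lift]
      rcases h with h | h
      · have hH0 : H 0 = ψ l := by
          have := h.self_of_nhds
          rw [𝓜.Q_zero, hlift0] at this
          exact this.symm
        have hFH : AnalyticAt ℂ F (H 0) := by
          rw [hH0]
          exact hF _ (Metric.mem_ball_self hr)
        refine ⟨fun z => F (H z), hFH.comp hH, ?_⟩
        filter_upwards [h, hev] with w h1 h2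
        rw [h2, h1]
      · have hH0 : starRingEnd ℂ (H 0) = ψ l := by
          have := h.self_of_nhds
          rw [𝓜.Q_zero, hlift0] at this
          exact this.symm
        have hH0' : H 0 = starRingEnd ℂ (ψ l) := by rw [← hH0, Complex.conj_conj]
        -- `z ↦ conj (F (conj z))` is holomorphic and has the same real part as `F ∘ conj`
        have hFc : AnalyticAt ℂ (fun z => starRingEnd ℂ (F (starRingEnd ℂ z))) (H 0) := by
          rw [Complex.analyticAt_iff_eventually_differentiableAt, hH0']
          have h1 : ∀ᶠ z in 𝓝 (ψ l), DifferentiableAt ℂ F z :=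
            (hF _ (Metric.mem_ball_self hr)).eventually_analyticAt.mono fun z hz =>
              hz.differentiableAt
          have h2 : Filter.Tendsto (starRingEnd ℂ) (𝓝 (starRingEnd ℂ (ψ l))) (𝓝 (ψ l)) := by
            have := Complex.continuous_conj.tendsto (starRingEnd ℂ (ψ l))
            rwa [Complex.conj_conj] at this
          filter_upwards [h2.eventually h1] with z hz
          have h3 := hz.conj_conj
          rwa [Complex.conj_conj] at h3
        refine ⟨fun z => starRingEnd ℂ (F (starRingEnd ℂ (H z))), hFc.comp hH, ?_⟩
        filter_upwards [h, hev] with w h1 h2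
        rw [h2, h1, Complex.conj_re]
    refine ⟨fun m hm => ?_, fun m hm => ?_⟩
    · obtain ⟨hfc, Φ, hΦ, h⟩ := key m hm
      have hΦs : ContDiffAt ℝ 2 Φ (𝓜.Q 0) := by
        rw [𝓜.Q_zero]
        exact hΦ.contDiffAt.restrict_scalars ℝ
      have hQ2 : ContDiffAt ℝ 2 𝓜.Q 0 := contDiffAt_infty.1 𝓜.contDiffAt_Q 2
      have hΦQ : ContDiffAt ℝ 2 (fun w => (Φ (𝓜.Q w)).re) 0 :=
        Complex.reCLM.contDiff.contDiffAt.comp (0 : R3) (hΦs.comp (0 : R3) hQ2)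
      exact (𝒜.contMDiffAt_of_comp (hfc.comp hcont.continuousAt)
        (hΦQ.congr_of_eventuallyEq h)).contMDiffWithinAt
    · obtain ⟨-, Φ, hΦ, h⟩ := key m hm
      rw [𝒜.laplaceBeltrami_eq, ← 𝓜.laplacian_re_comp_Q hΦ]
      refine Finset.sum_congr rfl fun i _ => ?_
      have h1 : partialDeriv i (fun w => f (𝓜.descend hΓ (orbitProj Γ
          (𝓜.C.param (𝒜.lift m) w)))) =ᶠ[𝓝 0] partialDeriv i fun w => (Φ (𝓜.Q w)).re := by
        filter_upwards [h.fderiv (𝕜 := ℝ)] with w hw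
        rw [partialDeriv, partialDeriv, hw]
      exact congrArg (fun L : R3 →L[ℝ] ℝ => L (EuclideanSpace.single i 1)) h1.fderiv_eq

end ModelFibration

/-! ### The quotient of a model fibration -/

namespace ModelFibration

variable {X Y E E' : Type} [MetricSpace X] [MetricSpace Y] [NormedAddCommGroup E]
  [InnerProductSpace ℝ E] [NormedAddCommGroup E'] [InnerProductSpace ℝ E'] [ChartedSpace R3 X]
  {ι : X → E} {κ : Y → E'} {π : X → Y} {leaves : Set (Set X)} {isReflection : (Y ≃ᵢ Y) → Prop}

/-- If no element of the group is a reflection fixing a point, the stabilizers act by rotations. -/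
lemma actsByRotations (𝓜 : ModelFibration ι κ π leaves isReflection) {Δ : Subgroup (Y ≃ᵢ Y)}
    (h : ∀ p : Y, ∀ b ∈ Δ, b p = p → ¬ isReflection b) : 𝓜.B.ActsByRotations Δ := by
  rintro p A ⟨b, hb, hp, hA⟩
  by_contra hdet
  exact h p b hb hp (𝓜.isReflection_of_det b p A hA hdet)

/-- All the assertions about the quotient of a model fibration by a discrete group of isometries
that acts freely and preserves the fibres. -/
theorem quotient_harmonic_morphism (𝓜 : ModelFibration ι κ π leaves isReflection)
    [ProperSpace X] [SecondCountableTopology X] [ConnectedSpace X] [LocallyCompactSpace Y]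
    [SecondCountableTopology Y] (Γ : Subgroup (X ≃ᵢ X)) (hd : IsDiscreteGroup Γ)
    (hfree : ActsFreely Γ) (hΓ : PreservesLeaves Γ leaves) :
    (∃ ρ : Γ →* (Y ≃ᵢ Y),
      (∀ (a : Γ) (x : X), π ((a : X ≃ᵢ X) x) = ρ a (π x)) ∧ ρ.range = descendedGroup π Γ) ∧
    ∃ (_ : ChartedSpace R3 (OrbitSpace Γ)) (_ : IsManifold (𝓡 3) ∞ (OrbitSpace Γ))
      (g : RiemMetric 3 (OrbitSpace Γ))
      (ϖ : OrbitSpace Γ → OrbitSpace (descendedGroup π Γ)),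
      IsRiemannianQuotient ι (orbitProj Γ) g ∧
      ConnectedSpace (OrbitSpace Γ) ∧ IsGeodesicallyComplete g ∧
      (∀ x : X, ϖ (orbitProj Γ x) = orbitProj (descendedGroup π Γ) (π x)) ∧
      (∃ D : ∀ x : OrbitSpace Γ, Submodule ℝ (TangentSpace (𝓡 3) x),
        IsRiemannianFoliationByGeodesics g 2 D (quotientLeaves Γ leaves)) ∧
      IsLeafSpace (quotientLeaves Γ leaves) ϖ ∧
      ((∀ p : Y, ∀ b ∈ descendedGroup π Γ, b p = p → ¬ isReflection b) →
        ActsDiscontinuously (descendedGroup π Γ) →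
        Continuous ϖ ∧
        ∃ O : RiemannianOrbifold (OrbitSpace (descendedGroup π Γ)),
          O.IsQuotientOf κ (orbitProj (descendedGroup π Γ)) ∧
          O.OnlyConePoints ∧
          (∃ _ : ChartedSpace ℂ (OrbitSpace (descendedGroup π Γ)), O.IsSmoothedBy) ∧
          ∀ _ : ChartedSpace ℂ (OrbitSpace (descendedGroup π Γ)), O.IsSmoothedBy →
            IsSmoothHarmonicMorphism g ϖ) := by
  have hdisc := hd.actsDiscontinuously
  have hcov := hdisc.isCoveringMap_orbitProj hfree
  let _ := quotientChartedSpace 𝓜.C hcov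
  have := isManifold_quotient 𝓜.C hcov
  let 𝒜 := quotientAdaptedAtlas 𝓜.C hcov
  refine ⟨𝓜.exists_descentHom hΓ, quotientChartedSpace 𝓜.C hcov, isManifold_quotient 𝓜.C hcov,
    𝒜.metric, 𝓜.descend hΓ,
    𝒜.isRiemannianQuotient hdisc hfree 𝓜.contMDiffOn_chart 𝓜.contMDiff_param,
    orbitProj_surjective.connectedSpace continuous_orbitProj, 𝓜.isGeodesicallyComplete 𝒜,
    𝓜.descend_orbitProj hΓ, ⟨_, 𝓜.isRiemannianFoliationByGeodesics 𝒜 hcov hΓ⟩,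
    𝓜.isLeafSpace hΓ, fun hrefl hΔ => ?_⟩
  have hrot := 𝓜.actsByRotations hrefl
  exact ⟨(𝓜.isQuotientMap_descend hΓ).continuous, 𝓜.B.quotientOrbifold hΔ, 𝓜.B.isQuotientOf hΔ,
    𝓜.B.onlyConePoints hΔ hrot, ⟨_, 𝓜.B.isSmoothedBy_smoothing hΔ hrot⟩,
    fun _ hL => 𝓜.isSmoothHarmonicMorphism hΓ hΔ hrot 𝒜 hL⟩

end ModelFibration

instance : ConnectedSpace S3 :=
  Subtype.connectedSpace (isConnected_sphere (by
    rw [← Module.finrank_eq_rank, finrank_euclideanSpace_fin]; norm_num) _ zero_le_one)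

end StandardFoliation

end

theorem theorem3p1 :
    -- Euclidean case: orthogonal projection of `ℝ³` and the foliation by vertical lines
    (∀ Γ : Subgroup (R3 ≃ᵢ R3), IsDiscreteGroup Γ → ActsFreely Γ →
      PreservesLeaves Γ verticalLines →
      (∃ ρ : Γ →* (R2 ≃ᵢ R2),
        (∀ (a : Γ) (x : R3), orthProj ((a : R3 ≃ᵢ R3) x) = ρ a (orthProj x)) ∧
        ρ.range = descendedGroup orthProj Γ) ∧
      ∃ (_ : ChartedSpace R3 (OrbitSpace Γ)) (_ : IsManifold (𝓡 3) ∞ (OrbitSpace Γ))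
        (g : RiemMetric 3 (OrbitSpace Γ))
        (ϖ : OrbitSpace Γ → OrbitSpace (descendedGroup orthProj Γ)),
        IsRiemannianQuotient (id : R3 → R3) (orbitProj Γ) g ∧
        ConnectedSpace (OrbitSpace Γ) ∧ IsGeodesicallyComplete g ∧
        (∀ x : R3, ϖ (orbitProj Γ x) = orbitProj (descendedGroup orthProj Γ) (orthProj x)) ∧
        (∃ D : ∀ x : OrbitSpace Γ, Submodule ℝ (TangentSpace (𝓡 3) x),
          IsRiemannianFoliationByGeodesics g 2 D (quotientLeaves Γ verticalLines)) ∧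
        IsLeafSpace (quotientLeaves Γ verticalLines) ϖ ∧
        ((∀ p : R2, ∀ b ∈ descendedGroup orthProj Γ, b p = p → ¬ IsPlaneReflection b) →
          ActsDiscontinuously (descendedGroup orthProj Γ) →
          Continuous ϖ ∧
          ∃ O : RiemannianOrbifold (OrbitSpace (descendedGroup orthProj Γ)),
            O.IsQuotientOf (id : R2 → R2) (orbitProj (descendedGroup orthProj Γ)) ∧
            O.OnlyConePoints ∧
            (∃ _ : ChartedSpace ℂ (OrbitSpace (descendedGroup orthProj Γ)), O.IsSmoothedBy) ∧
            ∀ _ : ChartedSpace ℂ (OrbitSpace (descendedGroup orthProj Γ)), O.IsSmoothedBy →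
              IsSmoothHarmonicMorphism g ϖ)) ∧
    -- spherical case: the Hopf map of `S³` and the foliation by Hopf circles
    (∀ Γ : Subgroup (S3 ≃ᵢ S3), IsDiscreteGroup Γ → ActsFreely Γ →
      PreservesLeaves Γ hopfCircles →
      (∃ ρ : Γ →* (S2 ≃ᵢ S2),
        (∀ (a : Γ) (x : S3), hopfMap ((a : S3 ≃ᵢ S3) x) = ρ a (hopfMap x)) ∧
        ρ.range = descendedGroup hopfMap Γ) ∧
      ∃ (_ : ChartedSpace R3 (OrbitSpace Γ)) (_ : IsManifold (𝓡 3) ∞ (OrbitSpace Γ))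
        (g : RiemMetric 3 (OrbitSpace Γ))
        (ϖ : OrbitSpace Γ → OrbitSpace (descendedGroup hopfMap Γ)),
        IsRiemannianQuotient (Subtype.val : S3 → R4) (orbitProj Γ) g ∧
        ConnectedSpace (OrbitSpace Γ) ∧ IsGeodesicallyComplete g ∧
        (∀ x : S3, ϖ (orbitProj Γ x) = orbitProj (descendedGroup hopfMap Γ) (hopfMap x)) ∧
        (∃ D : ∀ x : OrbitSpace Γ, Submodule ℝ (TangentSpace (𝓡 3) x),
          IsRiemannianFoliationByGeodesics g 2 D (quotientLeaves Γ hopfCircles)) ∧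
        IsLeafSpace (quotientLeaves Γ hopfCircles) ϖ ∧
        ((∀ p : S2, ∀ b ∈ descendedGroup hopfMap Γ, b p = p → ¬ IsSphereReflection b) →
          ActsDiscontinuously (descendedGroup hopfMap Γ) →
          Continuous ϖ ∧
          ∃ O : RiemannianOrbifold (OrbitSpace (descendedGroup hopfMap Γ)),
            O.IsQuotientOf (Subtype.val : S2 → R3) (orbitProj (descendedGroup hopfMap Γ)) ∧
            O.OnlyConePoints ∧
            (∃ _ : ChartedSpace ℂ (OrbitSpace (descendedGroup hopfMap Γ)), O.IsSmoothedBy) ∧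
            ∀ _ : ChartedSpace ℂ (OrbitSpace (descendedGroup hopfMap Γ)), O.IsSmoothedBy →
              IsSmoothHarmonicMorphism g ϖ)) := by
  exact ⟨fun Γ hd hfree hΓ => planeFibration.quotient_harmonic_morphism Γ hd hfree hΓ,
    fun Γ hd hfree hΓ => hopfFibration.quotient_harmonic_morphism Γ hd hfree hΓ⟩
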